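/- All varieties are varieties of monoids; words are elements of the free monoid over a countably infinite alphabet, and $S_k$ denotes the group of permutations of $\{1,\dots,k\}$, acting on the right. For $n,m\ge 0$ let $S_{n,m}$ be the set of all $\rho\in S_{n+m}$ such that, for every $1\le i\le n+m-1$, exactly one of $i\rho$, $(i+1)\rho$ is at most $n$. For $\rho\in S_{n+m}$ put \[ \hat{\mathbf a}_{n,m}[\rho]:=\Bigl(\prod_{i=1}^n z_it_i\Bigr)\,x\,\Bigl(\prod_{i=1}^{n+m} z_{i\rho}\Bigr)\,x\,\Bigl(\prod_{i=n+1}^{n+m} t_iz_i\Bigr),\qquad \hat{\mathbf a}'_{n,m}[\rho]:=\Bigl(\prod_{i=1}^n z_it_i\Bigr)\Bigl(\prod_{i=1}^{n+m} z_{i\rho}\Bigr)\,x^2\,\Bigl(\prod_{i=n+1}^{n+m} t_iz_i\Bigr), \] where empty products are the empty word. Let $\mathbf K$ be the class of all monoids that satisfy the five identities \[ yx^2ty\approx xyx^2ty,\quad x^2yx\approx x^2yx^2,\quad ytyx^2\approx ytxyx^2,\quad xyzxy\approx yxzxy,\quad xyzxy\approx xyzyx \] and violate the identity $\hat{\mathbf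 a}_{n,m}[\pi]\approx\hat{\mathbf a}'_{n,m}[\pi]$ for some $n,m\ge 0$ with $|n-m|\le 1$ and some $\pi\in S_{n,m}$. Proposition. If $\mathbf V$ is the variety generated by a monoid in $\mathbf K$, then the lattice of subvarieties of $\mathbf V$ is not distributive. -/

import Mathlib

universe u

namespace MonVar

/-! ### Words and identities -/

/-- Words over the countably infinite alphabet `ℕ`: elements of the free monoid. -/
abbrev Word : Type := FreeMonoid ℕ

/-- An identity `u ≈ v` is a pair of words. -/
abbrev Identity : Type := Word × Word

/-- The monoid `M` satisfies the identity `u ≈ v`: every substitution of elements of `M` for the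
letters gives `u` and `v` the same value. -/
def Satisfies (M : Type u) [Monoid M] (e : Identity) : Prop :=
  ∀ φ : ℕ → M, FreeMonoid.lift φ e.1 = FreeMonoid.lift φ e.2

/-- The set of all identities satisfied by `M`. -/
def identitiesOf (M : Type u) [Monoid M] : Set Identity :=
  {e | Satisfies M e}

/-! ### Varieties of monoids and their lattice -/

/-- A variety of monoids: a class of monoids which is the class of all monoids that satisfy some
set of identities. -/
@[ext]
structure Variety where
  carrier : Set MonCat.{u}
  equational : ∃ S : Set Identity, carrier = {M : MonCat.{u} | ∀ e ∈ S, Satisfies M e}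

namespace Variety

/-- The variety `var S` given by a set `S` of identities. -/
def ofIdentities (S : Set Identity) : Variety.{u} where
  carrier := {M : MonCat.{u} | ∀ e ∈ S, Satisfies M e}
  equational := ⟨S, rfl⟩

/-- The identities satisfied by (all members of) a variety. -/
def identities (V : Variety.{u}) : Set Identity :=
  {e | ∀ M ∈ V.carrier, Satisfies M e}

/-- Varieties are ordered by inclusion. -/
instance : PartialOrder Variety.{u} :=
  PartialOrder.lift Variety.carrier (fun _ _ h => Variety.ext h)

theorem le_iff {V W : Variety.{u}} : V ≤ W ↔ V.carrier ⊆ W.carrier := Iff.rfl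

theorem le_ofIdentities_iff {V : Variety.{u}} {S : Set Identity} :
    V ≤ ofIdentities S ↔ S ⊆ V.identities :=
  ⟨fun h e he M hM => h hM e he, fun h M hM e he => h he M hM⟩

theorem ofIdentities_le_of_subset {W : Variety.{u}} {S : Set Identity}
    (h : W.identities ⊆ S) : ofIdentities S ≤ W := by
  obtain ⟨T, hT⟩ := W.equational
  intro M hM
  rw [hT]
  intro e he
  refine hM e (h ?_)
  intro N hN
  rw [hT] at hN
  exact hN e he

/-- The lattice of all monoid varieties: the meet is the intersection, the join is the smallest
variety containing both, i.e. the one given by all common identities. -/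
instance : Lattice Variety.{u} where
  inf V W :=
    { carrier := V.carrier ∩ W.carrier
      equational := by
        obtain ⟨S, hS⟩ := V.equational
        obtain ⟨T, hT⟩ := W.equational
        refine ⟨S ∪ T, ?_⟩
        rw [hS, hT]
        ext M
        simp only [Set.mem_inter_iff, Set.mem_ofPred_eq, Set.mem_union]
        exact ⟨fun h e he => he.elim (h.1 e) (h.2 e),
          fun h => ⟨fun e he => h e (Or.inl he), fun e he => h e (Or.inr he)⟩⟩ }
  inf_le_left _ _ := fun _ hM => hM.1
  inf_le_right _ _ := fun _ hM => hM.2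
  le_inf _ _ _ h₁ h₂ := fun _ hM => ⟨h₁ hM, h₂ hM⟩
  sup V W := ofIdentities (V.identities ∩ W.identities)
  le_sup_left _ _ := le_ofIdentities_iff.2 Set.inter_subset_left
  le_sup_right _ _ := le_ofIdentities_iff.2 Set.inter_subset_right
  sup_le _ _ _ h₁ h₂ := ofIdentities_le_of_subset fun _ he =>
    ⟨fun M hM => he M (h₁ hM), fun M hM => he M (h₂ hM)⟩

/-- The variety generated by the monoid `M`: the class of all monoids that satisfy every identity
of `M`. -/
def generatedBy (M : Type u) [Monoid M] : Variety.{u} :=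
  ofIdentities (identitiesOf M)

/-- The variety generated by `M` is the smallest variety containing `M`. -/
theorem isLeast_generatedBy (M : Type u) [Monoid M] :
    IsLeast {W : Variety.{u} | MonCat.of M ∈ W.carrier} (generatedBy M) :=
  ⟨fun _ he => he, fun _ hW => ofIdentities_le_of_subset fun _ he => he _ hW⟩

/-- The lattice of subvarieties of `V`, with the operations of the lattice of all varieties. -/
abbrev SubvarietyLattice (V : Variety.{u}) : Type (u + 1) := Set.Iic V

end Variety

/-- A lattice is distributive. -/
def IsDistributive (L : Type*) [Lattice L] : Prop :=
  ∀ a b c : L, a ⊓ (b ⊔ c) = (a ⊓ b) ⊔ (a ⊓ c)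

/-! ### The words and the class of monoids -/

/-- The letter `x`. -/
def x : Word := FreeMonoid.of 0

/-- The letter `y`. -/
def y : Word := FreeMonoid.of 1

/-- The letter `z`. -/
def z : Word := FreeMonoid.of 2

/-- The letter `t`. -/
def t : Word := FreeMonoid.of 3

/-- The letters `z₀, z₁, z₂, …` (indexed from `0`). -/
def zi (i : ℕ) : Word := FreeMonoid.of (2 * i + 4)

/-- The letters `t₀, t₁, t₂, …` (indexed from `0`). -/
def ti (i : ℕ) : Word := FreeMonoid.of (2 * i + 5)

/-- `(z₁t₁)(z₂t₂)⋯(zₙtₙ)`. -/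
def prefixWord (n : ℕ) : Word :=
  (List.ofFn fun i : Fin n => zi i * ti i).prod

/-- `z_{1ρ}z_{2ρ}⋯z_{(n+m)ρ}`. -/
def middleWord (n m : ℕ) (ρ : Equiv.Perm (Fin (n + m))) : Word :=
  (List.ofFn fun i : Fin (n + m) => zi (ρ i)).prod

/-- `(t_{n+1}z_{n+1})(t_{n+2}z_{n+2})⋯(t_{n+m}z_{n+m})`. -/
def suffixWord (n m : ℕ) : Word :=
  (List.ofFn fun j : Fin m => ti (n + j) * zi (n + j)).prod

/-- The word `â_{n,m}[ρ]`. -/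
def aHat (n m : ℕ) (ρ : Equiv.Perm (Fin (n + m))) : Word :=
  prefixWord n * x * middleWord n m ρ * x * suffixWord n m

/-- The word `â′_{n,m}[ρ]`. -/
def aHat' (n m : ℕ) (ρ : Equiv.Perm (Fin (n + m))) : Word :=
  prefixWord n * middleWord n m ρ * x ^ 2 * suffixWord n m

/-- `ρ` is an `(n,m)`-permutation: of any two consecutive values of `ρ`, exactly one is among the
first `n` indices and the other among the last `m`. -/
def IsNMPerm (n m : ℕ) (ρ : Equiv.Perm (Fin (n + m))) : Prop :=
  ∀ i j : Fin (n + m), (j : ℕ) = i + 1 →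
    ((ρ i : ℕ) < n ∧ n ≤ (ρ j : ℕ)) ∨ ((ρ j : ℕ) < n ∧ n ≤ (ρ i : ℕ))

/-- The class `K` of monoids. -/
structure ClassK (M : Type u) [Monoid M] : Prop where
  id₁ : Satisfies M (y * x ^ 2 * t * y, x * y * x ^ 2 * t * y)
  id₂ : Satisfies M (x ^ 2 * y * x, x ^ 2 * y * x ^ 2)
  id₃ : Satisfies M (y * t * y * x ^ 2, y * t * x * y * x ^ 2)
  id₄ : Satisfies M (x * y * z * x * y, y * x * z * x * y)
  id₅ : Satisfies M (x * y * z * x * y, x * y * z * y * x)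
  violates : ∃ (n m : ℕ) (ρ : Equiv.Perm (Fin (n + m))),
    |(n : ℤ) - (m : ℤ)| ≤ 1 ∧ IsNMPerm n m ρ ∧ ¬ Satisfies M (aHat n m ρ, aHat' n m ρ)

end MonVar

namespace KVariety

/-! A label `i` is either of prefix type (`s i = true`) or of suffix type. The words studied have
the form `P r Z₁ v Z₂ v Z₃ q S`, with `v` one of `x`, `y`. The middle lists letters `z i`, and the
second copy of each `z i` stands next to `t i`, in the prefix `P` or in the suffix `S` according to
type. A violation of an identity from the class `K` says that, for some list `Z` alternating in
type, `v Z v` cannot be turned into `Z v v`. A minimal violated list `D` is chosen (`Good`): its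
tail and its initial part do collapse.

Non-distributivity is seen on four words. A copy `N` of `D` is enlarged by a twin `g` of its first
label and a twin `h` of its last one. `wordA` has the middle `x z_g y N x z_h y`; moving the first
`x`, the first `y` or both to their second occurrences gives `wordAx`, `wordAy`, `wordAxy`. Let `A`,
`B`, `D` be generated by the syntactic monoids of `ClassXY`, `ClassX`, `ClassY`, which are
subvarieties of the given variety. Since `ClassXY` is an intersection of preimages of the other two
languages under deletions, `A ≤ B ⊔ D`. In `A ⊓ B` one has `wordA ≈ wordAy` (from `B`) and `wordAy ≈
wordAxy` (from `A`); in `A ⊓ D` one has `wordA ≈ wordAx` and `wordAx ≈ wordAxy`. Distributivity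
would give `A = (A ⊓ B) ⊔ (A ⊓ D)`, hence `wordA ≈ wordAxy` in `A`. But `ClassXY` contains `wordA`
and not `wordAxy`.

The work lies in these identities: under every substitution and in every context, a factor `Q Ω Q`
must be replaceable by `Ω Q Q` without leaving the language. Three ingredients carry this.

The normal form, `Pattern.form`. The invariant is `Killed`: being equivalent to the word in which
`v` is doubled. The five identities make a word killed as soon as `v²` appears in a suitable place,
while the word of a violated pattern is not killed. So words equivalent to the word of a pattern
still have exactly two `v` in the middle, enclosing the same set of labels. The label outside cannot
slip in: otherwise a pattern enclosing only a proper factor would be equivalent to one enclosing all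
of it, and the twin label would carry this over to a violated pattern.

The dichotomy, `Pattern.transfer`. The replacement is an equivalence of `M`, unless `Q` is `v`
itself and `Ω` is exactly the part between the two `v` (`Critical`).

Critical factors do not arise. For one special letter (`Config.not_critical_y`,
`Config.not_critical_x`), the images of the labels would give a type-preserving monotone shift along
the list, contradicting `g < n₁` and `h < n₂`. For both special letters (`not_critical_of_both`),
some `z j` would have a two-letter image containing the other special letter; the identities `xyzxy
≈ yxzxy` and `xyzxy ≈ xyzyx` swap these letters and contradict the normal form. -/

/-- The letters used in the words of the proof. -/
inductive Letter : Type
  | x | y | r | q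
  | z (i : ℕ)
  | t (i : ℕ)
  deriving DecidableEq

open Letter List

/-- `M` satisfies the identity `u ≈ v` between words over `Letter`. -/
def Eqv (M : Type u) [Monoid M] (u v : List Letter) : Prop :=
  ∀ φ : Letter → M, (u.map φ).prod = (v.map φ).prod

/-- The five identities defining the class `K`, on the level of elements. -/
structure Basic (M : Type u) [Monoid M] : Prop where
  a1 : ∀ x y t : M, y * (x * (x * (t * y))) = x * (y * (x * (x * (t * y))))
  a2 : ∀ x y : M, x * (x * (y * x)) = x * (x * (y * (x * x)))
  a3 : ∀ x y t : M, y * (t * (y * (x * x))) = y * (t * (x * (y * (x * x))))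
  a4 : ∀ x y z : M, x * (y * (z * (x * y))) = y * (x * (z * (x * y)))
  a5 : ∀ x y z : M, x * (y * (z * (x * y))) = x * (y * (z * (y * x)))

/-! ### Equivalence of words modulo a monoid; deletion and doubling of a letter -/

section Eqv

variable {M : Type u} [Monoid M]

theorem Eqv.refl (u : List Letter) : Eqv M u u := fun _ => rfl

theorem Eqv.of_eq {u v : List Letter} (h : u = v) : Eqv M u v := h ▸ Eqv.refl u

theorem Eqv.symm {u v : List Letter} (h : Eqv M u v) : Eqv M v u := fun φ => (h φ).symm

theorem Eqv.trans {u v w : List Letter} (h : Eqv M u v) (h' : Eqv M v w) : Eqv M u w :=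
  fun φ => (h φ).trans (h' φ)

theorem Eqv.left (a : List Letter) {u v : List Letter} (h : Eqv M u v) :
    Eqv M (a ++ u) (a ++ v) := fun φ => by simp [h φ]

theorem Eqv.right (b : List Letter) {u v : List Letter} (h : Eqv M u v) :
    Eqv M (u ++ b) (v ++ b) := fun φ => by simp [h φ]

theorem Eqv.cons (c : Letter) {u v : List Letter} (h : Eqv M u v) :
    Eqv M (c :: u) (c :: v) := h.left [c]

theorem prod_map_flatMap (φ : Letter → M) (σ : Letter → List Letter) (u : List Letter) :
    ((u.flatMap σ).map φ).prod = (u.map fun c => ((σ c).map φ).prod).prod := by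
  induction u with
  | nil => simp
  | cons a u ih => simp [ih]

/-- Full invariance. Deletion, doubling, restriction to labels and padding by `v` are all instances.
-/
theorem Eqv.subst (σ : Letter → List Letter) {u v : List Letter} (h : Eqv M u v) :
    Eqv M (u.flatMap σ) (v.flatMap σ) := fun φ => by
  rw [prod_map_flatMap, prod_map_flatMap, h]

theorem filter_eq_flatMap (p : Letter → Bool) (u : List Letter) :
    u.filter p = u.flatMap fun c => if p c then [c] else [] := by
  induction u with
  | nil => simp
  | cons a u ih => by_cases h : p a <;> simp [h, ih]

theorem Eqv.filter (p : Letter → Bool) {u v : List Letter} (h : Eqv M u v) :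
    Eqv M (u.filter p) (v.filter p) := by
  rw [filter_eq_flatMap, filter_eq_flatMap]; exact h.subst _

theorem Eqv.map (σ : Letter → Letter) {u v : List Letter} (h : Eqv M u v) :
    Eqv M (u.map σ) (v.map σ) := fun φ => by simpa using h (φ ∘ σ)

/-- Delete all occurrences of the letter `v`. -/
def del (v : Letter) (w : List Letter) : List Letter := w.filter fun c => decide (c ≠ v)

@[simp] theorem del_nil (v : Letter) : del v [] = [] := rfl
@[simp] theorem del_cons_self (v : Letter) (w) : del v (v :: w) = del v w := by simp [del]
theorem del_cons_ne {v c : Letter} (h : c ≠ v) (w) : del v (c :: w) = c :: del v w := by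
  simp [del, h]
@[simp] theorem del_append (v : Letter) (a b) : del v (a ++ b) = del v a ++ del v b := by
  simp [del]
@[simp] theorem mem_del {v c : Letter} {w} : c ∈ del v w ↔ c ∈ w ∧ c ≠ v := by simp [del]

theorem del_eq_self {v : Letter} {w : List Letter} (h : v ∉ w) : del v w = w := by
  rw [del, List.filter_eq_self]
  intro c hc; simp; rintro rfl; exact h hc

/-- Double all occurrences of the letter `v`. -/
def dbl (v : Letter) (w : List Letter) : List Letter :=
  w.flatMap fun c => if c = v then [v, v] else [c]

@[simp] theorem dbl_nil (v : Letter) : dbl v [] = [] := rfl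
@[simp] theorem dbl_cons_self (v : Letter) (w) : dbl v (v :: w) = v :: v :: dbl v w := by
  simp [dbl]
theorem dbl_cons_ne {v c : Letter} (h : c ≠ v) (w) : dbl v (c :: w) = c :: dbl v w := by
  simp [dbl, h]
@[simp] theorem dbl_append (v : Letter) (a b) : dbl v (a ++ b) = dbl v a ++ dbl v b := by
  simp [dbl]
@[simp] theorem mem_dbl {v c : Letter} {w} : c ∈ dbl v w ↔ c ∈ w := by
  induction w with
  | nil => simp
  | cons d w ih =>
    by_cases h : d = v
    · subst h; simp [ih]
    · simp [dbl_cons_ne h, ih]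

theorem dbl_eq_self {v : Letter} {w : List Letter} (h : v ∉ w) : dbl v w = w := by
  induction w with
  | nil => rfl
  | cons c w ih =>
    simp only [mem_cons, not_or] at h
    rw [dbl_cons_ne (Ne.symm h.1), ih h.2]

theorem del_dbl (v : Letter) (w) : del v (dbl v w) = del v w := by
  induction w with
  | nil => rfl
  | cons c w ih =>
    by_cases h : c = v
    · subst h; simp [ih]
    · simp [dbl_cons_ne h, del_cons_ne h, ih]

theorem dbl_filter (v : Letter) (p : Letter → Bool) (w) :
    dbl v (w.filter p) = (dbl v w).filter p := by
  induction w with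
  | nil => rfl
  | cons c w ih =>
    by_cases h : c = v
    · subst h; by_cases hp : p c <;> simp [hp, ih]
    · by_cases hp : p c <;> simp [hp, ih, dbl_cons_ne h]

/-- The word `w` is equivalent to the word obtained from it by doubling the letter `v`. -/
def Killed (M : Type u) [Monoid M] (v : Letter) (w : List Letter) : Prop := Eqv M w (dbl v w)

/-- Doubling is a substitution, so being killed is invariant under equivalence. This makes it the
invariant by which violated patterns are told apart. -/
theorem Killed.congr {v : Letter} {w w' : List Letter} (h : Eqv M w w') (hk : Killed M v w') :
    Killed M v w :=
  (h.trans hk).trans (h.symm.subst _)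

theorem Killed.filter {v : Letter} {w : List Letter} (p : Letter → Bool) (hk : Killed M v w) :
    Killed M v (w.filter p) := by
  unfold Killed; rw [dbl_filter]; exact Eqv.filter p hk

end Eqv

/-! ### Squares under the five identities -/

namespace Basic

variable {M : Type u} [Monoid M] (hM : Basic M)
include hM

theorem sq (x : M) : x * (x * x) = x * x := by
  simpa using (hM.a1 x 1 1).symm

theorem pow_eq (x : M) {n : ℕ} (hn : 2 ≤ n) : x ^ n = x * x := by
  induction n, hn using Nat.le_induction with
  | base => exact pow_two x
  | succ n _ ih => rw [pow_succ', ih, hM.sq]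

theorem three (a b : List Letter) (v : Letter) :
    Eqv M (a ++ v :: v :: v :: b) (a ++ v :: v :: b) := fun φ => by
  have := congrArg (fun m => (a.map φ).prod * (m * (b.map φ).prod)) (hM.sq (φ v))
  simpa only [map_append, map_cons, prod_append, prod_cons, mul_assoc] using this

/-- The other occurrence of `c` plays the outer `y` of the third identity if it lies to the left,
and of the first identity if it lies to the right. -/
theorem absorb {a b : List Letter} {c : Letter} (v : Letter) (h : c ∈ a ∨ c ∈ b) :
    Eqv M (a ++ c :: v :: v :: b) (a ++ v :: c :: v :: v :: b) := by
  intro φ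
  rcases h with h | h
  · obtain ⟨a1, a2, rfl⟩ := List.append_of_mem h
    have := hM.a3 (φ v) (φ c) (a2.map φ).prod
    have := congrArg (fun m => (a1.map φ).prod * (m * (b.map φ).prod)) this
    simpa only [map_append, map_cons, prod_append, prod_cons, mul_assoc] using this
  · obtain ⟨b1, b2, rfl⟩ := List.append_of_mem h
    have := hM.a1 (φ v) (φ c) (b1.map φ).prod
    have := congrArg (fun m => (a.map φ).prod * (m * (b2.map φ).prod)) this
    simpa only [map_append, map_cons, prod_append, prod_cons, mul_assoc] using this

/-- A square can be copied to the left over a letter that occurs elsewhere. The copy clears the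
occurrences of `v` further left, and is then taken back in the same way. -/
theorem absorb_left {v : Letter} (α : List Letter) : ∀ {a b : List Letter},
    (∀ c ∈ α, c = v ∨ c ∈ a ∨ c ∈ b) →
    Eqv M (a ++ (α ++ v :: v :: b)) (a ++ (del v α ++ v :: v :: b)) := by
  induction α using List.reverseRecOn with
  | nil => intro a b _; exact Eqv.refl _
  | append_singleton α c ih =>
    intro a b h
    by_cases hc : c = v
    · subst hc
      simp only [append_assoc, singleton_append, del_append, del_cons_self, del_nil, append_nil]
      refine Eqv.trans ?_ (ih fun d hd => h d (by simp [hd]))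
      simpa using hM.three (a ++ α) b c
    · have hc' := (h c (by simp)).resolve_left hc
      simp only [append_assoc, singleton_append, del_append, del_cons_ne hc, del_nil]
      have e : ∀ a', (∀ d ∈ a, d ∈ a') → Eqv M (a' ++ (c :: v :: v :: b))
          (a' ++ v :: v :: c :: v :: v :: b) := by
        intro a' ha'
        have e1 : c ∈ a' ∨ c ∈ b := hc'.imp_left (ha' c)
        have := hM.absorb v e1
        refine this.trans ?_
        have := hM.absorb (a := a' ++ [v]) (b := b) v (c := c) (e1.imp_left (by simp +contextual))
        simpa using this
      have e2 := e (a ++ α) (by simp +contextual)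
      have e3 := e (a ++ del v α) (by simp +contextual)
      simp only [append_assoc] at e2 e3
      refine e2.trans (Eqv.trans ?_ e3.symm)
      exact ih fun d hd => by
        rcases h d (by simp [hd]) with h | h | h
        · exact Or.inl h
        · exact Or.inr (Or.inl h)
        · exact Or.inr (Or.inr (by simp [h]))

/-- Behind a square, the second identity doubles each further occurrence of `v`. -/
theorem dbl_right {v : Letter} (a β : List Letter) :
    Eqv M (a ++ v :: v :: β) (a ++ v :: v :: dbl v β) := by
  induction β using List.reverseRecOn with
  | nil => exact Eqv.refl _
  | append_singleton β c ih =>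
    have ih' := ih.right [c]
    simp only [append_assoc, cons_append] at ih'
    by_cases hc : c = v
    · subst hc
      refine ih'.trans ?_
      intro φ
      have := hM.a2 (φ c) ((dbl c β).map φ).prod
      simp [this]
    · simpa [dbl_cons_ne hc] using ih'

/-- Occurrences behind the square are doubled by `dbl_right`; those before it, in the word and in
its doubled form alike, disappear by `absorb_left`. -/
theorem killed_of_square {v : Letter} {a α β : List Letter} (ha : v ∉ a)
    (h : ∀ c ∈ α, c = v ∨ c ∈ a ∨ c ∈ β) : Killed M v (a ++ (α ++ v :: v :: β)) := by
  unfold Killed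
  simp only [dbl_append, dbl_eq_self ha, dbl_cons_self]
  have h1 := hM.absorb_left α (v := v) (a := a) (b := β) h
  have h2 := hM.dbl_right (v := v) (a ++ del v α) β
  simp only [append_assoc] at h2
  have h3 := hM.absorb_left (dbl v α) (v := v) (a := a) (b := v :: v :: dbl v β)
    (fun c hc => by
      rcases h c (by simpa using hc) with h | h | h
      · exact Or.inl h
      · exact Or.inr (Or.inl h)
      · exact Or.inr (Or.inr (by simp [h])))
  rw [del_dbl] at h3
  refine (h1.trans h2).trans (Eqv.trans ?_ h3.symm)
  have h4 := hM.three (a ++ del v α) (v :: dbl v β) v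
  have h5 := hM.three (a ++ del v α) (dbl v β) v
  simpa using (h4.trans h5).symm

end Basic

/-- The identity `vtv² ≈ v²tv²`. -/
def SatQ (M : Type u) [Monoid M] : Prop := ∀ v t : M, v * (t * (v * v)) = v * (v * (t * (v * v)))

/-- The identity `v²t ≈ v²tv²`. -/
def SatR (M : Type u) [Monoid M] : Prop := ∀ v t : M, v * (v * t) = v * (v * (t * (v * v)))

/-! ### Squares under `SatQ` and under `SatR` -/

namespace Basic

variable {M : Type u} [Monoid M] (hM : Basic M)
include hM

/-- With `SatQ` occurrences before the square can be doubled as well, so no condition on the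
surrounding letters is needed. -/
theorem killed_of_satQ (hQ : SatQ M) {v : Letter} (α β : List Letter) :
    Killed M v (α ++ v :: v :: β) := by
  unfold Killed
  have e : ∀ α γ, Eqv M (α ++ v :: v :: γ) (dbl v α ++ v :: v :: γ) := by
    intro α
    induction α with
    | nil => intro γ; exact Eqv.refl _
    | cons c α ih =>
      intro γ
      by_cases hc : c = v
      · subst hc
        have : Eqv M (c :: (α ++ c :: c :: γ)) (c :: c :: (α ++ c :: c :: γ)) := fun φ => by
          have := congrArg (fun m => m * (γ.map φ).prod) (hQ (φ c) (α.map φ).prod)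
          simpa only [map_append, map_cons, prod_append, prod_cons, mul_assoc] using this
        simpa using this.trans (((ih γ).cons c).cons c)
      · simpa [dbl_cons_ne hc] using (ih γ).cons c
  have h2 := hM.dbl_right (v := v) α β
  have h3 := e α (dbl v β)
  simp only [dbl_append, dbl_cons_self]
  refine (h2.trans h3).trans ?_
  have h4 := hM.three (dbl v α) (v :: dbl v β) v
  have h5 := hM.three (dbl v α) (dbl v β) v
  exact (h4.trans h5).symm

theorem del_right (hR : SatR M) {v : Letter} (a β : List Letter) :
    Eqv M (a ++ v :: v :: β) (a ++ v :: v :: del v β) := by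
  induction β using List.reverseRecOn with
  | nil => exact Eqv.refl _
  | append_singleton β c ih =>
    by_cases hc : c = v
    · subst hc
      have : Eqv M (a ++ c :: c :: (β ++ [c])) (a ++ c :: c :: β) := fun φ => by
        have := hM.a2 (φ c) (β.map φ).prod
        have h' := hR (φ c) (β.map φ).prod
        simp [this, ← h']
      simpa using this.trans ih
    · simpa [del_cons_ne hc] using ih.right [c]

end Basic

/-! ### Label lists -/

/-- The labels in `Z` satisfying `s`, in increasing order. -/
def lab (s : ℕ → Bool) (Z : List ℕ) : List ℕ := (Z.filter s).insertionSort (· ≤ ·)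

theorem lab_perm (s : ℕ → Bool) (Z : List ℕ) : (lab s Z).Perm (Z.filter s) :=
  List.perm_insertionSort _ _

@[simp] theorem mem_lab {s : ℕ → Bool} {Z : List ℕ} {i : ℕ} : i ∈ lab s Z ↔ i ∈ Z ∧ s i = true := by
  rw [(lab_perm s Z).mem_iff, List.mem_filter]

theorem lab_nodup {s : ℕ → Bool} {Z : List ℕ} (h : Z.Nodup) : (lab s Z).Nodup :=
  (lab_perm s Z).nodup_iff.2 (h.filter _)

theorem lab_pairwise {s : ℕ → Bool} {Z : List ℕ} (h : Z.Nodup) :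
    (lab s Z).Pairwise (· < ·) := by
  have h1 : (lab s Z).Pairwise (· ≤ ·) := List.pairwise_insertionSort _ _
  exact (h1.and (lab_nodup h)).imp fun h => lt_of_le_of_ne h.1 h.2

theorem eq_of_pairwise_lt {l l' : List ℕ} (h : l.Pairwise (· < ·)) (h' : l'.Pairwise (· < ·))
    (hm : ∀ i, i ∈ l ↔ i ∈ l') : l = l' := by
  have hp : l.Perm l' := (List.perm_ext_iff_of_nodup (h.imp ne_of_lt) (h'.imp ne_of_lt)).2 hm
  exact hp.eq_of_pairwise (le := (· < ·)) (fun a b _ _ h1 h2 => absurd h1 (lt_asymm h2)) h h'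

theorem lab_filter {s p : ℕ → Bool} {Z : List ℕ} (h : Z.Nodup) :
    (lab s Z).filter p = lab s (Z.filter p) := by
  refine eq_of_pairwise_lt ((lab_pairwise h).filter _) (lab_pairwise (h.filter _)) fun i => ?_
  simp; tauto

theorem lab_congr {s : ℕ → Bool} {Z Z' : List ℕ} (h : Z.Nodup) (hp : Z.Perm Z') :
    lab s Z = lab s Z' :=
  eq_of_pairwise_lt (lab_pairwise h) (lab_pairwise (hp.nodup_iff.1 h)) fun i => by
    simp [hp.mem_iff]

theorem lab_map {s s' : ℕ → Bool} {Z : List ℕ} (h : Z.Nodup) {ρ : ℕ → ℕ}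
    (hρ : StrictMonoOn ρ {i | i ∈ Z}) (hs : ∀ i ∈ Z, s' (ρ i) = s i) :
    lab s' (Z.map ρ) = (lab s Z).map ρ := by
  refine eq_of_pairwise_lt (lab_pairwise (h.map_on fun i hi j hj e => hρ.injOn hi hj e)) ?_ ?_
  · rw [List.pairwise_map]
    refine (lab_pairwise h).imp_of_mem fun hi hj hij => hρ ?_ ?_ hij
    · exact (mem_lab.1 hi).1
    · exact (mem_lab.1 hj).1
  · intro i
    simp only [mem_lab, List.mem_map]
    constructor
    · rintro ⟨⟨j, hj, rfl⟩, h⟩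
      exact ⟨j, ⟨hj, by rw [← hs j hj, h]⟩, rfl⟩
    · rintro ⟨j, ⟨hj, hj'⟩, rfl⟩
      exact ⟨⟨j, hj, rfl⟩, by rw [hs j hj, hj']⟩

/-! ### Words attached to label lists -/

/-- The word `z_{i₁}t_{i₁}z_{i₂}t_{i₂}⋯`. -/
def ztWord (l : List ℕ) : List Letter := l.flatMap fun i => [z i, t i]

/-- The word `t_{i₁}z_{i₁}t_{i₂}z_{i₂}⋯`. -/
def tzWord (l : List ℕ) : List Letter := l.flatMap fun i => [t i, z i]

@[simp] theorem ztWord_nil : ztWord [] = [] := rfl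
@[simp] theorem tzWord_nil : tzWord [] = [] := rfl
@[simp] theorem ztWord_cons (i l) : ztWord (i :: l) = z i :: t i :: ztWord l := rfl
@[simp] theorem tzWord_cons (i l) : tzWord (i :: l) = t i :: z i :: tzWord l := rfl
@[simp] theorem mem_ztWord {c : Letter} {l} : c ∈ ztWord l ↔ ∃ i ∈ l, c = z i ∨ c = t i := by
  simp [ztWord]
@[simp] theorem mem_tzWord {c : Letter} {l} : c ∈ tzWord l ↔ ∃ i ∈ l, c = t i ∨ c = z i := by
  simp [tzWord]

/-- The prefix `P` of the pattern `Z`: its letters of type `s`. -/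
def pre (s : ℕ → Bool) (Z : List ℕ) : List Letter := ztWord (lab s Z)

/-- The suffix `S` of the pattern `Z`: its letters not of type `s`. -/
def suf (s : ℕ → Bool) (Z : List ℕ) : List Letter := tzWord (lab (fun i => !s i) Z)

/-- The word `P r (z⋯z) v (z⋯z) v (z⋯z) q S`. -/
def word (s : ℕ → Bool) (v : Letter) (Z₁ Z₂ Z₃ : List ℕ) : List Letter :=
  pre s (Z₁ ++ (Z₂ ++ Z₃)) ++ r :: (Z₁.map z ++ v :: (Z₂.map z ++ v :: (Z₃.map z ++
    q :: suf s (Z₁ ++ (Z₂ ++ Z₃)))))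

/-- Restriction of a word to the letters with labels satisfying `p` (and all letters without
label). -/
def keep (p : ℕ → Bool) : Letter → Bool
  | z i => p i
  | t i => p i
  | _ => true

theorem filter_ztWord (p : ℕ → Bool) (l) : (ztWord l).filter (keep p) = ztWord (l.filter p) := by
  induction l with
  | nil => rfl
  | cons i l ih => by_cases h : p i <;> simp [h, keep, ih]

theorem filter_tzWord (p : ℕ → Bool) (l) : (tzWord l).filter (keep p) = tzWord (l.filter p) := by
  induction l with
  | nil => rfl
  | cons i l ih => by_cases h : p i <;> simp [h, keep, ih]

theorem filter_map_z (p : ℕ → Bool) (l : List ℕ) :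
    (l.map z).filter (keep p) = (l.filter p).map z := by
  induction l with
  | nil => rfl
  | cons i l ih => by_cases h : p i <;> simp [h, keep, ih]

theorem filter_pre {s p : ℕ → Bool} {Z} (h : Z.Nodup) :
    (pre s Z).filter (keep p) = pre s (Z.filter p) := by
  rw [pre, filter_ztWord, lab_filter h, pre]

theorem filter_suf {s p : ℕ → Bool} {Z} (h : Z.Nodup) :
    (suf s Z).filter (keep p) = suf s (Z.filter p) := by
  rw [suf, filter_tzWord, lab_filter h, suf]

theorem filter_word {s p : ℕ → Bool} {v : Letter} (hv : v = x ∨ v = y) {Z₁ Z₂ Z₃ : List ℕ}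
    (h : (Z₁ ++ (Z₂ ++ Z₃)).Nodup) : (word s v Z₁ Z₂ Z₃).filter (keep p) =
      word s v (Z₁.filter p) (Z₂.filter p) (Z₃.filter p) := by
  have : keep p v = true := by rcases hv with rfl | rfl <;> rfl
  have hr : keep p r = true := rfl
  have hq : keep p q = true := rfl
  simp only [word, List.filter_append, List.filter_cons, this, hr, hq, if_true, filter_pre h,
    filter_suf h, filter_map_z]

/-! ### Satisfaction of the identities attached to patterns -/

section

variable (M : Type u) [Monoid M]

/-- `M` satisfies the identity which collapses the pattern `Z`, stated in all contexts. -/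
def Collapses (s : ℕ → Bool) (Z : List ℕ) : Prop :=
  ∀ (a b : List Letter) (v : Letter), (lab s Z).map z <+ a → (lab (fun i => !s i) Z).map z <+ b →
    Eqv M (a ++ v :: (Z.map z ++ v :: b)) (a ++ (Z.map z ++ v :: v :: b))

/-- `M` satisfies every collapsing identity. -/
def Trivializes : Prop :=
  ∀ (a b Z : List Letter) (v : Letter), (∀ c ∈ Z, c ∈ a ∨ c ∈ b) →
    Eqv M (a ++ v :: (Z ++ v :: b)) (a ++ (Z ++ v :: v :: b))

variable {M}

/-- The gaps behind the marked letters `z i` become the values of `t i`, which exhibits `a` as a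
substitution instance of `ztWord l` up to an initial part. -/
theorem sublist_zt_decomp {l : List ℕ} (hl : l.Nodup) : ∀ {a : List Letter}, l.map z <+ a →
    ∃ (s₀ : List Letter) (φ : ℕ → List Letter), a = s₀ ++ l.flatMap fun i => z i :: φ i := by
  induction l with
  | nil => intro a _; exact ⟨a, fun _ => [], by simp⟩
  | cons i l ih =>
    intro a h
    rw [List.map_cons, List.cons_sublist_iff] at h
    obtain ⟨r1, r2, rfl, hi, h⟩ := h
    obtain ⟨p, p', rfl⟩ := List.append_of_mem hi
    obtain ⟨s₀, φ, rfl⟩ := ih hl.of_cons h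
    refine ⟨p, fun j => if j = i then p' ++ s₀ else φ j, ?_⟩
    have : (l.flatMap fun j => z j :: if j = i then p' ++ s₀ else φ j) =
        l.flatMap fun j => z j :: φ j := by
      refine List.flatMap_congr fun j hj => ?_
      have : j ≠ i := fun e => (List.nodup_cons.1 hl).1 (e ▸ hj)
      simp [this]
    simp [this]

theorem sublist_tz_decomp {l : List ℕ} (hl : l.Nodup) : ∀ {a : List Letter}, l.map z <+ a →
    ∃ (s₀ : List Letter) (φ : ℕ → List Letter), a = (l.flatMap fun i => φ i ++ [z i]) ++ s₀ := by
  induction l with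
  | nil => intro a _; exact ⟨a, fun _ => [], by simp⟩
  | cons i l ih =>
    intro a h
    rw [List.map_cons, List.cons_sublist_iff] at h
    obtain ⟨r1, r2, rfl, hi, h⟩ := h
    obtain ⟨p, p', rfl⟩ := List.append_of_mem hi
    obtain ⟨s₀, φ, h⟩ := ih hl.of_cons (h.trans (List.sublist_append_right p' r2))
    refine ⟨s₀, fun j => if j = i then p else φ j, ?_⟩
    have : (l.flatMap fun j => (if j = i then p else φ j) ++ [z j]) =
        l.flatMap fun j => φ j ++ [z j] := by
      refine List.flatMap_congr fun j hj => ?_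
      have : j ≠ i := fun e => (List.nodup_cons.1 hl).1 (e ▸ hj)
      simp [this]
    simp [this, h]

theorem flatMap_map_z (Z : List ℕ) (σ : Letter → List Letter) (h : ∀ i, σ (z i) = [z i]) :
    (Z.map z).flatMap σ = Z.map z := by
  induction Z with
  | nil => rfl
  | cons i Z ih => simp [h, ih]

/-- One word identity gives the collapse in all contexts: `r` and `q` are erased, `x` becomes `v`,
and each `t i` becomes the gap next to the marked `z i`. -/
theorem Collapses.of_eqv {s : ℕ → Bool} {Z : List ℕ} (hZ : Z.Nodup)
    (h : Eqv M (word s x [] Z []) (pre s Z ++ r :: (Z.map z ++ x :: x :: q :: suf s Z))) :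
    Collapses M s Z := by
  intro a b v ha hb
  obtain ⟨a₀, φ, rfl⟩ := sublist_zt_decomp (lab_nodup hZ) ha
  obtain ⟨b₀, ψ, rfl⟩ := sublist_tz_decomp (lab_nodup hZ) hb
  let σ : Letter → List Letter := fun c => match c with
    | x => [v] | y => [] | r => [] | q => [] | z i => [z i]
    | t i => if s i then φ i else ψ i
  have key := ((h.subst σ).left a₀).right b₀
  have hz := flatMap_map_z Z σ fun _ => rfl
  have e1 : (pre s Z).flatMap σ = (lab s Z).flatMap fun i => z i :: φ i := by
    rw [pre, ztWord, List.flatMap_assoc]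
    refine List.flatMap_congr fun i hi => ?_
    simp [σ, (mem_lab.1 hi).2]
  have e2 : (suf s Z).flatMap σ = (lab (fun i => !s i) Z).flatMap fun i => ψ i ++ [z i] := by
    rw [suf, tzWord, List.flatMap_assoc]
    refine List.flatMap_congr fun i hi => ?_
    have := (mem_lab.1 hi).2
    simp only [Bool.not_eq_true'] at this
    simp [σ, this]
  have hx : σ x = [v] := rfl
  have hr : σ r = [] := rfl
  have hq : σ q = [] := rfl
  simpa [word, e1, e2, hz, hx, hr, hq] using key

theorem map_z_sublist_ztWord (l : List ℕ) : l.map z <+ ztWord l := by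
  induction l with
  | nil => simp
  | cons i l ih => exact (ih.cons (t i)).cons_cons (z i)

theorem map_z_sublist_tzWord (l : List ℕ) : l.map z <+ tzWord l := by
  induction l with
  | nil => simp
  | cons i l ih => exact (ih.cons_cons (z i)).cons (t i)

theorem Collapses.eqv {s : ℕ → Bool} {Z : List ℕ} (h : Collapses M s Z) (v : Letter) :
    Eqv M (word s v [] Z []) (pre s Z ++ r :: (Z.map z ++ v :: v :: q :: suf s Z)) := by
  have := h (pre s Z ++ [r]) (q :: suf s Z) v
    ((map_z_sublist_ztWord _).trans (List.sublist_append_left _ _))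
    ((map_z_sublist_tzWord _).trans (List.sublist_cons_self _ _))
  simpa [word] using this

/-- Erasing `z i` and `t i` removes the label `i` from the identity. -/
theorem Collapses.filter {s : ℕ → Bool} {Z : List ℕ} (hZ : Z.Nodup) (h : Collapses M s Z)
    (p : ℕ → Bool) : Collapses M s (Z.filter p) := by
  refine .of_eqv (hZ.filter _) ?_
  have := (h.eqv x).filter (keep p)
  rw [filter_word (Or.inl rfl) (by simpa using hZ)] at this
  simpa [List.filter_append, List.filter_cons, filter_pre hZ, filter_suf hZ, filter_map_z,
    keep] using this

theorem filter_mem_of_sublist {I Z : List ℕ} (hZ : Z.Nodup) (h : I <+ Z) :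
    Z.filter (fun i => decide (i ∈ I)) = I := by
  induction h with
  | slnil => rfl
  | @cons l₁ l₂ a h ih =>
    have ha : a ∉ l₁ := fun hh => (List.nodup_cons.1 hZ).1 (h.subset hh)
    rw [List.filter_cons_of_neg (by simpa using ha), ih hZ.of_cons]
  | @cons_cons l₁ l₂ a h ih =>
    rw [List.filter_cons_of_pos (by simp)]
    congr 1
    rw [← ih hZ.of_cons]
    refine List.filter_congr fun i hi => ?_
    have : i ≠ a := fun e => (List.nodup_cons.1 hZ).1 (e ▸ hi)
    have h' := ih hZ.of_cons
    simp [this, h']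

theorem Collapses.sublist {s : ℕ → Bool} {I Z : List ℕ} (hZ : Z.Nodup) (h : Collapses M s Z)
    (hI : I <+ Z) : Collapses M s I := by
  rw [← filter_mem_of_sublist hZ hI]; exact h.filter hZ _

/-- Labels enter only through their type and through the increasing order used in prefix and suffix,
so renaming the letters suffices. -/
theorem Collapses.relabel {s s' : ℕ → Bool} {Z : List ℕ} (hZ : Z.Nodup) (h : Collapses M s Z)
    {ρ : ℕ → ℕ} (hρ : StrictMonoOn ρ {i | i ∈ Z}) (hs : ∀ i ∈ Z, s' (ρ i) = s i) :
    Collapses M s' (Z.map ρ) := by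
  refine .of_eqv (hZ.map_on fun i hi j hj e => hρ.injOn hi hj e) ?_
  let σ : Letter → Letter := fun c => match c with
    | z i => z (ρ i) | t i => t (ρ i) | c => c
  have := (h.eqv x).map σ
  have e1 : ∀ l : List ℕ, (ztWord l).map σ = ztWord (l.map ρ) := by
    intro l; induction l with
    | nil => rfl
    | cons i l ih => simp [ih, σ]
  have e2 : ∀ l : List ℕ, (tzWord l).map σ = tzWord (l.map ρ) := by
    intro l; induction l with
    | nil => rfl
    | cons i l ih => simp [ih, σ]
  have e3 : ∀ l : List ℕ, (l.map z).map σ = (l.map ρ).map z := by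
    intro l; simp [σ]
  have e4 : (pre s Z).map σ = pre s' (Z.map ρ) := by
    rw [pre, e1, pre, lab_map hZ hρ hs]
  have e5 : (suf s Z).map σ = suf s' (Z.map ρ) := by
    rw [suf, e2, suf, lab_map (s := fun i => !s i) hZ hρ fun i hi => by simp [hs i hi]]
  have hx : σ x = x := rfl
  have hr : σ r = r := rfl
  have hq : σ q = q := rfl
  simp only [word, nil_append, append_nil, map_append, map_cons, map_nil, e3, e4, e5, hx, hr,
    hq] at this ⊢
  exact this

theorem collapses_nil (s : ℕ → Bool) : Collapses M s [] := fun _ _ _ _ _ => Eqv.refl _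

theorem mem_of_lab_sublist {s : ℕ → Bool} {Z : List ℕ} {a b : List Letter}
    (ha : (lab s Z).map z <+ a) (hb : (lab (fun i => !s i) Z).map z <+ b) :
    ∀ c ∈ Z.map z, c ∈ a ∨ c ∈ b := by
  intro c hc
  obtain ⟨i, hi, rfl⟩ := List.mem_map.1 hc
  by_cases h : s i = true
  · exact Or.inl (ha.subset (List.mem_map_of_mem (mem_lab.2 ⟨hi, h⟩)))
  · exact Or.inr (hb.subset (List.mem_map_of_mem (mem_lab.2 ⟨hi, by simpa using h⟩)))

theorem Trivializes.collapses (h : Trivializes M) (s Z) : Collapses M s Z := fun a b v ha hb => by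
  exact h a b (Z.map z) v (mem_of_lab_sublist ha hb)

/-- If the collapsing identity of `Z` fails, the word of the pattern `Z` is not killed. -/
theorem Collapses.of_killed (hM : Basic M) {s : ℕ → Bool} {v : Letter} (hv : v = x ∨ v = y)
    {Z : List ℕ} (hZ : Z.Nodup) (h : Killed M v (word s v [] Z [])) : Collapses M s Z := by
  refine .of_eqv hZ ?_
  have hp : v ∉ pre s Z := by rcases hv with rfl | rfl <;> simp [pre]
  have hs : v ∉ suf s Z := by rcases hv with rfl | rfl <;> simp [suf]
  have hz : v ∉ Z.map z := by rcases hv with rfl | rfl <;> simp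
  have hr : r ≠ v := by rcases hv with rfl | rfl <;> simp
  have hq : q ≠ v := by rcases hv with rfl | rfl <;> simp
  -- In the doubled word `v v Z v v` the second square absorbs the first, which leaves `Z v v`.
  have h1 := hM.absorb_left (v := v) (v :: v :: Z.map z) (a := pre s Z ++ [r]) (b := q :: suf s Z)
    (by
      intro c hc
      simp only [mem_cons] at hc
      rcases hc with rfl | rfl | hc
      · simp
      · simp
      · have := mem_of_lab_sublist (map_z_sublist_ztWord (lab s Z))
          (map_z_sublist_tzWord (lab (fun i => !s i) Z)) c hc
        right
        rcases this with h | h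
        · left; exact List.mem_append_left _ h
        · right; exact List.mem_cons_of_mem _ h)
  unfold Killed at h
  simp only [word, nil_append, append_nil, map_nil, dbl_append, dbl_cons_ne hr, dbl_cons_ne hq,
    dbl_cons_self, dbl_eq_self hp, dbl_eq_self hs, dbl_eq_self hz] at h
  simp only [del_cons_self, del_eq_self hz, append_assoc, cons_append] at h1
  have key := h.trans h1
  let σ : Letter → Letter := fun c => if c = v then x else c
  have key' := key.map σ
  have hσ : ∀ l : List Letter, v ∉ l → l.map σ = l := by
    intro l hl
    refine (List.map_congr_left fun c hc => ?_).trans (List.map_id l)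
    have : c ≠ v := fun e => hl (e ▸ hc)
    simp [σ, this]
  have hσv : σ v = x := by simp [σ]
  have hσr : σ r = r := by simp [σ, hr]
  have hσq : σ q = q := by simp [σ, hq]
  simpa only [word, nil_append, append_nil, map_nil, map_append, map_cons, hσ _ hp, hσ _ hs,
    hσ _ hz, hσv, hσr, hσq] using key'

end

variable {M : Type u} [Monoid M]

/-! ### Identities failing in a nontrivial monoid -/

/-- Once `v Z v` becomes `vⁿ Z v v`, the trailing square absorbs the initial power. -/
theorem Basic.trivializes_of (hM : Basic M)
    (h : ∀ (a Z b : List Letter) (v : Letter), ∃ n : ℕ,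
      Eqv M (a ++ v :: (Z ++ v :: b)) (a ++ (List.replicate n v ++ (Z ++ v :: v :: b)))) :
    Trivializes M := by
  intro a b Z v hZ
  obtain ⟨n, h⟩ := h a Z b v
  have e : ∀ n, del v (List.replicate n v) = [] := fun n => by simp [del]
  have h1 := hM.absorb_left (v := v) (List.replicate n v ++ Z) (a := a) (b := b) (by
    intro c hc
    rcases List.mem_append.1 hc with hc | hc
    · exact Or.inl (List.eq_of_mem_replicate hc)
    · exact Or.inr (hZ c hc))
  have h2 := hM.absorb_left (v := v) Z (a := a) (b := b) fun c hc => Or.inr (hZ c hc)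
  rw [del_append, e, nil_append, append_assoc] at h1
  exact (h.trans h1).trans h2.symm

theorem Basic.trivializes_of_idem (hM : Basic M) (h : ∀ v : M, v = v * v) : Trivializes M := by
  refine hM.trivializes_of fun a Z b v => ⟨1, fun φ => ?_⟩
  have := h (φ v)
  simp only [map_append, map_cons, prod_append, prod_cons, List.replicate_one, map_nil, prod_nil,
    mul_one]
  rw [← mul_assoc (φ v) (φ v) (b.map φ).prod, ← this]

/-- As `v³ = v²`, a law equating `1` or `v` with another power makes every element idempotent. -/
theorem Basic.trivializes_of_pow (hM : Basic M) {k n : ℕ} (hk : k ≤ 1) (hkn : k ≠ n)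
    (h : ∀ v : M, v ^ k = v ^ n) : Trivializes M := by
  refine hM.trivializes_of_idem fun v => ?_
  have h1 : v * (v * v) = v * v := hM.sq v
  have hv := h v
  have hp := fun hn => hM.pow_eq v (n := n) hn
  interval_cases k
  · rcases Nat.lt_or_ge n 2 with hn | hn
    · interval_cases n
      · exact absurd rfl hkn
      · rw [pow_zero, pow_one] at hv; simp [← hv]
    · rw [hp hn, pow_zero] at hv
      rw [← hv, mul_one] at h1
      simp [h1]
  · rcases Nat.lt_or_ge n 2 with hn | hn
    · interval_cases n
      · rw [pow_zero, pow_one] at hv; simp [hv]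
      · exact absurd rfl hkn
    · rwa [hp hn, pow_one] at hv

theorem trivializes_of_comm (h : ∀ a b : M, a * b = b * a) :
    Trivializes M := by
  intro a b Z v _ φ
  have := h (φ v) (Z.map φ).prod
  simp only [map_append, map_cons, prod_append, prod_cons]
  rw [← mul_assoc (φ v) (Z.map φ).prod, this, mul_assoc]

/-- The aim is a law `ztz ≈ z^k t z²`, so that `trivializes_of` applies. The value `t = 1` gives `z²
≈ z^(m+n)`, which disposes of `m + n < 2`. -/
theorem Basic.trivializes_of_sandwich (hM : Basic M) {m n : ℕ} (hmn : ¬ (m = 1 ∧ n = 1))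
    (h : ∀ z t : M, z * (t * z) = z ^ m * (t * z ^ n)) : Trivializes M := by
  have red : (∃ k, ∀ z t : M, z * (t * z) = z ^ k * (t * (z * z))) → Trivializes M := by
    rintro ⟨k, h⟩
    refine hM.trivializes_of fun a Z b v => ⟨k, fun φ => ?_⟩
    have := congrArg (fun m => (a.map φ).prod * (m * (b.map φ).prod)) (h (φ v) (Z.map φ).prod)
    simpa only [map_append, map_cons, prod_append, prod_cons, map_replicate, prod_replicate,
      mul_assoc] using this
  have hp := fun z {n} hn => hM.pow_eq z (n := n) hn
  have h1 : ∀ z : M, z ^ 2 = z ^ (m + n) := fun z => by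
    have := h z 1
    rw [one_mul, one_mul, ← pow_add] at this
    rw [pow_two, this]
  rcases Nat.lt_or_ge n 2 with hn | hn
  · rcases Nat.lt_or_ge (m + n) 2 with h2 | h2
    · exact hM.trivializes_of_pow (by omega) (by omega) fun v => (h1 v).symm
    have hm : 2 ≤ m := by
      by_contra hm
      exact hmn (by omega)
    interval_cases n
    · refine red ⟨2, fun z t => ?_⟩
      -- The law now reads `ztz ≈ z²t`; at `z²` it gives `z²tz² = z²t`, so the right-hand side ends
      -- in a square.
      have h3 := h (z * z) t
      have h4 := h z t
      rw [pow_zero, mul_one, hp _ hm] at h3 h4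
      have : z * z * (z * z) = z * z := by
        rw [mul_assoc, hM.sq, hM.sq]
      rw [this] at h3
      rw [h4, ← h3, pow_two]
    · refine red ⟨2, fun z t => ?_⟩
      have h4 := h z t
      rw [pow_one, hp _ hm] at h4
      rw [h4, pow_two, mul_assoc, mul_assoc]
      exact hM.a2 z t
  · exact red ⟨m, fun z t => by rw [h z t, hp z hn]⟩

/-- The identity `ptpqsq ≈ ptqpsq`. -/
def SatMixed (M : Type u) [Monoid M] : Prop :=
  ∀ p q t s : M, p * (t * (p * (q * (s * q)))) = p * (t * (q * (p * (s * q))))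

/-- The identity `pqapbq ≈ qpapbq`. -/
def SatFirst (M : Type u) [Monoid M] : Prop :=
  ∀ p q a b : M, p * (q * (a * (p * (b * q)))) = q * (p * (a * (p * (b * q))))

/-- The identity `paqbpq ≈ paqbqp`. -/
def SatSecond (M : Type u) [Monoid M] : Prop :=
  ∀ p q a b : M, p * (a * (q * (b * (p * q)))) = p * (a * (q * (b * (q * p))))

theorem SatMixed.swap (h : SatMixed M) {a b : List Letter} {c d : Letter} (hc : c ∈ a)
    (hd : d ∈ b) : Eqv M (a ++ c :: d :: b) (a ++ d :: c :: b) := by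
  intro φ
  obtain ⟨a1, a2, rfl⟩ := List.append_of_mem hc
  obtain ⟨b1, b2, rfl⟩ := List.append_of_mem hd
  have := congrArg (fun m => (a1.map φ).prod * (m * (b2.map φ).prod))
    (h (φ c) (φ d) (a2.map φ).prod (b1.map φ).prod)
  simpa only [map_append, map_cons, prod_append, prod_cons, mul_assoc] using this

theorem SatMixed.move_left (h : SatMixed M) {a b : List Letter} {d : Letter} (hd : d ∈ b) :
    ∀ Y : List Letter, (∀ c ∈ Y, c ∈ a) → Eqv M (a ++ (Y ++ d :: b)) (a ++ d :: (Y ++ b)) := by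
  intro Y
  induction Y generalizing a with
  | nil => intro _; exact Eqv.refl _
  | cons c Y ih =>
    intro hY
    have h1 := ih (a := a ++ [c]) fun e he => by simp [hY e (by simp [he])]
    have h2 := h.swap (hY c (by simp)) (b := Y ++ b) (d := d) (by simp [hd])
    simp only [append_assoc, singleton_append] at h1
    exact h1.trans h2

theorem SatMixed.move_right (h : SatMixed M) {a b : List Letter} {c : Letter} (hc : c ∈ a) :
    ∀ Y : List Letter, (∀ d ∈ Y, d ∈ b) → Eqv M (a ++ c :: (Y ++ b)) (a ++ (Y ++ c :: b)) := by
  intro Y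
  induction Y generalizing a with
  | nil => intro _; exact Eqv.refl _
  | cons d Y ih =>
    intro hY
    have h1 := ih (a := a ++ [d]) (by simp [hc]) fun e he => hY e (by simp [he])
    have h2 := h.swap hc (b := Y ++ b) (d := d) (by simp [hY d (by simp)])
    simp only [append_assoc, singleton_append] at h1
    exact h2.trans h1

/-- Under `SatMixed` a letter seen before commutes with an adjacent letter seen later, so `Z` can be
sorted by this distinction. -/
theorem SatMixed.sort (h : SatMixed M) (b : List Letter) : ∀ (Z a : List Letter)
    (p : Letter → Bool), (∀ c ∈ Z, p c = true → c ∈ a) → (∀ c ∈ Z, p c = false → c ∈ b) →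
    Eqv M (a ++ (Z ++ b)) (a ++ (Z.filter p ++ (Z.filter (fun c => !p c) ++ b))) := by
  intro Z
  induction Z with
  | nil => intro a p _ _; exact Eqv.refl _
  | cons c Z ih =>
    intro a p h1 h2
    have := ih (a ++ [c]) p (fun e he hp => by simp [h1 e (by simp [he]) hp])
      (fun e he hp => h2 e (by simp [he]) hp)
    simp only [append_assoc, singleton_append] at this
    by_cases hp : p c = true
    · simpa [hp] using this
    · have hp' : p c = false := by simpa using hp
      have h3 := h.move_left (a := a) (b := Z.filter (fun c => !p c) ++ b) (d := c)
        (by simp [h2 c (by simp) hp']) (Z.filter p) fun e he => by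
          obtain ⟨he, hp⟩ := List.mem_filter.1 he
          exact h1 e (by simp [he]) hp
      simpa [hp'] using this.trans h3.symm

/-- Let `Y` be the letters of `Z` occurring in `a` and `X` the others. Both `vZv` and `Zvv` are
brought to `Y v v X`. -/
theorem Basic.trivializes_of_mixed (hM : Basic M) (h : SatMixed M) : Trivializes M := by
  intro a b Z v hZ
  let p : Letter → Bool := fun c => decide (c ∈ a)
  have hb : ∀ c ∈ Z, p c = false → c ∈ b := fun c hc hp =>
    (hZ c hc).resolve_left (by simpa [p] using hp)
  have ha : ∀ c ∈ Z.filter p, c ∈ a := fun c hc => by simpa [p] using (List.mem_filter.1 hc).2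
  have hb' : ∀ c ∈ Z.filter (fun c => !p c), c ∈ b := fun c hc => by
    obtain ⟨h1, h2⟩ := List.mem_filter.1 hc
    exact hb c h1 (by simpa using h2)
  set Y := Z.filter p with hY
  set X := Z.filter (fun c => !p c) with hX
  have e1 := h.sort (v :: b) Z (a ++ [v]) p (fun c _ hp => by
    have : c ∈ a := by simpa [p] using hp
    simp [this]) (fun c hc hp => by simp [hb c hc hp])
  have e2 := (h.move_left (a := a) (b := X ++ v :: b) (d := v) (by simp) Y ha).symm
  have e3 := (h.move_right (a := a ++ Y ++ [v]) (b := b) (c := v) (by simp) X hb').symm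
  have f1 := h.sort (v :: v :: b) Z a p (fun c _ hp => by simpa [p] using hp)
    (fun c hc hp => by simp [hb c hc hp])
  have f2 := hM.absorb_left (v := v) X (a := a ++ Y) (b := b) (fun c hc => by simp [hb' c hc])
  have f3 := hM.absorb_left (v := v) (v :: v :: X) (a := a ++ Y) (b := b) (fun c hc => by
    simp only [mem_cons] at hc
    rcases hc with rfl | rfl | hc
    · simp
    · simp
    · simp [hb' c hc])
  have f4 := (h.move_right (a := a ++ Y ++ [v, v]) (b := v :: b) (c := v) (by simp) X
    (fun c hc => by simp [hb' c hc])).symm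
  have f5 := (h.move_right (a := a ++ Y ++ [v, v, v]) (b := b) (c := v) (by simp) X hb').symm
  have f6 := hM.three (a ++ Y) (v :: X ++ b) v
  have f7 := hM.three (a ++ Y) (X ++ b) v
  simp only [append_assoc, cons_append, nil_append, del_cons_self] at *
  have E := (e1.trans e2).trans e3
  have F := f1.trans (f2.trans (f3.symm.trans (f4.trans (f5.trans (f6.trans f7)))))
  exact E.trans F.symm

/-! ### Evaluation of words in two letters -/

/-- The substitution `l ↦ m`, `c ↦ n`, all other letters to `1`. -/
def twoVal (l c : Letter) (m n : M) : Letter → M := fun e => if e = l then m else if e = c then n else 1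

theorem prod_twoVal {l c : Letter} (m n : M) {w : List Letter} (h : l ∉ w) :
    (w.map (twoVal l c m n)).prod = n ^ w.count c := by
  induction w with
  | nil => simp
  | cons e w ih =>
    simp only [mem_cons, not_or] at h
    rw [map_cons, prod_cons, ih h.2]
    by_cases hc : e = c
    · subst hc; simp [twoVal, Ne.symm h.1, pow_succ']
    · simp [twoVal, Ne.symm h.1, hc, List.count_cons_of_ne hc]

/-- A changed multiplicity would give a law `vᵏ ≈ vⁿ` with `k ≤ 1`, excluded by
`trivializes_of_pow`. -/
theorem eqv_count (hM : Basic M) (hT : ¬ Trivializes M) {u w : List Letter} (h : Eqv M u w)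
    (c : Letter) (hc : u.count c ≤ 1) : w.count c = u.count c := by
  by_contra hne
  refine hT (hM.trivializes_of_pow hc (Ne.symm hne) fun v => ?_)
  -- A letter absent from both words turns `twoVal` into an evaluation that sees only `c`.
  obtain ⟨l, hl⟩ : ∃ l : Letter, l ∉ u ∧ l ∉ w := by
    have : ∃ n, ∀ i, t i ∈ u ++ w → i < n := by
      generalize u ++ w = l
      induction l with
      | nil => exact ⟨0, by simp⟩
      | cons e l ih =>
        obtain ⟨n, hn⟩ := ih
        cases e
        case t j =>
          refine ⟨max n (j + 1), fun i hi => ?_⟩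
          simp only [mem_cons, Letter.t.injEq] at hi
          rcases hi with rfl | hi
          · simp
          · exact lt_max_of_lt_left (hn i hi)
        all_goals exact ⟨n, by simpa using hn⟩
    obtain ⟨n, hn⟩ := this
    refine ⟨t n, fun h => ?_, fun h => ?_⟩
    · exact lt_irrefl n (hn n (by simp [h]))
    · exact lt_irrefl n (hn n (by simp [h]))
  have := h (twoVal l c 1 v)
  rwa [prod_twoVal _ _ hl.1, prod_twoVal _ _ hl.2] at this

/-! ### Words of the form `P r (z⋯z) q S` -/

/-- The letters occurring at most once in the words under consideration. -/
def isLin : Letter → Bool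
  | r => true
  | q => true
  | t _ => true
  | _ => false

/-- The words `u` and `w` agree up to permutations inside of the blocks between linear letters. -/
def Skel (u w : List Letter) : Prop :=
  u.Perm w ∧ ∀ (l : Letter) (u₁ u₂ w₁ w₂ : List Letter), isLin l = true → u = u₁ ++ l :: u₂ →
    w = w₁ ++ l :: w₂ → u₁.Perm w₁ ∧ u₂.Perm w₂

/-- Blocks are split off one at a time: the part before `l` is the same up to permutation, so it
cancels from the comparison at later linear letters. -/
theorem Skel.peel {B u w : List Letter} {l : Letter} (hl : isLin l = true)
    (h : Skel (B ++ l :: u) w) : ∃ β w', w = β ++ l :: w' ∧ B.Perm β ∧ Skel u w' := by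
  obtain ⟨β, w', rfl⟩ := List.append_of_mem (h.1.subset (show l ∈ B ++ l :: u by simp))
  obtain ⟨h1, h2⟩ := h.2 l B u β w' hl rfl rfl
  refine ⟨β, w', rfl, h1, h2, fun l' u₁ u₂ w₁ w₂ hl' e e' => ?_⟩
  subst e e'
  obtain ⟨h3, h4⟩ := h.2 l' (B ++ l :: u₁) u₂ (β ++ l :: w₁) w₂ hl' (by simp) (by simp)
  refine ⟨?_, h4⟩
  have := (h1.append_right (l :: u₁)).symm.trans h3
  rw [List.perm_append_left_iff] at this
  exact this.cons_inv

theorem Skel.zt {L : List ℕ} : ∀ {u w : List Letter}, Skel (ztWord L ++ u) w →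
    ∃ w', w = ztWord L ++ w' ∧ Skel u w' := by
  induction L with
  | nil => intro u w h; exact ⟨w, rfl, h⟩
  | cons i L ih =>
    intro u w h
    obtain ⟨β, w', rfl, h1, h2⟩ := Skel.peel (B := [z i]) (l := t i) rfl h
    obtain ⟨w'', rfl, h3⟩ := ih h2
    rw [List.singleton_perm] at h1
    subst h1
    exact ⟨w'', by simp, h3⟩

theorem Skel.tz {L : List ℕ} : ∀ {B w : List Letter}, Skel (B ++ tzWord L) w →
    ∃ β, w = β ++ tzWord L ∧ B.Perm β := by
  induction L with
  | nil => intro B w h; exact ⟨w, by simp, by simpa using h.1⟩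
  | cons i L ih =>
    intro B w h
    obtain ⟨β, w', rfl, h1, h2⟩ := Skel.peel (B := B) (l := t i) rfl h
    obtain ⟨γ, rfl, h3⟩ := ih (B := [z i]) h2
    rw [List.singleton_perm] at h3
    subst h3
    exact ⟨β, by simp, h1⟩

/-- The index of a letter. -/
def Letter.idx : Letter → ℕ
  | z i => i
  | t i => i
  | _ => 0

theorem exists_map_z_of_perm {Z : List ℕ} {β : List Letter} (h : (Z.map z).Perm β) :
    ∃ Z' : List ℕ, β = Z'.map z ∧ Z.Perm Z' := by
  refine ⟨β.map idx, ?_, ?_⟩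
  · rw [List.map_map]
    symm
    refine (List.map_congr_left fun c hc => ?_).trans (List.map_id β)
    obtain ⟨i, -, rfl⟩ := List.mem_map.1 (h.symm.subset hc)
    rfl
  · have := h.map idx
    rw [List.map_map] at this
    refine (Perm.of_eq ?_).trans this
    symm
    exact (List.map_congr_left fun i _ => rfl).trans (List.map_id Z)

/-- The word `P r (z⋯z) q S` in which the `z`-letters of the middle are arranged as in `Y`. -/
def bare (s : ℕ → Bool) (Z Y : List ℕ) : List Letter :=
  pre s Z ++ r :: (Y.map z ++ q :: suf s Z)

theorem Skel.bare {s : ℕ → Bool} {Z Y : List ℕ} {w : List Letter} (h : Skel (bare s Z Y) w) :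
    ∃ Y', w = KVariety.bare s Z Y' ∧ Y.Perm Y' := by
  unfold KVariety.bare at h
  obtain ⟨w₁, rfl, k1⟩ := Skel.zt h
  obtain ⟨β, w₂, rfl, h1, k2⟩ := Skel.peel (B := []) (l := r) rfl k1
  obtain ⟨γ, w₃, rfl, h2, k3⟩ := Skel.peel (l := q) rfl k2
  obtain ⟨δ, rfl, h3⟩ := Skel.tz (B := []) k3
  rw [List.nil_perm] at h1 h3
  subst h1 h3
  obtain ⟨Y', rfl, h4⟩ := exists_map_z_of_perm h2
  exact ⟨Y', rfl, h4⟩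

theorem eqv_split {u₁ u₂ w₁ w₂ : List Letter} {l c : Letter}
    (h : Eqv M (u₁ ++ l :: u₂) (w₁ ++ l :: w₂)) (hu₁ : l ∉ u₁) (hu₂ : l ∉ u₂) (hw₁ : l ∉ w₁)
    (hw₂ : l ∉ w₂) (m n : M) :
    n ^ u₁.count c * (m * n ^ u₂.count c) = n ^ w₁.count c * (m * n ^ w₂.count c) := by
  have := h (twoVal l c m n)
  simpa [prod_twoVal, hu₁, hu₂, hw₁, hw₂, twoVal] using this

/-- If two linear letters changed their order, `M` would be commutative. -/
theorem eqv_split_linear (hM : Basic M) (hT : ¬ Trivializes M) {u₁ u₂ w₁ w₂ : List Letter}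
    {l c : Letter} (hc : c ≠ l) (h : Eqv M (u₁ ++ l :: u₂) (w₁ ++ l :: w₂))
    (hl : (u₁ ++ l :: u₂).count l = 1) (hcu : (u₁ ++ l :: u₂).count c ≤ 1) :
    u₁.count c = w₁.count c ∧ u₂.count c = w₂.count c := by
  have e1 := eqv_count hM hT h l hl.le
  have e2 := eqv_count hM hT h c hcu
  rw [hl] at e1
  simp only [List.count_append, List.count_cons_self, List.count_cons_of_ne (Ne.symm hc)]
    at e1 e2 hl hcu
  have := eqv_split (c := c) h (count_eq_zero.1 (by omega)) (count_eq_zero.1 (by omega))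
    (count_eq_zero.1 (by omega)) (count_eq_zero.1 (by omega))
  by_contra hne
  refine hT (trivializes_of_comm fun m n => ?_)
  have := this m n
  obtain ⟨a1, a2, a3, a4⟩ | ⟨a1, a2, a3, a4⟩ : (u₁.count c = 1 ∧ u₂.count c = 0 ∧
      w₁.count c = 0 ∧ w₂.count c = 1) ∨ (u₁.count c = 0 ∧ u₂.count c = 1 ∧
      w₁.count c = 1 ∧ w₂.count c = 0) := by omega
  · simpa [a1, a2, a3, a4] using this.symm
  · simpa [a1, a2, a3, a4] using this

theorem eqv_split_sandwich (hM : Basic M) (hT : ¬ Trivializes M) {u₁ u₂ w₁ w₂ : List Letter}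
    {l c : Letter} (h : Eqv M (u₁ ++ l :: u₂) (w₁ ++ l :: w₂))
    (hl : (u₁ ++ l :: u₂).count l = 1) (h1 : u₁.count c = 1) (h2 : u₂.count c = 1) :
    w₁.count c = 1 ∧ w₂.count c = 1 := by
  have e1 := eqv_count hM hT h l hl.le
  rw [hl] at e1
  simp only [List.count_append, List.count_cons_self] at e1 hl
  have := eqv_split (c := c) h (count_eq_zero.1 (by omega)) (count_eq_zero.1 (by omega))
    (count_eq_zero.1 (by omega)) (count_eq_zero.1 (by omega))
  by_contra hne
  refine hT (hM.trivializes_of_sandwich hne fun v t => ?_)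
  simpa [h1, h2] using this t v

theorem count_map_z (Y : List ℕ) (i : ℕ) : (Y.map z).count (z i) = Y.count i :=
  List.count_map_of_injective _ _ (fun a b h => by simpa using h) _

theorem count_zt_z (L : List ℕ) (i : ℕ) : (ztWord L).count (z i) = L.count i := by
  induction L with
  | nil => simp
  | cons j L ih => by_cases h : j = i <;> simp [ih, h]

theorem count_zt_t (L : List ℕ) (i : ℕ) : (ztWord L).count (t i) = L.count i := by
  induction L with
  | nil => simp
  | cons j L ih => by_cases h : j = i <;> simp [ih, h]

theorem count_tz_z (L : List ℕ) (i : ℕ) : (tzWord L).count (z i) = L.count i := by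
  induction L with
  | nil => simp
  | cons j L ih => by_cases h : j = i <;> simp [ih, h]

theorem count_tz_t (L : List ℕ) (i : ℕ) : (tzWord L).count (t i) = L.count i := by
  induction L with
  | nil => simp
  | cons j L ih => by_cases h : j = i <;> simp [ih, h]

theorem count_lab {s : ℕ → Bool} {Z : List ℕ} (hZ : Z.Nodup) (i : ℕ) :
    (lab s Z).count i = if i ∈ Z ∧ s i = true then 1 else 0 := by
  by_cases h : i ∈ lab s Z
  · rw [List.count_eq_one_of_mem (lab_nodup hZ) h, if_pos (mem_lab.1 h)]
  · rw [List.count_eq_zero.2 h, if_neg fun h' => h (mem_lab.2 h')]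

theorem count_bare_lin {s : ℕ → Bool} {Z Y : List ℕ} (hZ : Z.Nodup) (l : Letter)
    (hl : isLin l = true) : (bare s Z Y).count l ≤ 1 := by
  have hz : (Y.map z).count l = 0 := count_eq_zero.2 (by cases l <;> simp_all [isLin])
  cases l with
  | r => simp [bare, pre, suf, List.count_append, count_eq_zero.2]
  | q => simp [bare, pre, suf, List.count_append, count_eq_zero.2]
  | t i =>
    simp only [bare, pre, suf, List.count_append, List.count_cons, hz, count_zt_t, count_tz_t,
      count_lab hZ]
    cases s i <;> simp <;> split_ifs <;> simp
  | _ => simp [isLin] at hl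

theorem count_bare_t {s : ℕ → Bool} {Z Y : List ℕ} (hZ : Z.Nodup) {i : ℕ} (hi : i ∈ Z) :
    (bare s Z Y).count (t i) = 1 := by
  have hz : (Y.map z).count (t i) = 0 := count_eq_zero.2 (by simp)
  simp only [bare, pre, suf, List.count_append, List.count_cons, hz, count_zt_t, count_tz_t,
    count_lab hZ]
  cases h : s i <;> simp [hi]

/-- In the word `P r (z⋯z) q S` each `z i` occurs exactly once on each side of `t i`. -/
theorem exists_split_bare {s : ℕ → Bool} {Z Y : List ℕ} (hZ : Z.Nodup) (hY : Z.Perm Y) {i : ℕ}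
    (hi : i ∈ Z) : ∃ u₁ u₂, bare s Z Y = u₁ ++ t i :: u₂ ∧ u₁.count (z i) = 1 ∧
      u₂.count (z i) = 1 := by
  have hYi : Y.count i = 1 :=
    List.count_eq_one_of_mem (hY.nodup_iff.1 hZ) (hY.subset hi)
  cases h : s i with
  | true =>
    have hm : i ∈ lab s Z := mem_lab.2 ⟨hi, h⟩
    have hn := lab_nodup (s := s) hZ
    obtain ⟨L₁, L₂, e⟩ := List.append_of_mem hm
    rw [e, List.nodup_append, List.nodup_cons] at hn
    have e1 : L₁.count i = 0 := count_eq_zero.2 fun h => hn.2.2 i h i (by simp) rfl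
    have e2 : L₂.count i = 0 := count_eq_zero.2 hn.2.1.1
    refine ⟨ztWord L₁ ++ [z i], ztWord L₂ ++ r :: (Y.map z ++ q :: suf s Z), ?_, ?_, ?_⟩
    · simp [bare, pre, e, ztWord]
    · simp [List.count_append, count_zt_z, e1]
    · simp [List.count_append, count_zt_z, e2, count_map_z, hYi, suf, count_tz_z,
        count_lab hZ, h]
  | false =>
    have hm : i ∈ lab (fun i => !s i) Z := mem_lab.2 ⟨hi, by simp [h]⟩
    have hn := lab_nodup (s := fun i => !s i) hZ
    obtain ⟨L₁, L₂, e⟩ := List.append_of_mem hm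
    rw [e, List.nodup_append, List.nodup_cons] at hn
    have e1 : L₁.count i = 0 := count_eq_zero.2 fun h => hn.2.2 i h i (by simp) rfl
    have e2 : L₂.count i = 0 := count_eq_zero.2 hn.2.1.1
    refine ⟨pre s Z ++ r :: (Y.map z ++ q :: tzWord L₁), z i :: tzWord L₂, ?_, ?_, ?_⟩
    · simp [bare, suf, e, tzWord]
    · simp [List.count_append, count_tz_z, e1, count_map_z, hYi, pre, count_zt_z,
        count_lab hZ, h]
    · simp [count_tz_z, e2]

theorem mem_bare {s : ℕ → Bool} {Z Y : List ℕ} (hY : Z.Perm Y) {c : Letter} (h : c ∈ bare s Z Y) :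
    isLin c = true ∨ ∃ i ∈ Z, c = z i := by
  simp only [bare, pre, suf, mem_append, mem_ztWord, mem_lab, mem_cons, mem_map, mem_tzWord] at h
  rcases h with ⟨i, hi, rfl | rfl⟩ | rfl | ⟨i, hi, rfl⟩ | rfl | ⟨i, hi, rfl | rfl⟩
  · exact Or.inr ⟨i, hi.1, rfl⟩
  · exact Or.inl rfl
  · exact Or.inl rfl
  · exact Or.inr ⟨i, hY.mem_iff.2 hi, rfl⟩
  · exact Or.inl rfl
  · exact Or.inl rfl
  · exact Or.inr ⟨i, hi.1, rfl⟩

/-- Linear letters keep multiplicity and order, since other laws trivialize `M`; and `z i` keeps one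
occurrence on each side of `t i`, by the sandwich law. Only permutations inside the blocks between
linear letters remain, and outside the middle each block has at most one letter. -/
theorem eq_bare_of_eqv (hM : Basic M) (hT : ¬ Trivializes M) {s : ℕ → Bool} {Z : List ℕ}
    (hZ : Z.Nodup) {w : List Letter} (h : Eqv M (bare s Z Z) w) :
    ∃ Y, w = bare s Z Y ∧ Z.Perm Y := by
  refine Skel.bare (Y := Z) ?_
  have hlin : ∀ c, isLin c = true → w.count c = (bare s Z Z).count c := fun c hc =>
    eqv_count hM hT h c (count_bare_lin hZ c hc)
  -- the letters `z i` are distributed around `t i` as they should be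
  have hz : ∀ i ∈ Z, ∀ w₁ w₂, w = w₁ ++ t i :: w₂ → w₁.count (z i) = 1 ∧ w₂.count (z i) = 1 := by
    intro i hi w₁ w₂ e
    obtain ⟨u₁, u₂, e', h1, h2⟩ := exists_split_bare (s := s) (Y := Z) hZ (Perm.refl _) hi
    rw [e, e'] at h
    exact eqv_split_sandwich hM hT h (by rw [← e']; exact count_bare_t hZ hi) h1 h2
  have hcount : ∀ c, (bare s Z Z).count c = w.count c := by
    intro c
    by_cases hc : isLin c = true
    · exact (hlin c hc).symm
    by_cases hc' : c ∈ bare s Z Z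
    · obtain ⟨i, hi, rfl⟩ := (mem_bare (Perm.refl _) hc').resolve_left hc
      obtain ⟨u₁, u₂, e', h1, h2⟩ := exists_split_bare (s := s) (Y := Z) hZ (Perm.refl _) hi
      have : t i ∈ w := by
        rw [← List.count_pos_iff, hlin _ rfl, count_bare_t hZ hi]; simp
      obtain ⟨w₁, w₂, e⟩ := List.append_of_mem this
      obtain ⟨h3, h4⟩ := hz i hi w₁ w₂ e
      rw [e, e']
      simp [List.count_append, h1, h2, h3, h4]
    · have e := List.count_eq_zero.2 hc'
      rw [eqv_count hM hT h c (by omega)]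
  refine ⟨List.perm_iff_count.2 hcount, ?_⟩
  intro l u₁ u₂ w₁ w₂ hl e e'
  have hlu : (bare s Z Z).count l = 1 :=
    le_antisymm (count_bare_lin hZ l hl) (by rw [e]; simp [List.count_append]; omega)
  have h' := h
  rw [e, e'] at h'
  have hlu' : (u₁ ++ l :: u₂).count l = 1 := by rw [← e]; exact hlu
  have hlw' : (w₁ ++ l :: w₂).count l = 1 := by rw [← e', hlin l hl]; exact hlu
  have key : ∀ c, u₁.count c = w₁.count c ∧ u₂.count c = w₂.count c := by
    intro c
    by_cases hcl : c = l
    · subst hcl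
      simp only [List.count_append, List.count_cons_self] at hlu' hlw'
      omega
    by_cases hc : isLin c = true
    · exact eqv_split_linear hM hT hcl h' hlu' (by rw [← e]; exact count_bare_lin hZ c hc)
    have htot := hcount c
    by_cases hc' : c ∈ bare s Z Z
    · obtain ⟨i, hi, rfl⟩ := (mem_bare (Perm.refl _) hc').resolve_left hc
      by_cases hli : l = t i
      · subst hli
        obtain ⟨v₁, v₂, e'', h1, h2⟩ := exists_split_bare (s := s) (Y := Z) hZ (Perm.refl _) hi
        have hti : t i ∉ v₁ ∧ t i ∉ v₂ := by
          rw [e''] at hlu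
          simp only [List.count_append, List.count_cons_self] at hlu
          exact ⟨count_eq_zero.1 (by omega), count_eq_zero.1 (by omega)⟩
        have hti' : t i ∉ u₁ ∧ t i ∉ u₂ := by
          simp only [List.count_append, List.count_cons_self] at hlu'
          exact ⟨count_eq_zero.1 (by omega), count_eq_zero.1 (by omega)⟩
        have : u₁ = v₁ ∧ u₂ = v₂ := by
          have ee := e.symm.trans e''
          rw [List.append_eq_append_iff] at ee
          rcases ee with ⟨a, ha, hb⟩ | ⟨a, ha, hb⟩
          · cases a with
            | nil => simp_all
            | cons d a =>
              exfalso
              have : d = t i := by simpa using (List.cons_eq_cons.1 hb).1.symm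
              apply hti.1; rw [ha]; simp [this]
          · cases a with
            | nil => simp_all
            | cons d a =>
              exfalso
              have : d = t i := by simpa using (List.cons_eq_cons.1 hb).1.symm
              apply hti'.1; rw [ha]; simp [this]
        obtain ⟨rfl, rfl⟩ := this
        obtain ⟨h3, h4⟩ := hz i hi w₁ w₂ e'
        omega
      -- compare with the position of `t i`
      have hne : z i ≠ l := by rintro rfl; simp [isLin] at hl
      have f1 := eqv_split_linear hM hT (c := t i) (Ne.symm hli) h' hlu'
        (by rw [← e]; exact count_bare_lin hZ _ rfl)
      have f2 := fun a b => eqv_split_sandwich (c := z i) hM hT h' hlu' a b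
      have f3 := fun a b => eqv_split_sandwich (c := z i) hM hT h'.symm hlw' a b
      have two : (bare s Z Z).count (z i) = 2 := by
        obtain ⟨v₁, v₂, e'', h1, h2⟩ := exists_split_bare (s := s) (Y := Z) hZ (Perm.refl _) hi
        rw [e'']; simp [List.count_append, h1, h2]
      have bound : ∀ (v : List Letter) v₁ v₂, v = v₁ ++ l :: v₂ → (v.count (t i) = 1) →
          (∀ a b, v = a ++ t i :: b → a.count (z i) = 1 ∧ b.count (z i) = 1) →
          (v₁.count (t i) = 1 → 1 ≤ v₁.count (z i)) ∧
          (v₂.count (t i) = 1 → 1 ≤ v₂.count (z i)) := by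
        rintro v v₁ v₂ rfl - H
        constructor
        · intro hh
          obtain ⟨a, b, rfl⟩ := List.append_of_mem (count_pos_iff.1 (by omega : 0 < v₁.count (t i)))
          have := (H a (b ++ l :: v₂) (by simp)).1
          simp [List.count_append, this]
        · intro hh
          obtain ⟨a, b, rfl⟩ := List.append_of_mem (count_pos_iff.1 (by omega : 0 < v₂.count (t i)))
          have := (H (v₁ ++ l :: a) b (by simp)).2
          simp [List.count_append, this]
      have hzu : ∀ a b, bare s Z Z = a ++ t i :: b → a.count (z i) = 1 ∧ b.count (z i) = 1 := by
        intro a b e''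
        have htw : t i ∈ w := by
          rw [← List.count_pos_iff, hlin _ rfl, count_bare_t hZ hi]; simp
        obtain ⟨c, d, e3⟩ := List.append_of_mem htw
        obtain ⟨h3, h4⟩ := hz i hi c d e3
        have h'' := h
        rw [e'', e3] at h''
        exact eqv_split_sandwich hM hT h''.symm
          (by rw [← e3, hlin _ rfl, count_bare_t hZ hi]) h3 h4
      have g1 := bound _ u₁ u₂ e (count_bare_t hZ hi) hzu
      have g2 := bound _ w₁ w₂ e' (by rw [hlin _ rfl, count_bare_t hZ hi]) (hz i hi)
      have ht := count_bare_t (s := s) (Y := Z) hZ hi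
      rw [e] at ht
      rw [two] at htot
      rw [e'] at htot
      rw [e] at two
      simp only [List.count_append, List.count_cons_of_ne (Ne.symm hne),
        List.count_cons_of_ne hli] at ht htot two
      omega
    · rw [List.count_eq_zero.2 hc', e'] at htot
      have h0 := List.count_eq_zero.2 hc'
      rw [e] at h0
      simp only [List.count_append, List.count_cons] at h0 htot
      omega
  exact ⟨List.perm_iff_count.2 fun c => (key c).1, List.perm_iff_count.2 fun c => (key c).2⟩

/-! ### Rigidity of the middle part -/

theorem filter_keep_bare {s p : ℕ → Bool} {Z Y : List ℕ} (hZ : Z.Nodup) :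
    (bare s Z Y).filter (keep p) = bare s (Z.filter p) (Y.filter p) := by
  simp [bare, List.filter_append, List.filter_cons, filter_pre hZ, filter_suf hZ, filter_map_z,
    keep]

theorem filter_pair {Z : List ℕ} (hZ : Z.Nodup) {i j : ℕ} (h : [i, j] <+ Z) :
    Z.filter (fun k => decide (k = i ∨ k = j)) = [i, j] := by
  rw [← filter_mem_of_sublist hZ h]
  exact List.filter_congr fun k _ => by simp

theorem pair_sublist_or {Z : List ℕ} {i j : ℕ} (hij : i ≠ j) (hi : i ∈ Z) (hj : j ∈ Z) :
    [i, j] <+ Z ∨ [j, i] <+ Z := by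
  obtain ⟨a, b, rfl⟩ := List.append_of_mem hi
  rcases List.mem_append.1 hj with h | h
  · right
    exact (List.singleton_sublist.2 h).append (List.singleton_sublist.2 (show i ∈ i :: b by simp))
  · left
    rcases List.mem_cons.1 h with h | h
    · exact absurd h.symm hij
    · exact ((List.singleton_sublist.2 h).cons_cons i).trans (List.sublist_append_right a _)

/-- Two labels whose order in the middle part cannot be changed. -/
def RigidPair (M : Type u) [Monoid M] (s : ℕ → Bool) (i j : ℕ) : Prop :=
  s i ≠ s j ∨ (s i = true ∧ ¬ SatSecond M) ∨ (s i = false ∧ ¬ SatFirst M)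

/-- The substitution `z i ↦ p`, `z j ↦ q`, `t i ↦ a`, `t j ↦ b`, all other letters to `1`. -/
def fourVal (i j : ℕ) (p q a b : M) : Letter → M
  | z k => if k = i then p else if k = j then q else 1
  | t k => if k = i then a else if k = j then b else 1
  | _ => 1

/-- Evaluation by `fourVal` turns the swap into `SatMixed` for different types, `SatSecond` for two
prefix labels and `SatFirst` for two suffix labels. -/
theorem not_eqv_bare_swap (hM : Basic M) (hT : ¬ Trivializes M) {s : ℕ → Bool} {i j : ℕ}
    (hij : i < j) (hr : s i = s j → RigidPair M s i j) :
    ¬ Eqv M (bare s [i, j] [i, j]) (bare s [i, j] [j, i]) := by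
  intro h
  have hne : j ≠ i := Ne.symm hij.ne
  have key := fun p q a b : M => h (fourVal i j p q a b)
  cases hi : s i <;> cases hj : s j <;>
    simp [bare, pre, suf, lab, hi, hj, fourVal, hij.le, hne] at key
  · obtain hr | ⟨hr, -⟩ | ⟨-, hr⟩ := hr (hi.trans hj.symm)
    · exact hr (hi.trans hj.symm)
    · simp [hi] at hr
    · exact hr fun p q a b => key p q a b
  · exact hT (hM.trivializes_of_mixed fun p q a b => (key q p b a).symm)
  · exact hT (hM.trivializes_of_mixed fun p q a b => key p q a b)
  · obtain hr | ⟨-, hr⟩ | ⟨hr, -⟩ := hr (hi.trans hj.symm)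
    · exact hr (hi.trans hj.symm)
    · exact hr fun p q a b => key p q a b
    · simp [hi] at hr

theorem bare_congr {s : ℕ → Bool} {Z Z' : List ℕ} (hZ : Z.Nodup) (h : Z.Perm Z') (Y : List ℕ) :
    bare s Z Y = bare s Z' Y := by
  simp only [bare, pre, suf, lab_congr hZ h]

/-- The order of a rigid pair is preserved by the identities of `M`. -/
theorem pair_sublist_of_eqv (hM : Basic M) (hT : ¬ Trivializes M) {s : ℕ → Bool} {Z X Y : List ℕ}
    (hZ : Z.Nodup) (hX : Z.Perm X) (hY : Z.Perm Y) (h : Eqv M (bare s Z X) (bare s Z Y)) {i j : ℕ}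
    (hij : [i, j] <+ X) (hr : RigidPair M s i j) : [i, j] <+ Y := by
  have hXn := hX.nodup_iff.1 hZ
  have hYn := hY.nodup_iff.1 hZ
  have hne : i ≠ j := by
    have := hij.nodup hXn
    simpa using this
  have hi : i ∈ Y := hY.subset (hX.symm.subset (hij.subset (by simp)))
  have hj : j ∈ Y := hY.subset (hX.symm.subset (hij.subset (by simp)))
  refine (pair_sublist_or hne hi hj).resolve_right fun hji => ?_
  have key := h.filter (keep fun k => decide (k = i ∨ k = j))
  have e1 := filter_pair hXn hij
  have e2 : Y.filter (fun k => decide (k = i ∨ k = j)) = [j, i] := by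
    rw [← filter_pair hYn hji]
    exact List.filter_congr fun k _ => by simp [or_comm]
  have e3 : (Z.filter fun k => decide (k = i ∨ k = j)).Perm [i, j] := e1 ▸ hX.filter _
  rw [filter_keep_bare hZ, filter_keep_bare hZ, e1, e2, bare_congr (hZ.filter _) e3,
    bare_congr (hZ.filter _) e3] at key
  rcases lt_or_gt_of_ne hne with hlt | hlt
  · exact not_eqv_bare_swap hM hT hlt (fun _ => hr) key
  · rw [bare_congr (Z := [i, j]) (Z' := [j, i]) (by simpa using hne) (by simpa using Perm.swap j i []),
      bare_congr (Z := [i, j]) (Z' := [j, i]) (by simpa using hne) (by simpa using Perm.swap j i [])]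
      at key
    refine not_eqv_bare_swap hM hT hlt (fun e => ?_) key.symm
    unfold RigidPair at hr ⊢
    rw [e] at hr ⊢
    simpa using hr

theorem pair_sublist_iff {l : List ℕ} (hl : l.Nodup) {i j : ℕ} :
    [i, j] <+ l ↔ i ∈ l ∧ j ∈ l ∧ l.idxOf i < l.idxOf j := by
  constructor
  · intro h
    refine ⟨h.subset (by simp), h.subset (by simp), ?_⟩
    have : l.Pairwise fun i j => l.idxOf i < l.idxOf j := by
      rw [List.pairwise_iff_getElem]
      intro a b ha hb hab
      rwa [hl.idxOf_getElem, hl.idxOf_getElem]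
    exact List.pairwise_iff_forall_sublist.1 this h
  · rintro ⟨hi, hj, h⟩
    rcases pair_sublist_or (fun e => by simp [e] at h) hi hj with h' | h'
    · exact h'
    · exfalso
      have : l.Pairwise fun i j => l.idxOf i < l.idxOf j := by
        rw [List.pairwise_iff_getElem]
        intro a b ha hb hab
        rwa [hl.idxOf_getElem, hl.idxOf_getElem]
      exact lt_asymm h (List.pairwise_iff_forall_sublist.1 this h')

/-- A list is determined by the order of the adjacent elements of another arrangement. -/
theorem eq_of_isChain_sublist {D l : List ℕ} (hD : D.Nodup) (hl : D.Perm l)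
    (h : D.IsChain fun i j => [i, j] <+ l) : l = D := by
  have hln := hl.nodup_iff.1 hD
  have hlp : l.Pairwise fun i j => [i, j] <+ l := by
    rw [List.pairwise_iff_forall_sublist]; intro i j h; exact h
  have htr : ∀ {i j k : ℕ}, [i, j] <+ l → [j, k] <+ l → [i, k] <+ l := by
    intro i j k h1 h2
    rw [pair_sublist_iff hln] at *
    exact ⟨h1.1, h2.2.1, h1.2.2.trans h2.2.2⟩
  have : IsTrans ℕ fun i j => [i, j] <+ l := ⟨fun _ _ _ => htr⟩
  have hDp : D.Pairwise fun i j => [i, j] <+ l := List.isChain_iff_pairwise.1 h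
  refine (hl.symm.eq_of_pairwise (le := fun i j => [i, j] <+ l) ?_ hlp hDp)
  intro i j _ _ h1 h2
  rw [pair_sublist_iff hln] at *
  exact absurd h1.2.2 (lt_asymm h2.2.2)

/-- Labels alternate in type: the arrangement is rigid. -/
theorem eq_of_alternating (hM : Basic M) (hT : ¬ Trivializes M) {s : ℕ → Bool} {D Y : List ℕ}
    (hD : D.Nodup) (hc : D.IsChain fun i j => s i ≠ s j) (hY : D.Perm Y)
    (h : Eqv M (bare s D D) (bare s D Y)) : Y = D := by
  refine eq_of_isChain_sublist hD hY ?_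
  rw [List.isChain_iff_forall_rel_of_append_cons_cons] at hc ⊢
  intro a b l₁ l₂ e
  refine pair_sublist_of_eqv hM hT hD (Perm.refl D) hY h ?_ (Or.inl (hc e))
  rw [e]
  exact (List.Sublist.cons_cons a (List.Sublist.cons_cons b (List.nil_sublist l₂))).trans
    (List.sublist_append_right l₁ _)

/-! ### Decompositions of lists -/

/-- A factor avoiding the letter `l` lies on one side of `l`. -/
theorem factor_split {α : Type*} {A γ B P Q : List α} {l : α} (hl : l ∉ γ)
    (h : A ++ (γ ++ B) = P ++ l :: Q) :
    (∃ C, P = A ++ (γ ++ C) ∧ B = C ++ l :: Q) ∨ (∃ C, A = P ++ l :: C ∧ Q = C ++ (γ ++ B)) := by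
  rcases List.append_eq_append_iff.1 h with ⟨a, rfl, h2⟩ | ⟨a, rfl, h2⟩
  · rcases List.append_eq_append_iff.1 h2 with ⟨c, rfl, h4⟩ | ⟨c, rfl, h4⟩
    · exact Or.inl ⟨c, by simp, h4⟩
    · cases c with
      | nil => exact Or.inl ⟨[], by simp, by simpa using h4.symm⟩
      | cons d c =>
        rw [cons_append, List.cons_eq_cons] at h4
        exact absurd (by simp [h4.1]) hl
  · cases a with
    | nil =>
      cases γ with
      | nil => exact Or.inl ⟨[], by simp, by simpa using h2.symm⟩
      | cons d γ =>
        rw [nil_append, cons_append, List.cons_eq_cons] at h2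
        exact absurd (by simp [h2.1]) hl
    | cons d a =>
      rw [cons_append, List.cons_eq_cons] at h2
      exact Or.inr ⟨a, by rw [h2.1], h2.2⟩

theorem split_unique {α : Type*} {A B P Q : List α} {l : α} (hA : l ∉ A) (hP : l ∉ P)
    (h : A ++ l :: B = P ++ l :: Q) : A = P ∧ B = Q := by
  rcases factor_split (γ := []) (by simp) (A := A) (B := l :: B) h with ⟨C, rfl, h2⟩ | ⟨C, rfl, -⟩
  · cases C with
    | nil => exact ⟨by simp, (List.cons_eq_cons.1 h2).2⟩
    | cons d C =>
      rw [cons_append, List.cons_eq_cons] at h2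
      exact absurd (by simp [h2.1]) hP
  · exact absurd (by simp) hA

theorem del_eq_append {v : Letter} {w A B : List Letter} (h : del v w = A ++ B) :
    ∃ a b, w = a ++ b ∧ del v a = A ∧ del v b = B := List.filter_eq_append_iff.1 h

theorem del_eq_cons {v c : Letter} {w B : List Letter} (h : del v w = c :: B) :
    ∃ a b, w = a ++ c :: b ∧ del v a = [] ∧ del v b = B := by
  obtain ⟨a, b, e, h1, -, h3⟩ := List.filter_eq_cons_iff.1 h
  exact ⟨a, b, e, by rw [del, List.filter_eq_nil_iff]; exact h1, h3⟩

theorem del_eq_append_cons {v c : Letter} {w A B : List Letter} (h : del v w = A ++ c :: B) :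
    ∃ a b, w = a ++ c :: b ∧ del v a = A ∧ del v b = B := by
  obtain ⟨a, b, rfl, h1, h2⟩ := del_eq_append h
  obtain ⟨b₁, b₂, rfl, h3, h4⟩ := del_eq_cons h2
  exact ⟨a ++ b₁, b₂, by simp, by simp [h1, h3], h4⟩

theorem eq_replicate_of_del_eq_nil {v : Letter} {w : List Letter} (h : del v w = []) :
    w = List.replicate w.length v := by
  rw [del, List.filter_eq_nil_iff] at h
  exact List.eq_replicate_of_mem fun c hc => by simpa using h c hc

theorem length_of_replicate_count {v : Letter} {w : List Letter} (h : del v w = []) :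
    w = List.replicate (w.count v) v := by
  have := eq_replicate_of_del_eq_nil h
  rw [this]; simp

theorem prod_eq_pow {v : Letter} {φ : Letter → M} : ∀ {w : List Letter},
    (∀ c ∈ w, c ≠ v → φ c = 1) → (w.map φ).prod = φ v ^ w.count v := by
  intro w
  induction w with
  | nil => simp
  | cons c w ih =>
    intro h
    rw [map_cons, prod_cons, ih fun d hd => h d (by simp [hd])]
    by_cases hc : c = v
    · subst hc; simp [pow_succ']
    · rw [h c (by simp) hc, List.count_cons_of_ne hc, one_mul]

/-! ### Consequences of moving a letter out of the middle -/

/-- `zavzv ≈ zazv²`. -/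
def SatLeft (M : Type u) [Monoid M] : Prop :=
  ∀ z v a : M, z * (a * (v * (z * v))) = z * (a * (z * (v * v)))

/-- `vzvbz ≈ zv²bz`. -/
def SatRight (M : Type u) [Monoid M] : Prop :=
  ∀ z v b : M, v * (z * (v * (b * z))) = z * (v * (v * (b * z)))

/-- `M` does not satisfy `v² ≈ 1`, `v² ≈ v`. -/
theorem two_le_of_pow (hM : Basic M) (hT : ¬ Trivializes M) {n : ℕ}
    (h : ∀ v : M, v * v = v ^ n) : 2 ≤ n := by
  by_contra hn
  exact hT (hM.trivializes_of_pow (k := n) (n := 2) (by omega) (by omega) fun v => by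
    rw [pow_two, h v])

theorem Basic.satQ_of_comm (hM : Basic M) (h : ∀ v t : M, t * (v * v) = v * (v * t)) : SatQ M := by
  intro v t
  rw [h v t]
  have e : ∀ c : M, v * (v * (v * c)) = v * (v * c) := fun c => by
    have := congrArg (· * c) (hM.sq v)
    simpa only [mul_assoc] using this
  simp only [e]

/-- This law arises when a `v` moves to the left of `r`. Exponents at least 2 are the same, so only
the small values of `a` and `n` have to be distinguished. -/
theorem Basic.satQ_of_pos (hM : Basic M) (hT : ¬ Trivializes M) {a n : ℕ} (ha : 1 ≤ a)
    (h : ∀ v t : M, t * (v * v) = v ^ a * (t * v ^ n)) : SatQ M := by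
  have e : ∀ v c : M, v * (v * (v * c)) = v * (v * c) := fun v c => by
    have := congrArg (· * c) (hM.sq v)
    simpa only [mul_assoc] using this
  have hs := two_le_of_pow hM hT (n := a + n) fun v => by
    have := h v 1; rwa [one_mul, one_mul, ← pow_add] at this
  have hp := fun v {n} hn => hM.pow_eq v (n := n) hn
  intro v t
  rcases Nat.lt_or_ge a 2 with ha2 | ha2
  · obtain rfl : a = 1 := by omega
    rcases Nat.lt_or_ge n 2 with hn | hn
    · obtain rfl : n = 1 := by omega
      have h1 := h v t
      -- With `a = n = 1` the law at `v * t` gives `vtv² = v²tv`, and the second identity completes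
      -- the last square.
      have h2 := h v (v * t)
      have h3 := hM.a2 v t
      simp only [pow_one, mul_assoc] at h1 h2
      exact h2.trans h3
    · have h1 := h v t
      rw [hp v hn, pow_one] at h1
      exact congrArg (v * ·) h1
  · rcases Nat.lt_or_ge n 2 with hn | hn
    · interval_cases n
      · refine hM.satQ_of_comm (fun v t => ?_) v t
        have h1 := h v t
        rw [hp v ha2, pow_zero, mul_one, mul_assoc] at h1
        exact h1
      · have h1 := h v t
        rw [hp v ha2, pow_one, mul_assoc, hM.a2] at h1
        rw [h1]; simp only [e]
    · have h1 := h v t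
      rw [hp v ha2, hp v hn, mul_assoc] at h1
      rw [h1]; simp only [e]

theorem Basic.satQ_of_right (hM : Basic M) {b c : ℕ} (hb : b ≤ 1) (hc : 2 ≤ c)
    (h : ∀ v t : M, v * (v * t) = v ^ b * (t * v ^ c)) : SatQ M := by
  have hp := fun v {n} hn => hM.pow_eq v (n := n) hn
  have e : ∀ v c : M, v * (v * (v * c)) = v * (v * c) := fun v c => by
    have := congrArg (· * c) (hM.sq v)
    simpa only [mul_assoc] using this
  intro v t
  have h1 := h v t
  rw [hp v hc] at h1
  interval_cases b
  · rw [pow_zero, one_mul] at h1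
    rw [← h1]; simp only [e]
  · rw [pow_one] at h1
    rw [← h1]; simp only [e]

theorem Basic.satR_of_pos (hM : Basic M) {c : ℕ} (hc : 1 ≤ c)
    (h : ∀ v t : M, v * (v * t) = v * (v * (t * v ^ c))) : SatR M := by
  intro v t
  have h1 := h v t
  rcases Nat.lt_or_ge c 2 with hc2 | hc2
  · obtain rfl : c = 1 := by omega
    rw [pow_one, hM.a2] at h1
    exact h1
  · rwa [hM.pow_eq v hc2] at h1

/-! ### Words whose occurrences of `v` are separated by linear letters -/

/-- The letter `v` or a linear letter. -/
def vlin (v : Letter) (c : Letter) : Bool := decide (c = v) || isLin c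

theorem flatMap_update {φ : Letter → List Letter} {l : Letter} (β : List Letter)
    {u : List Letter} (h : l ∉ u) : u.flatMap (Function.update φ l β) = u.flatMap φ :=
  List.flatMap_congr fun c hc => by
    rw [Function.update_of_ne]; rintro rfl; exact h hc

/-- Between consecutive `v` there is a linear letter whose image can take in the neighbouring
nonlinear letters. Thus `w` is, up to its ends, an image of its restriction to `v` and the linear
letters. -/
theorem exists_flatMap_of_separated {v : Letter} (hv : isLin v = false) :
    ∀ {w : List Letter}, (∀ l, isLin l = true → w.count l ≤ 1) →
    (∀ α γ β, v ∉ γ → w = α ++ v :: (γ ++ v :: β) → ∃ c ∈ γ, isLin c = true) →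
    ∃ (φ : Letter → List Letter) (s₀ s₁ : List Letter), φ v = [v] ∧ v ∉ s₀ ∧ v ∉ s₁ ∧
      (∀ l, isLin l = true → v ∉ φ l) ∧ (∀ c ∈ s₀, isLin c = false) ∧
      w = s₀ ++ ((w.filter (vlin v)).flatMap φ ++ s₁) := by
  intro w
  induction w with
  | nil =>
    intro _ _
    refine ⟨fun c => [c], [], [], rfl, by simp, by simp, fun l hl => ?_, by simp, by simp⟩
    rintro h
    rw [List.mem_singleton] at h; subst h; simp [hl] at hv
  | cons c w ih =>
    intro h1 h2
    obtain ⟨φ, s₀, s₁, e1, e2, e3, e4, e5, e6⟩ := ih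
      (fun l hl => le_trans (List.count_le_count_cons) (h1 l hl))
      (fun α γ β hγ e => h2 (c :: α) γ β hγ (by simp [e]))
    by_cases hcv : c = v
    · subst hcv
      have hf : (c :: w).filter (vlin c) = c :: w.filter (vlin c) := by simp [vlin]
      rw [hf]
      cases hw : w.filter (vlin c) with
      | nil =>
        rw [hw] at e6
        refine ⟨φ, [], s₀ ++ s₁, e1, by simp, by simp [e2, e3], e4, by simp, ?_⟩
        conv_lhs => rw [e6]
        simp [e1]
      | cons l u =>
        rw [hw] at e6
        have hl : l ∈ w.filter (vlin c) := by rw [hw]; simp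
        rw [List.mem_filter] at hl
        by_cases hlc : l = c
        · exfalso
          subst hlc
          obtain ⟨d, hd, hd'⟩ := h2 [] s₀ (u.flatMap φ ++ s₁) e2 (by
            conv_lhs => rw [e6]
            simp [e1])
          simp [e5 d hd] at hd'
        have hl' : isLin l = true := by simpa [vlin, hlc] using hl.2
        have hlu : l ∉ u := by
          intro hlu
          have h3 := h1 l hl'
          have h4 : (l :: u).count l ≤ w.count l := by
            rw [← hw]; exact (List.filter_sublist).count_le l
          rw [List.count_cons_of_ne (Ne.symm hlc)] at h3
          have := List.count_pos_iff.2 hlu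
          rw [List.count_cons_self] at h4
          omega
        refine ⟨Function.update φ l (s₀ ++ φ l), [], s₁, ?_, by simp, e3, ?_, by simp, ?_⟩
        · rw [Function.update_of_ne (Ne.symm hlc), e1]
        · intro l' hl''
          by_cases h : l' = l
          · subst h; simp [e2, e4 _ hl'']
          · rw [Function.update_of_ne h]; exact e4 _ hl''
        · conv_lhs => rw [e6]
          rw [flatMap_cons, flatMap_cons, flatMap_cons, Function.update_self, flatMap_update _ hlu,
            Function.update_of_ne (Ne.symm hlc), e1]
          simp
    · by_cases hl : isLin c = true
      · have hf : (c :: w).filter (vlin v) = c :: w.filter (vlin v) := by simp [vlin, hl]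
        have hcw : c ∉ w := by
          have := h1 c hl
          rw [List.count_cons_self] at this
          exact count_eq_zero.1 (by omega)
        rw [hf]
        refine ⟨Function.update φ c (c :: s₀), [], s₁, ?_, by simp, e3, ?_, by simp, ?_⟩
        · rw [Function.update_of_ne (Ne.symm hcv), e1]
        · intro l' hl''
          by_cases h : l' = c
          · subst h; simp [e2, Ne.symm hcv]
          · rw [Function.update_of_ne h]; exact e4 _ hl''
        · rw [flatMap_cons, Function.update_self, flatMap_update _ fun h => hcw (List.mem_filter.1 h).1]
          conv_lhs => rw [e6]
          simp
      · have hl' : isLin c = false := by simpa using hl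
        have hf : (c :: w).filter (vlin v) = w.filter (vlin v) := by simp [vlin, hl', hcv]
        rw [hf]
        refine ⟨φ, c :: s₀, s₁, e1, by simp [e2, Ne.symm hcv], e3, e4, by simpa [hl'] using e5, ?_⟩
        conv_lhs => rw [e6]
        simp

/-! ### Padding with `v` -/

/-- The substitution `t i ↦ v^(f i) (t i) v^(g i)`. -/
def pad (v : Letter) (f g : ℕ → ℕ) : Letter → List Letter
  | t i => List.replicate (f i) v ++ t i :: List.replicate (g i) v
  | c => [c]

/-- Every gap other than the initial one is adjacent to some `t i`, so all inserted `v` except an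
initial power can be charged to the substitution `pad`. -/
theorem exists_pad_zt {v : Letter} {L : List ℕ} (hL : L.Nodup) :
    ∀ {w : List Letter}, del v w = ztWord L → ∃ (n : ℕ) (f g : ℕ → ℕ),
      w = List.replicate n v ++ (ztWord L).flatMap (pad v f g) := by
  induction L with
  | nil =>
    intro w h
    exact ⟨w.length, fun _ => 0, fun _ => 0, by simpa using eq_replicate_of_del_eq_nil h⟩
  | cons i L ih =>
    intro w h
    rw [ztWord_cons] at h
    obtain ⟨a, b, rfl, h1, h2⟩ := del_eq_cons h
    obtain ⟨c, d, rfl, h3, h4⟩ := del_eq_cons h2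
    obtain ⟨n, f, g, rfl⟩ := ih hL.of_cons h4
    refine ⟨a.length, Function.update f i c.length, Function.update g i n, ?_⟩
    have e : (ztWord L).flatMap (pad v (Function.update f i c.length) (Function.update g i n)) =
        (ztWord L).flatMap (pad v f g) := by
      refine List.flatMap_congr fun d hd => ?_
      obtain ⟨j, hj, rfl | rfl⟩ := mem_ztWord.1 hd
      · rfl
      · have : j ≠ i := fun e => (List.nodup_cons.1 hL).1 (e ▸ hj)
        simp [pad, this]
    rw [ztWord_cons, flatMap_cons, flatMap_cons, e]
    conv_lhs => rw [eq_replicate_of_del_eq_nil h1, eq_replicate_of_del_eq_nil h3]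
    simp [pad]

theorem exists_pad_tz {v : Letter} {L : List ℕ} (hL : L.Nodup) :
    ∀ {w : List Letter}, del v w = tzWord L → ∃ (n : ℕ) (f g : ℕ → ℕ),
      w = (tzWord L).flatMap (pad v f g) ++ List.replicate n v := by
  induction L with
  | nil =>
    intro w h
    exact ⟨w.length, fun _ => 0, fun _ => 0, by simpa using eq_replicate_of_del_eq_nil h⟩
  | cons i L ih =>
    intro w h
    rw [tzWord_cons] at h
    obtain ⟨a, b, rfl, h1, h2⟩ := del_eq_cons h
    obtain ⟨c, d, rfl, h3, h4⟩ := del_eq_cons h2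
    obtain ⟨n, f, g, rfl⟩ := ih hL.of_cons h4
    refine ⟨n, Function.update f i a.length, Function.update g i c.length, ?_⟩
    have e : (tzWord L).flatMap (pad v (Function.update f i a.length)
        (Function.update g i c.length)) = (tzWord L).flatMap (pad v f g) := by
      refine List.flatMap_congr fun d hd => ?_
      obtain ⟨j, hj, rfl | rfl⟩ := mem_tzWord.1 hd
      · have : j ≠ i := fun e => (List.nodup_cons.1 hL).1 (e ▸ hj)
        simp [pad, this]
      · rfl
    rw [tzWord_cons, flatMap_cons, flatMap_cons, e]
    conv_lhs => rw [eq_replicate_of_del_eq_nil h1, eq_replicate_of_del_eq_nil h3]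
    simp [pad]

/-- Padding fixes powers of `v`, so a composition of paddings adds the exponents. -/
theorem flatMap_pad_pad {v : Letter} (hv : v = x ∨ v = y) (f g f' g' : ℕ → ℕ) (w : List Letter) :
    (w.flatMap (pad v f g)).flatMap (pad v f' g') =
      w.flatMap (pad v (fun i => f i + f' i) fun i => g' i + g i) := by
  rw [List.flatMap_assoc]
  refine List.flatMap_congr fun c _ => ?_
  have hr : ∀ n, (List.replicate n v).flatMap (pad v f' g') = List.replicate n v := by
    intro n
    have : pad v f' g' v = [v] := by rcases hv with rfl | rfl <;> rfl
    induction n with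
    | zero => rfl
    | succ n ih => rw [List.replicate_succ, flatMap_cons, ih, this]; rfl
  cases c with
  | t i =>
    simp only [pad, flatMap_append, flatMap_cons, hr, append_assoc, cons_append,
      List.replicate_append_replicate]
    rw [← append_assoc, List.replicate_append_replicate]
  | _ => simp [pad]

theorem flatMap_pad_eq_self {v : Letter} {f g : ℕ → ℕ} {w : List Letter}
    (h : ∀ i, t i ∈ w → f i = 0 ∧ g i = 0) : w.flatMap (pad v f g) = w := by
  conv_rhs => rw [← List.flatMap_singleton' w]
  refine List.flatMap_congr fun c hc => ?_
  cases c with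
  | t i => simp [pad, h i hc]
  | _ => rfl

/-- Padding twice creates a square at the first occurrence of `v`. -/
theorem exists_square_pad {v : Letter} (f g : ℕ → ℕ) : ∀ {w a β : List Letter}, v ∉ w → v ∉ a →
    w.flatMap (pad v f g) = a ++ v :: β → ∃ β',
      w.flatMap (pad v (fun i => f i + f i) fun i => g i + g i) = a ++ v :: v :: β' := by
  intro w
  induction w with
  | nil => intro a β _ _ h; simp at h
  | cons c w ih =>
    intro a β h1 ha h2
    simp only [mem_cons, not_or] at h1
    rw [flatMap_cons] at h2 ⊢
    by_cases hc : v ∈ pad v f g c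
    · cases c with
      | t i =>
        by_cases hf : f i = 0
        · have hg : g i ≠ 0 := by
            intro hg
            simp [pad, hf, hg] at hc
            exact h1.1 hc
          obtain ⟨k, hk⟩ := Nat.exists_eq_succ_of_ne_zero hg
          have e : a = [t i] := by
            refine (split_unique (A := [t i]) (B := List.replicate k v ++ w.flatMap (pad v f g))
              (by simpa using h1.1) ha (Eq.trans ?_ h2)).1.symm
            simp [pad, hf, hk, List.replicate_succ]
          refine ⟨List.replicate (k + k) v ++
            w.flatMap (pad v (fun i => f i + f i) fun i => g i + g i), ?_⟩
          have : g i + g i = (k + k) + 1 + 1 := by omega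
          simp [pad, hf, this, List.replicate_succ, e]
        · obtain ⟨k, hk⟩ := Nat.exists_eq_succ_of_ne_zero hf
          have e : a = [] := by
            refine (split_unique (A := []) (B := List.replicate k v ++ t i ::
              List.replicate (g i) v ++ w.flatMap (pad v f g)) (by simp) ha (Eq.trans ?_ h2)).1.symm
            simp [pad, hk, List.replicate_succ]
          refine ⟨List.replicate (k + k) v ++ t i :: List.replicate (g i + g i) v ++
            w.flatMap (pad v (fun i => f i + f i) fun i => g i + g i), ?_⟩
          have : f i + f i = (k + k) + 1 + 1 := by omega
          simp [pad, this, List.replicate_succ, e]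
      | _ => exact absurd (by simpa [pad] using hc) h1.1
    · have hfg : pad v f g c = [c] ∧ pad v (fun i => f i + f i) (fun i => g i + g i) c = [c] := by
        cases c with
        | t i =>
          have hf : f i = 0 := by by_contra h; simp [pad, h] at hc
          have hg : g i = 0 := by by_contra h; simp [pad, h] at hc
          simp [pad, hf, hg]
        | _ => exact ⟨rfl, rfl⟩
      rw [hfg.1] at h2
      rw [hfg.2]
      cases a with
      | nil =>
        simp only [singleton_append, nil_append, List.cons.injEq] at h2
        exact absurd h2.1.symm h1.1
      | cons d a =>
        simp only [cons_append, List.cons.injEq] at h2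
        obtain ⟨β', h4⟩ := ih h1.2 (fun h => ha (by simp [h])) h2.2
        exact ⟨β', by simp [h4, h2.1]⟩

theorem del_flatMap_pad {v : Letter} (f g : ℕ → ℕ) {w : List Letter} (hv : v = x ∨ v = y) :
    del v (w.flatMap (pad v f g)) = del v w := by
  have hr : ∀ n, del v (List.replicate n v) = [] := fun n => by simp [del]
  induction w with
  | nil => rfl
  | cons c w ih =>
    rw [flatMap_cons, del_append, ih]
    by_cases hc : c = v
    · subst hc
      have : pad c f g c = [c] := by rcases hv with rfl | rfl <;> rfl
      simp [this]
    · cases c with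
      | t i => simp [pad, del_cons_ne hc, hr]
      | _ => simp [pad, del_cons_ne hc]

/-- The first `v` lies in the padding or in the final power; doubling the exponents makes it a
square in either case. -/
theorem exists_square_tz {v : Letter} (f g : ℕ → ℕ) (n : ℕ) {w p β : List Letter} (hw : v ∉ w)
    (hp : v ∉ p) (h : w.flatMap (pad v f g) ++ List.replicate n v = p ++ v :: β) : ∃ β',
      w.flatMap (pad v (fun i => f i + f i) fun i => g i + g i) ++ List.replicate (n + n) v =
        p ++ v :: v :: β' := by
  by_cases hv : v ∈ w.flatMap (pad v f g)
  · obtain ⟨a, β₀, e, ha⟩ := List.eq_append_cons_of_mem hv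
    obtain ⟨β', h'⟩ := exists_square_pad f g hw ha e
    rw [e] at h
    obtain rfl : a = p := (split_unique (B := β₀ ++ List.replicate n v) ha hp (by simpa using h)).1
    exact ⟨β' ++ List.replicate (n + n) v, by simp [h']⟩
  · have e : ∀ i, t i ∈ w → f i = 0 ∧ g i = 0 := by
      intro i hi
      by_contra hne
      refine hv (List.mem_flatMap.2 ⟨t i, hi, ?_⟩)
      simp only [pad, mem_append, mem_cons, List.mem_replicate]
      tauto
    rw [flatMap_pad_eq_self e] at h
    rw [flatMap_pad_eq_self fun i hi => by simp [e i hi]]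
    cases n with
    | zero =>
      exfalso
      apply hw
      simp only [List.replicate_zero, append_nil] at h
      simp [h]
    | succ n =>
      obtain rfl := (split_unique (B := List.replicate n v) hw hp h).1
      exact ⟨List.replicate (n + n) v, by
        have : n + 1 + (n + 1) = n + n + 1 + 1 := by omega
        simp [this, List.replicate_succ]⟩

/-! ### Minimal violated patterns -/

/-- An alternating pattern that is violated while its proper factors are satisfied. -/
structure Good (M : Type u) [Monoid M] (s : ℕ → Bool) (D : List ℕ) : Prop where
  nodup : D.Nodup
  chain : D.IsChain fun i j => s i ≠ s j
  not_collapses : ¬ Collapses M s D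
  tail : Collapses M s D.tail
  dropLast : Collapses M s D.dropLast

theorem Good.ne_nil {s : ℕ → Bool} {D : List ℕ} (h : Good M s D) : D ≠ [] := by
  rintro rfl; exact h.not_collapses (collapses_nil s)

/-- A proper factor misses the first or the last label, so it is a sublist of `D.tail` or
`D.dropLast`. -/
theorem Good.factor {s : ℕ → Bool} {D A I B : List ℕ} (h : Good M s D) (e : D = A ++ (I ++ B))
    (hAB : A ≠ [] ∨ B ≠ []) : Collapses M s I := by
  rcases hAB with hA | hB
  · obtain ⟨a, A, rfl⟩ := List.exists_cons_of_ne_nil hA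
    refine h.tail.sublist (h.nodup.sublist (List.tail_sublist D)) ?_
    rw [e]
    exact (List.sublist_append_left I B).trans (List.sublist_append_right A _)
  · refine h.dropLast.sublist (h.nodup.sublist (List.dropLast_sublist D)) ?_
    rw [e, ← append_assoc, List.dropLast_append_of_ne_nil hB, append_assoc]
    exact (List.sublist_append_left I _).trans (List.sublist_append_right A _)

theorem del_sublist (v : Letter) (w : List Letter) : del v w <+ w := List.filter_sublist

/-- The substitutions inserting `v` around the letters `t i` on both sides. -/
theorem exists_pad {v : Letter} {s : ℕ → Bool} {Z : List ℕ} (hZ : Z.Nodup) {w₁ w₃ : List Letter}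
    (h1 : del v w₁ = pre s Z) (h3 : del v w₃ = suf s Z) :
    ∃ (n m : ℕ) (f g : ℕ → ℕ), w₁ = List.replicate n v ++ (pre s Z).flatMap (pad v f g) ∧
      w₃ = (suf s Z).flatMap (pad v f g) ++ List.replicate m v ∧
      (v ∉ w₁ → ∀ i, s i = true → f i = 0 ∧ g i = 0) := by
  obtain ⟨n, f₁, g₁, e1⟩ := exists_pad_zt (lab_nodup hZ) h1
  obtain ⟨m, f₃, g₃, e3⟩ := exists_pad_tz (lab_nodup hZ) h3
  -- Prefix and suffix involve labels of different types, so the two paddings combine into one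
  -- according to `s`.
  by_cases hw : v ∈ w₁
  · refine ⟨n, m, fun i => if s i then f₁ i else f₃ i, fun i => if s i then g₁ i else g₃ i, ?_, ?_,
      fun h => absurd hw h⟩
    · rw [e1]
      congr 1
      refine List.flatMap_congr fun c hc => ?_
      obtain ⟨i, hi, rfl | rfl⟩ := mem_ztWord.1 hc
      · rfl
      · simp [pad, (mem_lab.1 hi).2]
    · rw [e3]
      congr 1
      refine List.flatMap_congr fun c hc => ?_
      obtain ⟨i, hi, rfl | rfl⟩ := mem_tzWord.1 hc
      · have := (mem_lab.1 hi).2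
        simp only [Bool.not_eq_true'] at this
        simp [pad, this]
      · rfl
  · refine ⟨0, m, fun i => if s i then 0 else f₃ i, fun i => if s i then 0 else g₃ i, ?_, ?_, ?_⟩
    · rw [← h1, del_eq_self hw, flatMap_pad_eq_self]
      · rfl
      · intro i hi
        rw [← del_eq_self hw, h1] at hi
        obtain ⟨j, hj, h | h⟩ := mem_ztWord.1 hi
        · simp at h
        · simp only [Letter.t.injEq] at h; subst h
          simp [(mem_lab.1 hj).2]
    · rw [e3]
      congr 1
      refine List.flatMap_congr fun c hc => ?_
      obtain ⟨i, hi, rfl | rfl⟩ := mem_tzWord.1 hc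
      · have := (mem_lab.1 hi).2
        simp only [Bool.not_eq_true'] at this
        simp [pad, this]
      · rfl
    · intro _ i hi
      simp [hi]

/-! ### Words equivalent to the word of one violated pattern -/

section Special

variable {v : Letter} (hv : v = x ∨ v = y)
include hv

theorem notMem_pre (s Z) : v ∉ pre s Z := by rcases hv with rfl | rfl <;> simp [pre]
theorem notMem_suf (s Z) : v ∉ suf s Z := by rcases hv with rfl | rfl <;> simp [suf]
theorem notMem_map_z (Z : List ℕ) : v ∉ Z.map z := by rcases hv with rfl | rfl <;> simp
theorem r_ne : r ≠ v := by rcases hv with rfl | rfl <;> simp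
theorem q_ne : q ≠ v := by rcases hv with rfl | rfl <;> simp
theorem z_ne (i) : z i ≠ v := by rcases hv with rfl | rfl <;> simp
theorem t_ne (i) : t i ≠ v := by rcases hv with rfl | rfl <;> simp
theorem isLin_special : isLin v = false := by rcases hv with rfl | rfl <;> rfl
theorem keep_special (p : ℕ → Bool) : keep p v = true := by rcases hv with rfl | rfl <;> rfl

theorem del_word (s : ℕ → Bool) (Z₁ Z₂ Z₃ : List ℕ) : del v (word s v Z₁ Z₂ Z₃) =
    bare s (Z₁ ++ (Z₂ ++ Z₃)) (Z₁ ++ (Z₂ ++ Z₃)) := by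
  simp [word, bare, del_cons_ne (r_ne hv), del_cons_ne (q_ne hv), del_eq_self (notMem_pre hv _ _),
    del_eq_self (notMem_suf hv _ _), del_eq_self (notMem_map_z hv _)]

theorem exists_decomp (hM : Basic M) (hT : ¬ Trivializes M) {s : ℕ → Bool} {Z₁ Z₂ Z₃ : List ℕ}
    (hZ : (Z₁ ++ (Z₂ ++ Z₃)).Nodup) {w : List Letter} (h : Eqv M (word s v Z₁ Z₂ Z₃) w) :
    ∃ w₁ w₂ w₃ Y, w = w₁ ++ r :: (w₂ ++ q :: w₃) ∧ del v w₁ = pre s (Z₁ ++ (Z₂ ++ Z₃)) ∧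
      del v w₂ = Y.map z ∧ del v w₃ = suf s (Z₁ ++ (Z₂ ++ Z₃)) ∧ (Z₁ ++ (Z₂ ++ Z₃)).Perm Y ∧
      Eqv M (bare s (Z₁ ++ (Z₂ ++ Z₃)) (Z₁ ++ (Z₂ ++ Z₃))) (bare s (Z₁ ++ (Z₂ ++ Z₃)) Y) := by
  have h1 : Eqv M (del v (word s v Z₁ Z₂ Z₃)) (del v w) := h.filter _
  rw [del_word hv] at h1
  obtain ⟨Y, e, hY⟩ := eq_bare_of_eqv hM hT hZ h1
  rw [e] at h1
  obtain ⟨w₁, w', rfl, h2, h3⟩ := del_eq_append_cons (e.trans rfl)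
  obtain ⟨w₂, w₃, rfl, h4, h5⟩ := del_eq_append_cons h3
  exact ⟨w₁, w₂, w₃, Y, rfl, h2, h4, h5, hY, h1⟩

theorem mem_of_del_eq {c : Letter} {w u : List Letter} (h : del v w = u) (hc : c ≠ v) :
    c ∈ w ↔ c ∈ u := by rw [← h, mem_del]; tauto

/-- Comparing the positions of the two occurrences of `v` with those of `r` and `q`. -/
theorem exponents (s : ℕ → Bool) {Z₁ Z₂ Z₃ Y : List ℕ} {w₁ w₂ w₃ : List Letter}
    (h : Eqv M (word s v Z₁ Z₂ Z₃) (w₁ ++ r :: (w₂ ++ q :: w₃)))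
    (h1 : del v w₁ = pre s (Z₁ ++ (Z₂ ++ Z₃))) (h2 : del v w₂ = Y.map z)
    (h3 : del v w₃ = suf s (Z₁ ++ (Z₂ ++ Z₃))) (V R Q : M) :
    R * (V * (V * Q)) = V ^ w₁.count v * (R * (V ^ w₂.count v * (Q * V ^ w₃.count v))) := by
  let φ : Letter → M := fun c => if c = v then V else if c = r then R else if c = q then Q else 1
  have hφv : φ v = V := by simp [φ]
  have hφr : φ r = R := by simp [φ, r_ne hv]
  have hφq : φ q = Q := by simp [φ, q_ne hv]
  have hφz : ∀ Z : List ℕ, ((Z.map z).map φ).prod = 1 := by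
    intro Z
    rw [prod_eq_pow (v := v), count_eq_zero.2 (notMem_map_z hv Z), pow_zero]
    intro c hc hcv
    obtain ⟨i, -, rfl⟩ := List.mem_map.1 hc
    simp [φ, hcv]
  have hφp : ∀ Z, ((pre s Z).map φ).prod = 1 := by
    intro Z
    rw [prod_eq_pow (v := v), count_eq_zero.2 (notMem_pre hv s Z), pow_zero]
    intro c hc hcv
    obtain ⟨i, -, rfl | rfl⟩ := mem_ztWord.1 hc <;> simp [φ, hcv]
  have hφs : ∀ Z, ((suf s Z).map φ).prod = 1 := by
    intro Z
    rw [prod_eq_pow (v := v), count_eq_zero.2 (notMem_suf hv s Z), pow_zero]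
    intro c hc hcv
    obtain ⟨i, -, rfl | rfl⟩ := mem_tzWord.1 hc <;> simp [φ, hcv]
  have e : ∀ {w u : List Letter}, del v w = u → r ∉ u → q ∉ u →
      (w.map φ).prod = V ^ w.count v := by
    intro w u hw hr hq
    rw [prod_eq_pow (v := v), hφv]
    intro c hc hcv
    have hcu : c ∈ u := (mem_of_del_eq hv hw hcv).1 hc
    have h1 : c ≠ r := by rintro rfl; exact hr hcu
    have h2 : c ≠ q := by rintro rfl; exact hq hcu
    simp [φ, hcv, h1, h2]
  have key := h φ
  simp only [word, map_append, map_cons, prod_append, prod_cons, hφv, hφr, hφq, hφz, hφp, hφs,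
    one_mul, mul_one] at key
  rw [key, e h1 (by simp [pre]) (by simp [pre]), e h2 (by simp) (by simp),
    e h3 (by simp [suf]) (by simp [suf])]

/-- Keeping only `v` and `r` leaves `R V² = V^a R V^n` with `a ≥ 1`. -/
theorem satQ_of_count (hM : Basic M) (hT : ¬ Trivializes M) {s : ℕ → Bool} {Z₁ Z₂ Z₃ Y : List ℕ}
    {w₁ w₂ w₃ : List Letter} (h : Eqv M (word s v Z₁ Z₂ Z₃) (w₁ ++ r :: (w₂ ++ q :: w₃)))
    (h1 : del v w₁ = pre s (Z₁ ++ (Z₂ ++ Z₃))) (h2 : del v w₂ = Y.map z)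
    (h3 : del v w₃ = suf s (Z₁ ++ (Z₂ ++ Z₃))) (ha : v ∈ w₁) : SatQ M := by
  refine hM.satQ_of_pos hT (List.count_pos_iff.2 ha) (n := w₂.count v + w₃.count v) fun V R => ?_
  have := exponents hv s h h1 h2 h3 V R 1
  rw [mul_one, one_mul, ← pow_add] at this
  exact this

/-- Every `z i` in the middle has its second copy in `w₁` or `w₃`, as `killed_of_square` requires;
if `v` occurs in `w₁`, `SatQ` takes over. -/
theorem killed_of_middle_square (hM : Basic M) {s : ℕ → Bool} {Z Y : List ℕ}
    {w₁ α β w₃ : List Letter} (h1 : del v w₁ = pre s Z) (h2 : del v (α ++ v :: v :: β) = Y.map z)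
    (h3 : del v w₃ = suf s Z) (hY : ∀ i ∈ Y, i ∈ Z) (hQ : v ∉ w₁ ∨ SatQ M) :
    Killed M v (w₁ ++ r :: ((α ++ v :: v :: β) ++ q :: w₃)) := by
  rcases hQ with hw | hQ
  · have := hM.killed_of_square (v := v) (a := w₁ ++ [r]) (α := α) (β := β ++ q :: w₃)
      (by simp [hw, (r_ne hv).symm]) (by
        intro c hc
        by_cases hcv : c = v
        · exact Or.inl hcv
        right
        have : c ∈ Y.map z := by rw [← h2]; simp [hc, hcv]
        obtain ⟨i, hi, rfl⟩ := List.mem_map.1 this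
        cases hs : s i with
        | true =>
          have : z i ∈ del v w₁ := by rw [h1]; simp [pre, hY i hi, hs]
          simp [(mem_del.1 this).1]
        | false =>
          have : z i ∈ del v w₃ := by rw [h3]; simp [suf, hY i hi, hs]
          simp [(mem_del.1 this).1])
    simpa using this
  · have := hM.killed_of_satQ hQ (v := v) (w₁ ++ r :: α) (β ++ q :: w₃)
    simpa using this

theorem Good.not_killed (hM : Basic M) {s : ℕ → Bool} {D : List ℕ} (hD : Good M s D) :
    ¬ Killed M v (word s v [] D []) := fun h =>
  hD.not_collapses (Collapses.of_killed hM hv hD.nodup h)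

/-- In a violated pattern, the middle part of a word is determined as soon as `v` occurs twice. -/
theorem Good.middle (hM : Basic M) (hT : ¬ Trivializes M) {s : ℕ → Bool} {D : List ℕ}
    (hD : Good M s D) {w₁ w₂ w₃ : List Letter}
    (h : Eqv M (word s v [] D []) (w₁ ++ r :: (w₂ ++ q :: w₃)))
    (h1 : del v w₁ = pre s D) (h2 : del v w₂ = D.map z) (h3 : del v w₃ = suf s D)
    (hb : 2 ≤ w₂.count v) : w₂ = v :: (D.map z ++ [v]) := by
  have hnk : ¬ Killed M v (w₁ ++ r :: (w₂ ++ q :: w₃)) := fun hk =>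
    hD.not_killed hv hM (hk.congr h)
  have hQ : v ∉ w₁ ∨ SatQ M := by
    by_cases hw : v ∈ w₁
    · exact Or.inr (satQ_of_count hv hM hT h (by simpa using h1) h2 (by simpa using h3) hw)
    · exact Or.inl hw
  obtain ⟨α, w', rfl, hα⟩ := List.eq_append_cons_of_mem (List.count_pos_iff.1 (by omega : 0 < w₂.count v))
  have hb' : 0 < w'.count v := by
    rw [List.count_append, List.count_cons_self, count_eq_zero.2 hα] at hb
    omega
  obtain ⟨γ, β, rfl, hγ⟩ := List.eq_append_cons_of_mem (List.count_pos_iff.1 hb')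
  have h2' := h2
  rw [del_append, del_cons_self, del_append, del_cons_self, del_eq_self hα, del_eq_self hγ] at h2
  obtain ⟨A, D', rfl, rfl, h4⟩ := List.map_eq_append_iff.1 h2.symm
  obtain ⟨I, B, rfl, rfl, h5⟩ := List.map_eq_append_iff.1 h4
  -- If the first two `v` enclose a proper factor, that factor collapses by minimality and yields a
  -- square. If they enclose all of `D`, a third `v` would be adjacent to the second.
  by_cases hAB : A ≠ [] ∨ B ≠ []
  · exfalso
    have hc := hD.factor rfl hAB
    have hI : I <+ A ++ (I ++ B) :=
      (List.sublist_append_left I _).trans (List.sublist_append_right A _)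
    have hl : ∀ s : ℕ → Bool, (lab s I).map z <+ (lab s (A ++ (I ++ B))).map z := by
      intro s
      refine List.Sublist.map _ ?_
      conv_lhs => rw [← filter_mem_of_sublist hD.nodup hI]
      rw [← lab_filter hD.nodup]
      exact List.filter_sublist
    have := hc (w₁ ++ r :: A.map z) (β ++ q :: w₃) v
      (((hl _).trans (map_z_sublist_ztWord _)).trans
        (((h1 ▸ del_sublist v w₁ : pre s _ <+ w₁)).trans (List.sublist_append_left _ _)))
      (((hl _).trans (map_z_sublist_tzWord _)).trans
        (((h3 ▸ del_sublist v w₃ : suf s _ <+ w₃)).trans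
          ((List.sublist_cons_self _ _).trans (List.sublist_append_right _ _))))
    refine hnk (Killed.congr (w' := w₁ ++ r :: (((A.map z ++ I.map z) ++ v :: v :: β) ++ q :: w₃))
      (by simpa using this) ?_)
    refine killed_of_middle_square hv hM h1 (Y := A ++ (I ++ B)) ?_ h3 (fun i hi => hi) hQ
    rw [← h2']
    simp
  · simp only [ne_eq, not_or, not_not] at hAB
    obtain ⟨rfl, rfl⟩ := hAB
    have hβ := length_of_replicate_count h5.symm
    simp only [map_nil, nil_append, append_nil] at *
    cases hn : β.count v with
    | zero => rw [hn] at hβ; rw [hβ]; rfl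
    | succ n =>
      exfalso
      rw [hn, List.replicate_succ] at hβ
      refine hnk ?_
      have := killed_of_middle_square hv hM h1 (α := v :: I.map z) (β := List.replicate n v)
        (Y := I) (by rw [hβ] at h2'; exact h2') h3 (fun i hi => hi) hQ
      rw [hβ]
      simpa using this

theorem flatMap_pad_word (s : ℕ → Bool) (D : List ℕ) (f g : ℕ → ℕ) :
    (word s v [] D []).flatMap (pad v f g) = (pre s D).flatMap (pad v f g) ++
      r :: (v :: (D.map z ++ v :: q :: (suf s D).flatMap (pad v f g))) := by
  have hz : (D.map z).flatMap (pad v f g) = D.map z := flatMap_map_z D _ fun _ => rfl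
  have hvv : pad v f g v = [v] := by rcases hv with rfl | rfl <;> rfl
  have hr : pad v f g r = [r] := rfl
  have hq : pad v f g q = [q] := rfl
  simp [word, hz, hvv, hr, hq]

theorem flatMap_pad_replicate (f g : ℕ → ℕ) (n : ℕ) :
    (List.replicate n v).flatMap (pad v f g) = List.replicate n v := by
  refine flatMap_pad_eq_self fun i hi => ?_
  exact absurd (List.eq_of_mem_replicate hi) (t_ne hv i)

/-- The equivalent word is a padding of the original one between two powers of `v`, so the
equivalence can be applied to itself. This doubles all exponents, the first `v` becomes a square,
and the word would be killed. -/
theorem Good.notMem_left (hM : Basic M) {s : ℕ → Bool} {D : List ℕ}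
    (hD : Good M s D) {w₁ w₃ : List Letter}
    (h : Eqv M (word s v [] D []) (w₁ ++ r :: (v :: (D.map z ++ v :: q :: w₃))))
    (h1 : del v w₁ = pre s D) (h3 : del v w₃ = suf s D) : v ∉ w₁ := by
  intro hw
  obtain ⟨n, m, f, g, e1, e3, -⟩ := exists_pad hD.nodup h1 h3
  have e : w₁ ++ r :: (v :: (D.map z ++ v :: q :: w₃)) =
      List.replicate n v ++ ((word s v [] D []).flatMap (pad v f g) ++ List.replicate m v) := by
    rw [flatMap_pad_word hv, e1, e3]; simp
  rw [e] at h
  have h' := h.subst (pad v f g)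
  simp only [flatMap_append, flatMap_pad_replicate hv, flatMap_pad_pad hv] at h'
  have h4 := h.trans ((h'.left (List.replicate n v)).right (List.replicate m v)
    |> fun h => by simpa only [append_assoc] using h)
  refine hD.not_killed hv hM (Killed.congr h4 ?_)
  cases n with
  | succ n =>
    have := hM.killed_of_square (v := v) (a := []) (α := [])
      (β := List.replicate (n + n) v ++ ((word s v [] D []).flatMap
        (pad v (fun i => f i + f i) fun i => g i + g i) ++
        (List.replicate m v ++ List.replicate m v))) (by simp) (by simp)
    refine Eq.mp (congrArg _ ?_) this
    have e6 : List.replicate (n + 1) v ++ List.replicate (n + 1) v =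
        v :: v :: List.replicate (n + n) v := by
      rw [List.replicate_append_replicate, show n + 1 + (n + 1) = n + n + 1 + 1 by omega,
        List.replicate_succ, List.replicate_succ]
    rw [← append_assoc (List.replicate (n + 1) v), e6]
    simp
  | zero =>
    simp only [List.replicate_zero, nil_append] at e1 ⊢
    obtain ⟨a, β, e4, ha⟩ := List.eq_append_cons_of_mem (e1 ▸ hw)
    obtain ⟨β', e5⟩ := exists_square_pad f g (notMem_pre hv s D) ha e4
    rw [flatMap_pad_word hv, e5]
    have := hM.killed_of_square (v := v) (a := a) (α := []) (β := β' ++ (r :: (v :: (D.map z ++ v ::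
      q :: (suf s D).flatMap (pad v (fun i => f i + f i) fun i => g i + g i))) ++
        (List.replicate m v ++ List.replicate m v))) ha (by simp)
    simpa using this

end Special

/-! ### Words equivalent to the words of a pattern -/

/-- The data of the patterns for which equivalent words are determined: `D₁`, `D₂`, `D₃` are
violated, `o` is the label outside of the part between the two `v`, and `o'` is its twin. -/
structure Pattern (M : Type u) [Monoid M] (s : ℕ → Bool) (Z₁ Z₂ Z₃ D₁ D₂ D₃ : List ℕ)
    (o o' : ℕ) : Prop where
  nodup : (Z₁ ++ (Z₂ ++ Z₃)).Nodup
  good₁ : Good M s D₁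
  good₂ : Good M s D₂
  good₃ : Good M s D₃
  sub₁ : D₁ <+ Z₂
  sub₂ : D₂ <+ Z₂
  cover : ∀ i ∈ Z₂, i ∈ D₁ ∨ i ∈ D₂
  outer : (Z₁ = [o] ∧ Z₃ = []) ∨ (Z₁ = [] ∧ Z₃ = [o])
  sub₃ : D₃ <+ Z₁ ++ (Z₂ ++ Z₃)
  mem₃ : o ∈ D₃
  map₃ : D₃.map (Function.update id o o') = D₁
  type_eq : s o = s o'
  lt : o < o'
  adj : ∀ i ∈ Z₁ ++ (Z₂ ++ Z₃), i ≤ o ∨ o' ≤ i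
  left : SatRight M ∨ ∀ j, j ∉ D₁ ∨ j ∉ D₂
  right : SatLeft M ∨ ∀ i ∈ Z₁ ++ (Z₂ ++ Z₃), s i = true

/-- In `z_i t_i z_j t_j ⋯` no two nonlinear letters are adjacent. -/
theorem factor_ztWord {A γ B : List Letter} (hγ : ∀ c ∈ γ, isLin c = false) : ∀ {L : List ℕ},
    ztWord L = A ++ (γ ++ B) → γ = [] ∨ ∃ j ∈ L, γ = [z j] := by
  intro L
  induction L generalizing A with
  | nil =>
    intro h
    rw [ztWord_nil, eq_comm, append_eq_nil_iff, append_eq_nil_iff] at h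
    exact Or.inl h.2.1
  | cons i L ih =>
    intro h
    rw [ztWord_cons] at h
    match A, h with
    | [], h =>
      match γ, h, hγ with
      | [], _, _ => exact Or.inl rfl
      | [c], h, _ =>
        simp only [nil_append, singleton_append, List.cons.injEq] at h
        exact Or.inr ⟨i, by simp, by rw [h.1]⟩
      | c :: d :: γ, h, hγ =>
        simp only [nil_append, cons_append, List.cons.injEq] at h
        have := hγ d (by simp)
        rw [← h.2.1] at this
        simp [isLin] at this
    | [a], h =>
      match γ, h, hγ with
      | [], _, _ => exact Or.inl rfl
      | d :: γ, h, hγ =>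
        simp only [nil_append, cons_append, List.cons.injEq] at h
        have := hγ d (by simp)
        rw [← h.2.1] at this
        simp [isLin] at this
    | a :: b :: A, h =>
      simp only [cons_append, List.cons.injEq] at h
      rcases ih h.2.2 with h | ⟨j, hj, h⟩
      · exact Or.inl h
      · exact Or.inr ⟨j, by simp [hj], h⟩

theorem factor_tzWord {A γ B : List Letter} (hγ : ∀ c ∈ γ, isLin c = false) : ∀ {L : List ℕ},
    tzWord L = A ++ (γ ++ B) → γ = [] ∨ ∃ j ∈ L, γ = [z j] := by
  intro L
  induction L generalizing A with
  | nil =>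
    intro h
    rw [tzWord_nil, eq_comm, append_eq_nil_iff, append_eq_nil_iff] at h
    exact Or.inl h.2.1
  | cons i L ih =>
    intro h
    rw [tzWord_cons] at h
    match A, h with
    | [], h =>
      match γ, h, hγ with
      | [], _, _ => exact Or.inl rfl
      | d :: γ, h, hγ =>
        simp only [nil_append, cons_append, List.cons.injEq] at h
        have := hγ d (by simp)
        rw [← h.1] at this
        simp [isLin] at this
    | [a], h =>
      match γ, L, h, hγ with
      | [], _, _, _ => exact Or.inl rfl
      | [c], _, h, _ =>
        simp only [singleton_append, List.cons.injEq] at h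
        exact Or.inr ⟨i, by simp, by rw [h.2.1]⟩
      | c :: d :: γ, [], h, _ => simp at h
      | c :: d :: γ, j :: L, h, hγ =>
        simp only [nil_append, cons_append, List.cons.injEq, tzWord_cons] at h
        have := hγ d (by simp)
        rw [← h.2.2.1] at this
        simp [isLin] at this
    | a :: b :: A, h =>
      simp only [cons_append, List.cons.injEq] at h
      rcases ih h.2.2 with h | ⟨j, hj, h⟩
      · exact Or.inl h
      · exact Or.inr ⟨j, by simp [hj], h⟩

/-! ### The two occurrences of `v` stay in the middle -/

section Special

variable {v : Letter} (hv : v = x ∨ v = y)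
include hv

theorem filter_word_of_sublist {s : ℕ → Bool} {Z₁ Z₂ Z₃ D : List ℕ}
    (hZ : (Z₁ ++ (Z₂ ++ Z₃)).Nodup) (hD : D <+ Z₂) :
    (word s v Z₁ Z₂ Z₃).filter (keep fun i => decide (i ∈ D)) = word s v [] D [] := by
  have h2 := List.nodup_append.1 hZ
  have h3 := List.nodup_append.1 h2.2.1
  have e1 : Z₁.filter (fun i => decide (i ∈ D)) = [] := by
    rw [List.filter_eq_nil_iff]
    intro i hi
    simpa using fun h => h2.2.2 i hi i (by simp [hD.subset h]) rfl
  have e3 : Z₃.filter (fun i => decide (i ∈ D)) = [] := by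
    rw [List.filter_eq_nil_iff]
    intro i hi
    simpa using fun h => h3.2.2 i (hD.subset h) i hi rfl
  rw [filter_word hv hZ, e1, e3, filter_mem_of_sublist h3.1 hD]

/-- A word equivalent to a word of a pattern is not killed. -/
theorem not_killed_filter (hM : Basic M) {s : ℕ → Bool} {Z₁ Z₂ Z₃ D : List ℕ}
    (hZ : (Z₁ ++ (Z₂ ++ Z₃)).Nodup) (hD : Good M s D) (hs : D <+ Z₂) {w : List Letter}
    (h : Eqv M (word s v Z₁ Z₂ Z₃) w) :
    ¬ Killed M v (w.filter (keep fun i => decide (i ∈ D))) := by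
  intro hk
  refine hD.not_killed hv hM ?_
  rw [← filter_word_of_sublist hv hZ hs]
  exact Killed.congr (h.filter _) hk

theorem not_killed (hM : Basic M) {s : ℕ → Bool} {Z₁ Z₂ Z₃ D : List ℕ}
    (hZ : (Z₁ ++ (Z₂ ++ Z₃)).Nodup) (hD : Good M s D) (hs : D <+ Z₂) {w : List Letter}
    (h : Eqv M (word s v Z₁ Z₂ Z₃) w) : ¬ Killed M v w :=
  fun hk => not_killed_filter hv hM hZ hD hs h (hk.filter _)

theorem count_linear (hM : Basic M) (hT : ¬ Trivializes M) {s : ℕ → Bool} {Z₁ Z₂ Z₃ : List ℕ}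
    (hZ : (Z₁ ++ (Z₂ ++ Z₃)).Nodup) {w : List Letter} (h : Eqv M (word s v Z₁ Z₂ Z₃) w)
    {l : Letter} (hl : isLin l = true) : w.count l ≤ 1 := by
  have hlv : l ≠ v := by rintro rfl; rw [isLin_special hv] at hl; simp at hl
  have e : ∀ u, (del v u).count l = u.count l := fun u => List.count_filter (by simpa using hlv)
  have h1 : Eqv M (del v (word s v Z₁ Z₂ Z₃)) (del v w) := h.filter _
  have h2 := count_bare_lin (s := s) (Y := Z₁ ++ (Z₂ ++ Z₃)) hZ l hl
  rw [del_word hv] at h1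
  rw [← e, eqv_count hM hT h1 l h2]
  exact h2

/-- Without the letters `z i` the word of the pattern reads `⋯ r v v q ⋯`. As `w` is an image of its
own restriction to `v` and linear letters, it is equivalent to an image of that word, in which the
first occurrence of `v` is a square. -/
theorem killed_of_separated (hM : Basic M) (hT : ¬ Trivializes M) {s : ℕ → Bool}
    {Z₁ Z₂ Z₃ : List ℕ} (hZ : (Z₁ ++ (Z₂ ++ Z₃)).Nodup) {w : List Letter}
    (h : Eqv M (word s v Z₁ Z₂ Z₃) w)
    (hs : ∀ α γ β, v ∉ γ → w = α ++ v :: (γ ++ v :: β) → ∃ c ∈ γ, isLin c = true) :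
    Killed M v w := by
  obtain ⟨φ, s₀, s₁, e1, e2, e3, e4, -, e6⟩ := exists_flatMap_of_separated (isLin_special hv)
    (fun l hl => count_linear hv hM hT hZ h hl) hs
  have h1 := (((h.filter (vlin v)).subst φ).left s₀).right s₁
  rw [append_assoc, append_assoc, ← e6] at h1
  have hz : ∀ Z : List ℕ, (Z.map z).filter (vlin v) = [] := by
    intro Z
    rw [List.filter_eq_nil_iff]
    intro c hc
    obtain ⟨i, -, rfl⟩ := List.mem_map.1 hc
    simp [vlin, isLin, z_ne hv]
  have hvv : vlin v v = true := by simp [vlin]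
  have hr : vlin v r = true := by simp [vlin, isLin]
  have hq : vlin v q = true := by simp [vlin, isLin]
  have hnv : ∀ u : List Letter, v ∉ u → v ∉ (u.filter (vlin v)).flatMap φ := by
    intro u hu hc
    obtain ⟨c, hc, hc'⟩ := List.mem_flatMap.1 hc
    obtain ⟨h3, h4⟩ := List.mem_filter.1 hc
    have : c ≠ v := by rintro rfl; exact hu h3
    exact e4 c (by simpa [vlin, this] using h4) hc'
  have hk := hM.killed_of_square (v := v)
    (a := s₀ ++ (((pre s (Z₁ ++ (Z₂ ++ Z₃))).filter (vlin v)).flatMap φ ++ φ r)) (α := [])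
    (β := φ q ++ (((suf s (Z₁ ++ (Z₂ ++ Z₃))).filter (vlin v)).flatMap φ ++ s₁))
    (by simp only [mem_append, not_or]
        exact ⟨e2, hnv _ (notMem_pre hv _ _), e4 r rfl⟩) (by simp)
  refine Killed.congr h1.symm (Eq.mp (congrArg _ ?_) hk)
  simp [word, List.filter_append, hz, hvv, hr, hq, e1]

/-- In a word equivalent to a word of a pattern, the middle part contains `v` twice. -/
theorem Pattern.two_le_count (hM : Basic M) (hT : ¬ Trivializes M) {s : ℕ → Bool}
    {Z₁ Z₂ Z₃ D₁ D₂ D₃ : List ℕ} {o o' : ℕ} (hP : Pattern M s Z₁ Z₂ Z₃ D₁ D₂ D₃ o o')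
    {w₁ w₂ w₃ : List Letter} {Y : List ℕ}
    (h : Eqv M (word s v Z₁ Z₂ Z₃) (w₁ ++ r :: (w₂ ++ q :: w₃)))
    (h1 : del v w₁ = pre s (Z₁ ++ (Z₂ ++ Z₃))) (h2 : del v w₂ = Y.map z)
    (h3 : del v w₃ = suf s (Z₁ ++ (Z₂ ++ Z₃))) (hY : (Z₁ ++ (Z₂ ++ Z₃)).Perm Y) :
    2 ≤ w₂.count v := by
  by_contra hb
  have hnk := not_killed hv hM hP.nodup hP.good₁ hP.sub₁ h
  apply hnk
  -- It remains to exclude two consecutive `v` without a linear letter between them. Such a factor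
  -- lies wholly in `w₁`, `w₂` or `w₃`.
  refine killed_of_separated hv hM hT hP.nodup h ?_
  intro α γ β hγ e
  by_contra hlin
  have hlin : ∀ c ∈ γ, isLin c = false := by
    intro c hc
    by_contra hcl
    exact hlin ⟨c, hc, by simpa using hcl⟩
  have hvl : isLin v = false := isLin_special hv
  have hmid : ∀ l, isLin l = true → l ∉ v :: (γ ++ [v]) := by
    intro l hl hm
    simp only [mem_cons, mem_append, not_mem_nil, or_false] at hm
    rcases hm with rfl | hm | rfl
    · simp [hl] at hvl
    · have := hlin l hm; simp [hl] at this
    · simp [hl] at hvl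
  have hzm : ∀ j ∈ Z₁ ++ (Z₂ ++ Z₃), z j ∈ w₂ := by
    intro j hj
    have : z j ∈ del v w₂ := by rw [h2]; simpa using hY.subset hj
    exact (mem_del.1 this).1
  -- the square is killed when `SatQ` holds
  have hsq : SatQ M → ∀ α β, Eqv M (w₁ ++ r :: (w₂ ++ q :: w₃)) (α ++ v :: v :: β) → False := by
    intro hQ α β hE
    exact hnk (Killed.congr hE (hM.killed_of_satQ hQ α β))
  have e' : w₁ ++ r :: (w₂ ++ q :: w₃) = α ++ ((v :: (γ ++ [v])) ++ β) := by rw [e]; simp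
  rcases factor_split (hmid r rfl) e'.symm with ⟨C, rfl, rfl⟩ | ⟨C, rfl, e2⟩
  · have hQ : SatQ M := satQ_of_count hv hM hT h h1 h2 h3 (by simp)
    rw [del_append, del_append, del_cons_self, del_append, del_cons_self, del_nil, append_nil,
      del_eq_self hγ] at h1
    rcases factor_ztWord hlin h1.symm with rfl | ⟨j, hj, rfl⟩
    · exact hsq hQ α (C ++ r :: (w₂ ++ q :: w₃)) (Eqv.of_eq (by simp))
    · rcases hP.left with hR | hR
      · obtain ⟨b₁, b₂, e3⟩ := List.append_of_mem
          (show z j ∈ C ++ r :: (w₂ ++ q :: w₃) by simp [hzm j (mem_lab.1 hj).1])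
        refine hsq hQ (α ++ [z j]) (b₁ ++ z j :: b₂) ?_
        rw [e', e3]
        intro φ
        have := congrArg (fun m => (α.map φ).prod * (m * (b₂.map φ).prod))
          (hR (φ (z j)) (φ v) (b₁.map φ).prod)
        simpa [mul_assoc] using this
      -- Otherwise `j` is missing in `D₁` or in `D₂`, and restriction to that pattern makes the two
      -- `v` adjacent.
      · have key : ∀ D, Good M s D → D <+ Z₂ → j ∉ D → False := by
          intro D hD hs hjD
          refine not_killed_filter hv hM hP.nodup hD hs h ?_
          have := hM.killed_of_satQ hQ (v := v) (α.filter (keep fun i => decide (i ∈ D)))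
            ((C ++ r :: (w₂ ++ q :: w₃)).filter (keep fun i => decide (i ∈ D)))
          refine Eq.mp (congrArg _ ?_) this
          have hz : keep (fun i => decide (i ∈ D)) (z j) = false := by simp [keep, hjD]
          have hr : keep (fun i => decide (i ∈ D)) r = true := rfl
          have hq : keep (fun i => decide (i ∈ D)) q = true := rfl
          simp [List.filter_append, keep_special hv, hz, hr, hq]
        rcases hR j with hj' | hj'
        · exact key D₁ hP.good₁ hP.sub₁ hj'
        · exact key D₂ hP.good₂ hP.sub₂ hj'
  · rcases factor_split (hmid q rfl) e2.symm with ⟨C', rfl, rfl⟩ | ⟨C', rfl, rfl⟩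
    · apply hb
      simp only [List.count_append, List.count_cons_self]
      omega
    -- If `v` is absent from `w₁`, at most one `v` is left in the middle while two are in `w₃`; the
    -- exponents give `v²t ≈ v^b t v^c` with `b ≤ 1` and `c ≥ 2`.
    · have hQ : SatQ M := by
        by_cases hw : v ∈ w₁
        · exact satQ_of_count hv hM hT h h1 h2 h3 hw
        · refine hM.satQ_of_right (b := w₂.count v)
            (c := (C' ++ ((v :: (γ ++ [v])) ++ β)).count v) (by omega) ?_ fun V Q => ?_
          · simp only [List.count_append, List.count_cons_self]
            omega
          · have := exponents hv s h h1 h2 h3 V 1 Q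
            rwa [one_mul, one_mul, count_eq_zero.2 hw, pow_zero, one_mul] at this
      rw [del_append, del_append, del_cons_self, del_append, del_cons_self, del_nil, append_nil,
        del_eq_self hγ] at h3
      rcases factor_tzWord hlin h3.symm with rfl | ⟨j, hj, rfl⟩
      · exact hsq hQ (w₁ ++ r :: (w₂ ++ q :: C')) β (Eqv.of_eq (by simp))
      · rcases hP.right with hL | hL
        · obtain ⟨a₁, a₂, e3⟩ := List.append_of_mem
            (show z j ∈ w₁ ++ r :: (w₂ ++ q :: C') by simp [hzm j (mem_lab.1 hj).1])
          refine hsq hQ (a₁ ++ z j :: (a₂ ++ [z j])) β ?_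
          have e4 : w₁ ++ r :: (w₂ ++ q :: (C' ++ ((v :: ([z j] ++ [v])) ++ β))) =
            (w₁ ++ r :: (w₂ ++ q :: C')) ++ ((v :: ([z j] ++ [v])) ++ β) := by simp
          rw [e4, e3]
          intro φ
          have := congrArg (fun m => (a₁.map φ).prod * (m * (β.map φ).prod))
            (hL (φ (z j)) (φ v) (a₂.map φ).prod)
          simpa [mul_assoc] using this
        · have := (mem_lab.1 hj)
          simp [hL j this.1] at this

end Special

/-- Renaming of labels. -/
def Letter.ren (ρ : ℕ → ℕ) : Letter → Letter
  | z i => z (ρ i)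
  | t i => t (ρ i)
  | c => c

theorem map_ren_ztWord (ρ : ℕ → ℕ) (l : List ℕ) : (ztWord l).map (ren ρ) = ztWord (l.map ρ) := by
  induction l with
  | nil => rfl
  | cons i l ih => simp [ih, ren]

theorem map_ren_tzWord (ρ : ℕ → ℕ) (l : List ℕ) : (tzWord l).map (ren ρ) = tzWord (l.map ρ) := by
  induction l with
  | nil => rfl
  | cons i l ih => simp [ih, ren]

theorem map_ren_map_z (ρ : ℕ → ℕ) (l : List ℕ) : (l.map z).map (ren ρ) = (l.map ρ).map z := by
  simp [ren]

theorem map_ren_pre {s : ℕ → Bool} {Z : List ℕ} (hZ : Z.Nodup) {ρ : ℕ → ℕ}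
    (hρ : StrictMonoOn ρ {i | i ∈ Z}) (hs : ∀ i ∈ Z, s (ρ i) = s i) :
    (pre s Z).map (ren ρ) = pre s (Z.map ρ) := by
  rw [pre, map_ren_ztWord, pre, lab_map hZ hρ hs]

theorem map_ren_suf {s : ℕ → Bool} {Z : List ℕ} (hZ : Z.Nodup) {ρ : ℕ → ℕ}
    (hρ : StrictMonoOn ρ {i | i ∈ Z}) (hs : ∀ i ∈ Z, s (ρ i) = s i) :
    (suf s Z).map (ren ρ) = suf s (Z.map ρ) := by
  rw [suf, map_ren_tzWord, suf, lab_map (s := fun i => !s i) hZ hρ fun i hi => by simp [hs i hi]]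

/-- The twin `o` stands immediately before `o'` in the suffix. Hence, when `o` is read as `o'`,
every initial part of the suffix has already shown at least as much of the renamed `D₃` as of `D₁`.
-/
theorem prefix_of_twins {L : List ℕ} (hL : L.Pairwise (· < ·)) {D₁ D₃ : List ℕ} {o o' : ℕ}
    (hD : ∀ i ∈ L, i ≠ o → i ≠ o' → (i ∈ D₁ ↔ i ∈ D₃)) (ho : o ∉ D₁) (ho' : o' ∈ D₁)
    (ho₃ : o ∈ D₃) (ho₃' : o' ∉ D₃) (hlt : o < o') (hadj : ∀ i ∈ L, i ≤ o ∨ o' ≤ i)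
    (hmem : o ∈ L ↔ o' ∈ L) {p : List Letter} (hp : p <+: tzWord L) :
    p.filter (keep fun i => decide (i ∈ D₁)) <+:
      (p.filter (keep fun i => decide (i ∈ D₃))).map (ren (Function.update id o o')) := by
  have hz : ∀ {L : List ℕ} {p : List Letter}, (∀ c ∈ p, c ∈ tzWord L) →
      (∀ i ∈ L, i ≠ o ∧ i ≠ o' ∧ (i ∈ D₁ ↔ i ∈ D₃)) → p.filter (keep fun i => decide (i ∈ D₁)) =
      (p.filter (keep fun i => decide (i ∈ D₃))).map (ren (Function.update id o o')) := by
    intro L p hp hL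
    induction p with
    | nil => rfl
    | cons c p ih =>
      have ih := ih fun d hd => hp d (by simp [hd])
      obtain ⟨i, hi, h⟩ := mem_tzWord.1 (hp c (by simp))
      obtain ⟨h1, h2, h3⟩ := hL i hi
      have e : keep (fun i => decide (i ∈ D₁)) c = keep (fun i => decide (i ∈ D₃)) c := by
        rcases h with rfl | rfl <;> simp [keep, h3]
      have e' : ren (Function.update id o o') c = c := by
        rcases h with rfl | rfl <;> simp [ren, h1]
      rw [List.filter_cons, List.filter_cons, e, ih]
      split_ifs <;> simp [e']
  by_cases hoL : o ∈ L
  · have hoL' := hmem.1 hoL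
    obtain ⟨A, B, rfl⟩ := List.append_of_mem hoL
    have hB : ∃ B', B = o' :: B' := by
      rw [List.pairwise_append, List.pairwise_cons] at hL
      have hB : o' ∈ B := by
        simp only [mem_append, mem_cons] at hoL'
        rcases hoL' with h | h | h
        · exact absurd (hL.2.2 _ h o (by simp)) (by omega)
        · omega
        · exact h
      cases B with
      | nil => simp at hB
      | cons b B =>
        refine ⟨B, ?_⟩
        rcases List.mem_cons.1 hB with h | h
        · rw [h]
        · have h1 := hL.2.1.1 b (by simp)
          have h2 := (List.pairwise_cons.1 hL.2.1.2).1 _ h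
          have := hadj b (by simp)
          omega
    obtain ⟨B, rfl⟩ := hB
    rw [List.pairwise_append, List.pairwise_cons, List.pairwise_cons] at hL
    have hA : ∀ i ∈ A, i ≠ o ∧ i ≠ o' ∧ (i ∈ D₁ ↔ i ∈ D₃) := by
      intro i hi
      have h1 := hL.2.2 i hi o (by simp)
      have h2 := hL.2.2 i hi o' (by simp)
      exact ⟨h1.ne, h2.ne, hD i (by simp [hi]) h1.ne h2.ne⟩
    have hB : ∀ i ∈ B, i ≠ o ∧ i ≠ o' ∧ (i ∈ D₁ ↔ i ∈ D₃) := by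
      intro i hi
      have h1 := hL.2.1.1 i (by simp [hi])
      have h2 := hL.2.1.2.1 i hi
      exact ⟨h1.ne', h2.ne', hD i (by simp [hi]) h1.ne' h2.ne'⟩
    have e : tzWord (A ++ o :: o' :: B) = tzWord A ++ ([t o, z o, t o', z o'] ++ tzWord B) := by
      simp [tzWord]
    rw [e] at hp
    obtain ⟨R, hR⟩ := hp
    rcases List.append_eq_append_iff.1 hR with ⟨a, h1, h2⟩ | ⟨p', rfl, h2⟩
    · rw [hz (L := A) (fun c hc => by rw [h1]; simp [hc]) hA]
    · rw [List.filter_append, List.filter_append, map_append,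
        hz (L := A) (p := tzWord A) (fun c hc => hc) hA, List.prefix_append_right_inj]
      rcases List.append_eq_append_iff.1 h2 with ⟨a, rfl, h4⟩ | ⟨a, h3, h4⟩
      · rw [List.filter_append, List.filter_append, map_append,
          hz (L := B) (p := a) (fun c hc => by rw [h4]; simp [hc]) hB]
        simp [keep, ren, ho, ho', ho₃, ho₃']
      · match p', h3 with
        | [], _ => simp
        | [c₁], h3 =>
          simp only [cons_append, nil_append, List.cons.injEq] at h3
          simp [← h3.1, keep, ren, ho, ho₃]
        | [c₁, c₂], h3 =>
          simp only [cons_append, nil_append, List.cons.injEq] at h3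
          simp [← h3.1, ← h3.2.1, keep, ren, ho, ho₃]
        | [c₁, c₂, c₃], h3 =>
          simp only [cons_append, nil_append, List.cons.injEq] at h3
          simp [← h3.1, ← h3.2.1, ← h3.2.2.1, keep, ren, ho, ho₃, ho', ho₃']
        | [c₁, c₂, c₃, c₄], h3 =>
          simp only [cons_append, nil_append, List.cons.injEq] at h3
          simp [← h3.1, ← h3.2.1, ← h3.2.2.1, ← h3.2.2.2.1, keep, ren, ho, ho₃, ho', ho₃']
        | c₁ :: c₂ :: c₃ :: c₄ :: c₅ :: p', h3 => simp at h3
  · have hoL' : o' ∉ L := fun h => hoL (hmem.2 h)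
    rw [hz (L := L) (fun c hc => hp.subset hc) fun i hi => ?_]
    have h1 : i ≠ o := fun e => hoL (e ▸ hi)
    have h2 : i ≠ o' := fun e => hoL' (e ▸ hi)
    exact ⟨h1, h2, hD i hi h1 h2⟩

theorem del_filter_comm (v : Letter) (p : ℕ → Bool) (w : List Letter) :
    del v (w.filter (keep p)) = (del v w).filter (keep p) := by
  simp only [del, List.filter_filter]
  exact List.filter_congr fun c _ => by rw [Bool.and_comm]

/-! ### The normal form of words equivalent to the word of a pattern -/

section Special

variable {v : Letter} (hv : v = x ∨ v = y)
include hv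

theorem ren_special (ρ : ℕ → ℕ) : ren ρ v = v := by rcases hv with rfl | rfl <;> rfl

theorem ren_eq_iff (ρ : ℕ → ℕ) {c : Letter} : ren ρ c = v ↔ c = v := by
  rcases hv with rfl | rfl <;> cases c <;> simp [ren]

theorem dbl_map_ren (ρ : ℕ → ℕ) (w : List Letter) : dbl v (w.map (ren ρ)) = (dbl v w).map (ren ρ) := by
  induction w with
  | nil => rfl
  | cons c w ih =>
    by_cases hc : c = v
    · subst hc; simp [ren_special hv, ih]
    · rw [map_cons, dbl_cons_ne (fun h => hc ((ren_eq_iff hv ρ).1 h)), dbl_cons_ne hc, ih, map_cons]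

theorem del_map_ren (ρ : ℕ → ℕ) (w : List Letter) : del v (w.map (ren ρ)) = (del v w).map (ren ρ) := by
  induction w with
  | nil => rfl
  | cons c w ih =>
    by_cases hc : c = v
    · subst hc; simp [ren_special hv, ih]
    · rw [map_cons, del_cons_ne (fun h => hc ((ren_eq_iff hv ρ).1 h)), del_cons_ne hc, ih, map_cons]

theorem Killed.map_ren {w : List Letter} (h : Killed M v w) (ρ : ℕ → ℕ) :
    Killed M v (w.map (ren ρ)) := by
  unfold Killed
  rw [dbl_map_ren hv]
  exact Eqv.map _ h

/-- A killed word with `v` in the suffix kills the word of the pattern, if the occurrence of `v` in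
another equivalent word comes earlier. -/
theorem killed_of_suffix (hM : Basic M) (hR : SatR M) {s : ℕ → Bool} {D : List ℕ} (hD : D.Nodup)
    {ω₁ ω p₁ β₁ p β : List Letter} (h1 : del v ω₁ = suf s D) (h : del v ω = suf s D)
    (e₁ : ω₁ = p₁ ++ v :: β₁) (hp₁ : v ∉ p₁) (e : ω = p ++ v :: β) (hp : v ∉ p) (hpp : p₁ <+: p)
    (hE : Eqv M (word s v [] D []) (pre s D ++ r :: (v :: (D.map z ++ v :: q :: ω₁))))
    (hK : Killed M v (pre s D ++ r :: (v :: (D.map z ++ v :: q :: ω)))) :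
    Killed M v (word s v [] D []) := by
  obtain ⟨-, m₁, f₁, g₁, -, e3, h4⟩ := exists_pad hD (w₁ := pre s D) (v := v)
    (del_eq_self (notMem_pre hv s D)) h1
  have h4 := h4 (notMem_pre hv s D)
  obtain ⟨-, m, f, g, -, e5, h6⟩ := exists_pad hD (w₁ := pre s D) (v := v)
    (del_eq_self (notMem_pre hv s D)) h
  have h6 := h6 (notMem_pre hv s D)
  have hfix : ∀ f g : ℕ → ℕ, (∀ i, s i = true → f i = 0 ∧ g i = 0) →
      (pre s D).flatMap (pad v f g) = pre s D := by
    intro f g h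
    refine flatMap_pad_eq_self fun i hi => ?_
    obtain ⟨j, hj, hc | hc⟩ := mem_ztWord.1 hi
    · simp at hc
    · simp only [Letter.t.injEq] at hc; subst hc
      exact h i (mem_lab.1 hj).2
  set E : List Letter := pre s D ++ r :: (v :: (D.map z ++ [v, q])) with hEdef
  have hU : word s v [] D [] = E ++ suf s D := by simp [word, hEdef]
  have hfixE : ∀ f g : ℕ → ℕ, (∀ i, s i = true → f i = 0 ∧ g i = 0) →
      E.flatMap (pad v f g) = E := by
    intro f g h
    refine flatMap_pad_eq_self fun i hi => ?_
    have : t i ∈ pre s D := by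
      have := t_ne hv i
      simpa [hEdef, this] using hi
    obtain ⟨j, hj, hc | hc⟩ := mem_ztWord.1 this
    · simp at hc
    · simp only [Letter.t.injEq] at hc; subst hc
      exact h i (mem_lab.1 hj).2
  -- the first equivalent word, with a square at the first occurrence of `v` in the suffix
  obtain ⟨β₂, hβ₂⟩ := exists_square_tz f₁ g₁ m₁ (notMem_suf hv s D) hp₁ (e3.symm.trans e₁)
  have hE1 : Eqv M (E ++ suf s D) (E ++ ((suf s D).flatMap (pad v f₁ g₁) ++ List.replicate m₁ v)) := by
    rw [← hU, ← e3]; simpa [hEdef] using hE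
  have hE2 : Eqv M (E ++ suf s D) (E ++ (p₁ ++ v :: v :: β₂)) := by
    have h7 := (hE1.subst (pad v f₁ g₁)).right (List.replicate m₁ v)
    simp only [flatMap_append, hfixE _ _ h4, flatMap_pad_replicate hv, flatMap_pad_pad hv,
      append_assoc, List.replicate_append_replicate] at h7
    rw [hβ₂] at h7
    exact hE1.trans h7
  -- insert the padding of the killed word
  obtain ⟨k, hk⟩ : ∃ k, p₁.flatMap (pad v f g) = p₁ ++ List.replicate k v := by
    have hd : del v (p₁.flatMap (pad v f g)) = p₁ := by
      rw [del_flatMap_pad f g hv, del_eq_self hp₁]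
    -- Since `p₁` is an initial part of `p`, the padding belonging to `ω` inserts no `v` inside
    -- `p₁`, only possibly behind it.
    obtain ⟨p', rfl⟩ := hpp
    have h8 : suf s D = p₁ ++ del v β₁ := by
      rw [← h1, e₁]; simp [del_eq_self hp₁]
    rw [h8, flatMap_append, e] at e5
    simp only [append_assoc] at e5
    rcases List.append_eq_append_iff.1 e5 with ⟨a, h9, -⟩ | ⟨a, h9, -⟩
    · rw [h9, del_append, del_eq_self hp₁] at hd
      have := length_of_replicate_count (v := v) (w := a) (by simpa using hd)
      exact ⟨_, by rw [h9]; congr 1⟩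
    · have hnv : v ∉ p₁.flatMap (pad v f g) := fun hc => hp₁ (by rw [h9]; simp [hc])
      rw [del_eq_self hnv] at hd
      exact ⟨0, by simp [hd]⟩
  have hE3 : Eqv M (pre s D ++ r :: (v :: (D.map z ++ v :: q :: ω)))
      (E ++ (p₁ ++ v :: v :: (List.replicate k v ++ (β₂.flatMap (pad v f g) ++
        List.replicate m v)))) := by
    have h7 := (hE2.subst (pad v f g)).right (List.replicate m v)
    have hvv : pad v f g v = [v] := by rcases hv with rfl | rfl <;> rfl
    simp only [flatMap_append, flatMap_cons, hfixE _ _ h6, hk, hvv, append_assoc] at h7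
    rw [← e5] at h7
    have hcomm : List.replicate k v ++ ([v] ++ ([v] ++ (β₂.flatMap (pad v f g) ++
        List.replicate m v))) = v :: v :: (List.replicate k v ++ (β₂.flatMap (pad v f g) ++
        List.replicate m v)) := by
      rw [← append_assoc, ← List.replicate_succ', List.replicate_succ, cons_append, ← append_assoc,
        ← List.replicate_succ', List.replicate_succ, cons_append]
    rw [hcomm] at h7
    simpa [hEdef] using h7
  have hrep : ∀ n, del v (List.replicate n v) = [] := fun n => by simp [del]
  -- By `SatR` every `v` behind the square may be erased; then the two words coincide.
  have hF1 := hM.del_right hR (v := v) (E ++ p₁) (List.replicate k v ++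
    (β₂.flatMap (pad v f g) ++ List.replicate m v))
  have hF2 := hM.del_right hR (v := v) (E ++ p₁) β₂
  rw [del_append, del_append, hrep, hrep, del_flatMap_pad f g hv, nil_append, append_nil] at hF1
  simp only [append_assoc] at hF1 hF2
  refine Killed.congr ?_ hK
  rw [hU]
  exact hE2.trans (hF2.trans (hF1.symm.trans hE3.symm))

/-- The collapse of the enclosed factor brings the two `v` together to a square in the middle. -/
theorem Collapses.killed_word (hM : Basic M) {s : ℕ → Bool} {A K B : List ℕ}
    (hn : (A ++ (K ++ B)).Nodup) (h : Collapses M s K) : Killed M v (word s v A K B) := by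
  have hK : K <+ A ++ (K ++ B) :=
    (List.sublist_append_left K B).trans (List.sublist_append_right A _)
  have hl : ∀ s : ℕ → Bool, (lab s K).map z <+ (lab s (A ++ (K ++ B))).map z := by
    intro s
    refine List.Sublist.map _ ?_
    conv_lhs => rw [← filter_mem_of_sublist hn hK]
    rw [← lab_filter hn]
    exact List.filter_sublist
  have := h (pre s (A ++ (K ++ B)) ++ r :: A.map z) (B.map z ++ q :: suf s (A ++ (K ++ B))) v
    (((hl _).trans (map_z_sublist_ztWord _)).trans (List.sublist_append_left _ _))
    (((hl _).trans (map_z_sublist_tzWord _)).trans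
      ((List.sublist_cons_self _ _).trans (List.sublist_append_right _ _)))
  refine Killed.congr (w' := pre s (A ++ (K ++ B)) ++ r :: (((A.map z ++ K.map z) ++ v :: v ::
    B.map z) ++ q :: suf s (A ++ (K ++ B)))) (by simpa [word] using this) ?_
  exact killed_of_middle_square hv hM (del_eq_self (notMem_pre hv s _)) (Y := A ++ (K ++ B))
    (by simp [del_eq_self (notMem_map_z hv _)]) (del_eq_self (notMem_suf hv s _)) (fun i hi => hi)
    (Or.inl (notMem_pre hv s _))

/-- The words equivalent to the word of a pattern. -/
theorem Pattern.form (hM : Basic M) (hT : ¬ Trivializes M) {s : ℕ → Bool}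
    {Z₁ Z₂ Z₃ D₁ D₂ D₃ : List ℕ} {o o' : ℕ} (hP : Pattern M s Z₁ Z₂ Z₃ D₁ D₂ D₃ o o')
    {w : List Letter} (h : Eqv M (word s v Z₁ Z₂ Z₃) w) :
    ∃ α γ β w₃ Y, w = pre s (Z₁ ++ (Z₂ ++ Z₃)) ++ r :: ((α ++ v :: (γ ++ v :: β)) ++ q :: w₃) ∧
      v ∉ α ∧ v ∉ γ ∧ v ∉ β ∧ del v w₃ = suf s (Z₁ ++ (Z₂ ++ Z₃)) ∧
      α ++ (γ ++ β) = Y.map z ∧ (Z₁ ++ (Z₂ ++ Z₃)).Perm Y ∧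
      Eqv M (bare s (Z₁ ++ (Z₂ ++ Z₃)) (Z₁ ++ (Z₂ ++ Z₃))) (bare s (Z₁ ++ (Z₂ ++ Z₃)) Y) ∧
      (∀ i, z i ∈ γ ↔ i ∈ Z₂) := by
  obtain ⟨w₁, w₂, w₃, Y, rfl, h1, h2, h3, hY, hbare⟩ := exists_decomp hv hM hT hP.nodup h
  have hb := hP.two_le_count hv hM hT h h1 h2 h3 hY
  set Z := Z₁ ++ (Z₂ ++ Z₃) with hZ
  have hYn : Y.Nodup := hY.nodup_iff.1 hP.nodup
  have hZ₂Z : Z₂ <+ Z := (List.sublist_append_left Z₂ Z₃).trans (List.sublist_append_right Z₁ _)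
  have hkr : ∀ p : ℕ → Bool, keep p r = true := fun _ => rfl
  have hkq : ∀ p : ℕ → Bool, keep p q = true := fun _ => rfl
  -- restriction to a violated pattern
  have hres : ∀ D, Good M s D → D <+ Z →
      del v (w₁.filter (keep fun i => decide (i ∈ D))) = pre s D ∧
      del v (w₂.filter (keep fun i => decide (i ∈ D))) = D.map z ∧
      del v (w₃.filter (keep fun i => decide (i ∈ D))) = suf s D := by
    intro D hD hs
    have e1 : Z.filter (fun i => decide (i ∈ D)) = D := filter_mem_of_sublist hP.nodup hs
    refine ⟨?_, ?_, ?_⟩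
    · rw [del_filter_comm v, h1, filter_pre hP.nodup, e1]
    · rw [del_filter_comm v, h2, filter_map_z]
      congr 1
      have h4 := hbare.filter (keep fun i => decide (i ∈ D))
      rw [filter_keep_bare hP.nodup, filter_keep_bare hP.nodup, e1] at h4
      exact eq_of_alternating hM hT hD.nodup hD.chain (by have h5 := hY.filter (fun i => decide (i ∈ D)); rwa [e1] at h5) h4
    · rw [del_filter_comm v, h3, filter_suf hP.nodup, e1]
  have hEres : ∀ D, D <+ Z₂ → Eqv M (word s v [] D [])
      (w₁.filter (keep fun i => decide (i ∈ D)) ++ r :: (w₂.filter (keep fun i => decide (i ∈ D)) ++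
        q :: w₃.filter (keep fun i => decide (i ∈ D)))) := by
    intro D hs
    have := h.filter (keep fun i => decide (i ∈ D))
    rw [filter_word_of_sublist hv hP.nodup hs] at this
    simpa [List.filter_append, hkr, hkq] using this
  have hcount : ∀ (D : List ℕ) (u : List Letter),
      (u.filter (keep fun i => decide (i ∈ D))).count v = u.count v := fun D u =>
    List.count_filter (keep_special hv _)
  have hmid : ∀ D, Good M s D → D <+ Z₂ →
      w₂.filter (keep fun i => decide (i ∈ D)) = v :: (D.map z ++ [v]) := by
    intro D hD hs
    obtain ⟨h4, h5, h6⟩ := hres D hD (hs.trans hZ₂Z)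
    exact hD.middle hv hM hT (hEres D hs) h4 h5 h6 (by rw [hcount]; exact hb)
  have hw₁ : v ∉ w₁ := by
    obtain ⟨h4, h5, h6⟩ := hres D₁ hP.good₁ (hP.sub₁.trans hZ₂Z)
    have h7 := hEres D₁ hP.sub₁
    rw [hmid D₁ hP.good₁ hP.sub₁] at h7
    have := hP.good₁.notMem_left hv hM (w₁ := w₁.filter (keep fun i => decide (i ∈ D₁)))
      (w₃ := w₃.filter (keep fun i => decide (i ∈ D₁))) (by simpa using h7) h4 h6
    intro hc
    exact this (List.mem_filter.2 ⟨hc, keep_special hv _⟩)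
  obtain ⟨α, w', rfl, hα⟩ := List.eq_append_cons_of_mem
    (List.count_pos_iff.1 (by omega : 0 < w₂.count v))
  have hb' : 0 < w'.count v := by
    rw [List.count_append, List.count_cons_self, count_eq_zero.2 hα] at hb
    omega
  obtain ⟨γ, β, rfl, hγ⟩ := List.eq_append_cons_of_mem (List.count_pos_iff.1 hb')
  have hβ : v ∉ β := by
    have := hcount D₁ (α ++ v :: (γ ++ v :: β))
    rw [hmid D₁ hP.good₁ hP.sub₁] at this
    simp only [List.count_append, List.count_cons_self, count_eq_zero.2 (notMem_map_z hv D₁),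
      count_eq_zero.2 hα, count_eq_zero.2 hγ, List.count_nil] at this
    exact count_eq_zero.1 (by omega)
  have hαγβ : α ++ (γ ++ β) = Y.map z := by
    rw [← h2]; simp [del_eq_self hα, del_eq_self hβ, del_eq_self hγ]
  have hnodup : (α ++ (γ ++ β)).Nodup := by
    rw [hαγβ]; exact hYn.map fun a b h => by simpa using h
  -- the part between the two `v` contains the violated patterns
  have hγD : ∀ D, Good M s D → D <+ Z₂ → ∀ i ∈ D, z i ∈ γ := by
    intro D hD hs i hi
    have h4 := hmid D hD hs
    have hvk : keep (fun i => decide (i ∈ D)) v = true := keep_special hv _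
    simp only [List.filter_append, List.filter_cons, hvk, if_true] at h4
    have h5 := split_unique (A := α.filter (keep fun i => decide (i ∈ D))) (P := [])
      (fun hc => hα (List.mem_filter.1 hc).1) (by simp) h4
    have h6 := split_unique (A := γ.filter (keep fun i => decide (i ∈ D))) (P := D.map z)
      (fun hc => hγ (List.mem_filter.1 hc).1) (notMem_map_z hv D) h5.2
    have h7 : z i ∈ γ.filter (keep fun i => decide (i ∈ D)) := by
      rw [h6.1]; simpa using hi
    exact (List.mem_filter.1 h7).1
  have hγZ : ∀ i ∈ Z₂, z i ∈ γ := by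
    intro i hi
    rcases hP.cover i hi with h | h
    · exact hγD D₁ hP.good₁ hP.sub₁ i h
    · exact hγD D₂ hP.good₂ hP.sub₂ i h
  have hpre : w₁ = pre s Z := by rw [← h1, del_eq_self hw₁]
  have hZmem : ∀ i, i ∈ Z ↔ i = o ∨ i ∈ Z₂ := by
    intro i
    rcases hP.outer with ⟨e1, e2⟩ | ⟨e1, e2⟩ <;> simp [hZ, e1, e2]
    tauto
  have hoZ₂ : o ∉ Z₂ := by
    have := hP.nodup
    rcases hP.outer with ⟨e1, e2⟩ | ⟨e1, e2⟩
    · rw [e1, e2] at this; simp at this; exact this.1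
    · rw [e1, e2, nil_append, List.nodup_append] at this
      exact fun h => this.2.2 o h o (by simp) rfl
  refine ⟨α, γ, β, w₃, Y, by rw [hpre], hα, hγ, hβ, h3, hαγβ, hY, hbare, fun i => ⟨fun hi => ?_, hγZ i⟩⟩
  have hiZ : i ∈ Z := by
    have : z i ∈ Y.map z := by rw [← hαγβ]; simp [hi]
    exact hY.symm.subset (by simpa using this)
  rcases (hZmem i).1 hiZ with rfl | hi₂
  swap
  · exact hi₂
  exfalso
  -- now the outer label lies between the two `v`
  have hγall : ∀ j ∈ Z, z j ∈ γ := by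
    intro j hj
    rcases (hZmem j).1 hj with rfl | h
    · exact hi
    · exact hγZ j h
  have hαnil : α = [] := by
    refine List.eq_nil_iff_forall_not_mem.2 fun c hc => ?_
    have : c ∈ Y.map z := by rw [← hαγβ]; simp [hc]
    obtain ⟨j, hj, rfl⟩ := List.mem_map.1 this
    exact (List.nodup_append.1 hnodup).2.2 _ hc _
      (List.mem_append_left _ (hγall j (hY.symm.subset hj))) rfl
  have hβnil : β = [] := by
    refine List.eq_nil_iff_forall_not_mem.2 fun c hc => ?_
    have : c ∈ Y.map z := by rw [← hαγβ]; simp [hc]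
    obtain ⟨j, hj, rfl⟩ := List.mem_map.1 this
    exact (List.nodup_append.1 (List.nodup_append.1 hnodup).2.1).2.2 _
      (hγall j (hY.symm.subset hj)) _ hc rfl
  subst hαnil hβnil
  simp only [nil_append, append_nil] at *
  -- the word of the third pattern is killed
  set ρ : ℕ → ℕ := Function.update id i o' with hρ
  have hvk : ∀ p, keep p v = true := keep_special hv
  have hD₃ := hres D₃ hP.good₃ hP.sub₃
  have hD₁ := hres D₁ hP.good₁ (hP.sub₁.trans hZ₂Z)
  have hγ₃ : γ.filter (keep fun i => decide (i ∈ D₃)) = D₃.map z := by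
    rw [← hD₃.2.1]
    simp [List.filter_append, hvk,
      del_eq_self (fun hc => hγ (List.mem_filter.1 hc).1 :
        v ∉ γ.filter (keep fun i => decide (i ∈ D₃)))]
  have hγ₁ : γ.filter (keep fun i => decide (i ∈ D₁)) = D₁.map z := by
    rw [← hD₁.2.1]
    simp [List.filter_append, hvk,
      del_eq_self (fun hc => hγ (List.mem_filter.1 hc).1 :
        v ∉ γ.filter (keep fun i => decide (i ∈ D₁)))]
  have hpre₃ : (pre s Z).filter (keep fun i => decide (i ∈ D₃)) = pre s D₃ := by
    rw [filter_pre hP.nodup, filter_mem_of_sublist hP.nodup hP.sub₃]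
  have hpre₁ : (pre s Z).filter (keep fun i => decide (i ∈ D₁)) = pre s D₁ := by
    rw [filter_pre hP.nodup, filter_mem_of_sublist hP.nodup (hP.sub₁.trans hZ₂Z)]
  -- In the original word, restricted to `D₃`, the two `v` leave out the label `o` and enclose a
  -- proper factor, which collapses. The restricted equivalent word encloses all of `D₃` and is
  -- killed with it.
  have hK₃ : Killed M v (pre s D₃ ++ r :: (v :: (D₃.map z ++ v :: q ::
      w₃.filter (keep fun i => decide (i ∈ D₃))))) := by
    have h4 := h.filter (keep fun i => decide (i ∈ D₃))
    have e3 := filter_mem_of_sublist hP.nodup hP.sub₃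
    simp only [List.filter_append, List.filter_cons, hkr, hkq, hvk, if_true, hpre, hpre₃, hγ₃,
      List.filter_nil] at h4
    rw [filter_word hv hP.nodup] at h4
    simp only [append_assoc, cons_append, nil_append] at h4
    refine Killed.congr h4.symm ?_
    have hn : (Z₁.filter (fun i => decide (i ∈ D₃)) ++ (Z₂.filter (fun i => decide (i ∈ D₃)) ++
        Z₃.filter (fun i => decide (i ∈ D₃)))).Nodup := by
      rw [← List.filter_append, ← List.filter_append]; exact hP.nodup.filter _
    refine Collapses.killed_word hv hM hn ?_
    rw [List.filter_append, List.filter_append] at e3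
    refine hP.good₃.factor e3.symm ?_
    rcases hP.outer with ⟨e4, e5⟩ | ⟨e4, e5⟩
    · left; rw [e4]; simp [hP.mem₃]
    · right; rw [e5]; simp [hP.mem₃]
  have hiD₁ : i ∉ D₁ := fun h => hoZ₂ (hP.sub₁.subset h)
  have hD₁₃ : ∀ j, j ≠ i → j ≠ o' → (j ∈ D₁ ↔ j ∈ D₃) := by
    intro j hj hj'
    rw [← hP.map₃, List.mem_map]
    constructor
    · rintro ⟨k, hk, rfl⟩
      by_cases hki : k = i
      · subst hki; simp at hj'
      · simpa [hki] using hk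
    · intro h
      exact ⟨j, h, by simp [hj]⟩
  have ho'D₁ : o' ∈ D₁ := by
    rw [← hP.map₃, List.mem_map]; exact ⟨i, hP.mem₃, by simp⟩
  have ho'D₃ : o' ∉ D₃ := by
    intro h
    have h4 := hP.good₁.nodup
    rw [← hP.map₃] at h4
    have := List.inj_on_of_nodup_map h4 hP.mem₃ h (by simp [hP.lt.ne'])
    exact hP.lt.ne this
  have hadj₃ : ∀ j ∈ D₃, j ≠ i → j < i ∨ o' < j := by
    intro j hj hji
    have h4 := hP.adj j (hP.sub₃.subset hj)
    have h5 : j ≠ o' := fun e => ho'D₃ (e ▸ hj)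
    omega
  -- No label of `D₃` other than `o` lies between `o` and `o'`, so the renaming `o ↦ o'` keeps the
  -- order.
  have hmono : StrictMonoOn ρ {j | j ∈ D₃} := by
    intro a ha b hb hab
    have h4 := hP.lt
    by_cases h1 : a = i
    · have hbi : b ≠ i := by omega
      have := hadj₃ b hb hbi
      simp only [hρ, h1, Function.update_self, Function.update_of_ne hbi, id]
      omega
    · by_cases h2 : b = i
      · simp only [hρ, h2, Function.update_self, Function.update_of_ne h1, id]
        omega
      · simpa only [hρ, Function.update_of_ne h1, Function.update_of_ne h2, id] using hab
  have htype : ∀ j ∈ D₃, s (ρ j) = s j := by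
    intro j _
    by_cases h1 : j = i
    · simp [hρ, h1, hP.type_eq]
    · simp [hρ, h1]
  set ω := (w₃.filter (keep fun i => decide (i ∈ D₃))).map (ren ρ) with hω
  have hK : Killed M v (pre s D₁ ++ r :: (v :: (D₁.map z ++ v :: q :: ω))) := by
    have h4 := Killed.map_ren hv hK₃ ρ
    have hr : ren ρ r = r := rfl
    have hq : ren ρ q = q := rfl
    simp only [map_append, map_cons, hr, hq, ren_special hv, map_ren_map_z,
      map_ren_pre hP.good₃.nodup hmono htype] at h4
    rw [show D₃.map ρ = D₁ from hP.map₃] at h4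
    exact h4
  have hdω : del v ω = suf s D₁ := by
    rw [hω, del_map_ren hv, hD₃.2.2, map_ren_suf hP.good₃.nodup hmono htype,
      show D₃.map ρ = D₁ from hP.map₃]
  have hE := hEres D₁ hP.sub₁
  rw [hmid D₁ hP.good₁ hP.sub₁, hpre, hpre₁] at hE
  refine hP.good₁.not_killed hv hM ?_
  -- With a `v` in the suffix the exponents yield `SatR`, and the suffixes of the `D₁` and `D₃`
  -- restrictions are compared. Without one, the renamed word is the word of `D₁` itself.
  by_cases hw₃ : v ∈ w₃
  · have hR : SatR M := by
      refine hM.satR_of_pos (List.count_pos_iff.2 hw₃) fun V Q => ?_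
      have h4 := exponents hv s h h1 h2 h3 V 1 Q
      rw [count_eq_zero.2 hw₁] at h4
      simpa [count_eq_zero.2 hγ, pow_two, mul_assoc] using h4
    obtain ⟨p, β, e4, hp⟩ := List.eq_append_cons_of_mem hw₃
    have hpre : p <+: tzWord (lab (fun i => !s i) Z) := by
      refine ⟨del v β, ?_⟩
      have := h3
      rw [e4, del_append, del_cons_self, del_eq_self hp] at this
      exact this
    have hpp := prefix_of_twins (lab_pairwise (s := fun i => !s i) hP.nodup) (o := i) (o' := o')
      (fun j _ h1 h2 => hD₁₃ j h1 h2) hiD₁ ho'D₁ hP.mem₃ ho'D₃ hP.lt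
      (fun j hj => hP.adj j (mem_lab.1 hj).1) (by
        have h4 : i ∈ Z := (hZmem i).2 (Or.inl rfl)
        have h5 : o' ∈ Z := (hZmem o').2 (Or.inr (hP.sub₁.subset ho'D₁))
        rw [mem_lab, mem_lab, hP.type_eq]
        simp only [hZ] at h4 h5
        tauto) hpre
    refine killed_of_suffix hv hM hR hP.good₁.nodup hD₁.2.2 hdω
      (p₁ := p.filter (keep fun i => decide (i ∈ D₁)))
      (β₁ := β.filter (keep fun i => decide (i ∈ D₁)))
      (p := (p.filter (keep fun i => decide (i ∈ D₃))).map (ren ρ))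
      (β := (β.filter (keep fun i => decide (i ∈ D₃))).map (ren ρ)) ?_ ?_ ?_ ?_ hpp
      (by simpa using hE) hK
    · rw [e4, List.filter_append, List.filter_cons, hvk, if_pos rfl]
    · exact fun hc => hp (List.mem_filter.1 hc).1
    · rw [hω, e4, List.filter_append, List.filter_cons, hvk, if_pos rfl, map_append, map_cons,
        ren_special hv]
    · intro hc
      obtain ⟨c, hc', e⟩ := List.mem_map.1 hc
      rw [ren_eq_iff hv] at e
      subst e
      exact hp (List.mem_filter.1 hc').1
  · have hvω : v ∉ ω := by
      intro hc
      obtain ⟨c, hc', e⟩ := List.mem_map.1 hc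
      rw [ren_eq_iff hv] at e
      subst e
      exact hw₃ (List.mem_filter.1 hc').1
    rw [del_eq_self hvω] at hdω
    rw [hdω] at hK
    simpa [word] using hK

end Special

/-! ### Replacing a factor `QΩQ` by `ΩQQ` -/

/-- The situation in which the factor `QΩQ` is the middle part between the two `v`. -/
def Critical (M : Type u) [Monoid M] (s : ℕ → Bool) (v : Letter) (Z Z₂ : List ℕ)
    (a Ω b : List Letter) : Prop :=
  ∃ α β w₃ Y, a = pre s Z ++ r :: α ∧ b = β ++ q :: w₃ ∧ v ∉ α ∧ v ∉ Ω ∧ v ∉ β ∧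
    del v w₃ = suf s Z ∧ α ++ (Ω ++ β) = Y.map z ∧ Z.Perm Y ∧
    Eqv M (bare s Z Z) (bare s Z Y) ∧ ∀ i, z i ∈ Ω ↔ i ∈ Z₂

/-- `SatLeft` needs a `v` behind `c`, hence the exponent `l + 1`. -/
theorem eqv_move_of_satLeft (hL : SatLeft M) {v c : Letter} (k : ℕ) :
    ∀ {l : ℕ} {a b : List Letter}, c ∈ a →
    Eqv M (a ++ (List.replicate k v ++ c :: (List.replicate (l + 1) v ++ b)))
      (a ++ c :: (List.replicate (k + (l + 1)) v ++ b)) := by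
  induction k with
  | zero => intro l a b _; simpa using Eqv.refl _
  | succ k ih =>
    intro l a b hc
    have h1 : Eqv M (a ++ (List.replicate (k + 1) v ++ c :: (List.replicate (l + 1) v ++ b)))
        (a ++ (List.replicate k v ++ c :: (List.replicate (l + 1 + 1) v ++ b))) := by
      obtain ⟨a₁, a₂, rfl⟩ := List.append_of_mem hc
      rw [List.replicate_succ' (n := k), List.replicate_succ (n := l + 1),
        List.replicate_succ (n := l)]
      intro φ
      have := congrArg (fun m => (a₁.map φ).prod * (m * ((List.replicate l v ++ b).map φ).prod))
        (hL (φ c) (φ v) ((a₂ ++ List.replicate k v).map φ).prod)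
      simpa [mul_assoc] using this
    have h2 := ih (l := l + 1) (b := b) hc
    rw [show k + 1 + (l + 1) = k + (l + 1 + 1) by omega]
    exact h1.trans h2

theorem not_factor_pre {A γ B : List Letter} {L : List ℕ} {s : ℕ → Bool}
    (hγ : ∀ c ∈ γ, isLin c = false) (e : pre s L = A ++ (γ ++ B)) (n : 1 < γ.length) : False := by
  rcases factor_ztWord hγ e with rfl | ⟨j, -, rfl⟩ <;> simp at n

/-! ### Replacing `QΩQ` by `ΩQQ` in words equivalent to the word of a pattern -/

section Special

variable {v : Letter} (hv : v = x ∨ v = y)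
include hv

theorem unique_split (hM : Basic M) (hT : ¬ Trivializes M) {s : ℕ → Bool} {Z₁ Z₂ Z₃ : List ℕ}
    (hZ : (Z₁ ++ (Z₂ ++ Z₃)).Nodup) {A B A' B' : List Letter} {l : Letter}
    (hl : isLin l = true) (h : Eqv M (word s v Z₁ Z₂ Z₃) (A ++ l :: B))
    (e : A ++ l :: B = A' ++ l :: B') : A = A' ∧ B = B' := by
  have h1 := count_linear hv hM hT hZ h hl
  have h2 := h1
  rw [e] at h2
  simp only [List.count_append, List.count_cons_self] at h1 h2
  exact split_unique (count_eq_zero.1 (by omega)) (count_eq_zero.1 (by omega)) e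

/-- The labels of the middle part are separated by the two `v` as they should be. -/
theorem Pattern.position (hM : Basic M) (hT : ¬ Trivializes M) {s : ℕ → Bool}
    {Z₁ Z₂ Z₃ D₁ D₂ D₃ : List ℕ} {o o' : ℕ} (hP : Pattern M s Z₁ Z₂ Z₃ D₁ D₂ D₃ o o')
    {w₁ X X' w₃ : List Letter} {c : ℕ}
    (h : Eqv M (word s v Z₁ Z₂ Z₃) (w₁ ++ r :: ((X ++ z c :: X') ++ q :: w₃))) :
    (c ∈ Z₂ ↔ X.count v = 1) ∧ X.count v + X'.count v = 2 := by
  obtain ⟨α, γ, β, w₃', Y, e, hα, hγ, hβ, -, hY, hZY, -, hiff⟩ := hP.form hv hM hT h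
  obtain ⟨rfl, e1⟩ := unique_split hv hM hT hP.nodup (l := r) rfl h e
  have e2 : X ++ z c :: X' = α ++ v :: (γ ++ v :: β) := by
    refine (unique_split hv hM hT hP.nodup (l := q)
      (A := pre s (Z₁ ++ (Z₂ ++ Z₃)) ++ r :: (X ++ z c :: X'))
      (A' := pre s (Z₁ ++ (Z₂ ++ Z₃)) ++ r :: (α ++ v :: (γ ++ v :: β)))
      (B := w₃) (B' := w₃') rfl (by simpa using h) (by simpa using e1)).1 |> fun h => ?_
    simpa using h
  have hn : (α ++ (γ ++ β)).Nodup := by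
    rw [hY]; exact (hZY.nodup_iff.1 hP.nodup).map fun a b h => by simpa using h
  rw [List.nodup_append, List.nodup_append] at hn
  have hne : z c ≠ v := z_ne hv c
  rw [← hiff]
  have htot := congrArg (List.count v) e2
  simp only [List.count_append, List.count_cons_self, List.count_cons_of_ne hne,
    count_eq_zero.2 hα, count_eq_zero.2 hγ, count_eq_zero.2 hβ] at htot
  refine ⟨?_, by omega⟩
  rcases factor_split (γ := [z c]) (by simpa using Ne.symm hne) (A := X) (B := X') e2 with
    ⟨C, rfl, -⟩ | ⟨C, rfl, e3⟩
  · have : X.count v = 0 := count_eq_zero.2 fun hc => hα (by simp [hc])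
    rw [this]
    have : z c ∉ γ := fun hc => hn.2.2 (z c) (by simp) (z c) (by simp [hc]) rfl
    simp [this]
  · have hα0 := count_eq_zero.2 hα
    rcases factor_split (γ := [z c]) (by simpa using Ne.symm hne) (A := C) (B := X') e3.symm with
      ⟨E, rfl, -⟩ | ⟨E, rfl, rfl⟩
    · have : C.count v = 0 := count_eq_zero.2 fun hc => hγ (by simp [hc])
      simp [List.count_append, hα0, this]
    · have h1 : γ.count v = 0 := count_eq_zero.2 hγ
      have h2 : E.count v = 0 := count_eq_zero.2 fun hc => hβ (by simp [hc])
      have : z c ∉ γ := fun hc => hn.2.1.2.2 (z c) hc (z c) (by simp) rfl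
      simp [List.count_append, hα0, h1, h2, this]

/-- Apart from `v`, a nonlinear factor of the suffix has at most one letter. As `Q` occurs twice,
that letter lies in `Ω` and `Q` is a power of `v`, which `SatLeft` moves past it. -/
theorem Pattern.eqv_of_right {s : ℕ → Bool}
    {Z₁ Z₂ Z₃ D₁ D₂ D₃ : List ℕ} {o o' : ℕ} (hP : Pattern M s Z₁ Z₂ Z₃ D₁ D₂ D₃ o o')
    {a Q Ω b A B : List Letter}
    (hz : ∀ j ∈ Z₁ ++ (Z₂ ++ Z₃), z j ∈ a)
    (hlin : ∀ c ∈ Q ++ Ω, isLin c = false)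
    (hE : suf s (Z₁ ++ (Z₂ ++ Z₃)) = A ++ (del v (Q ++ (Ω ++ Q)) ++ B)) :
    Eqv M (a ++ (Q ++ (Ω ++ (Q ++ b)))) (a ++ (Ω ++ (Q ++ (Q ++ b)))) := by
  have h1 := factor_tzWord (by
    intro c hc
    have := (mem_del.1 hc).1
    refine hlin c ?_
    simp only [mem_append] at this ⊢
    tauto) hE
  have hQ : del v Q = [] ∧ (del v Ω = [] ∨ ∃ j, j ∈ Z₁ ++ (Z₂ ++ Z₃) ∧ s j = false ∧
      del v Ω = [z j]) := by
    rw [del_append, del_append] at h1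
    rcases h1 with h1 | ⟨j, hj, h1⟩
    · simp only [append_eq_nil_iff] at h1
      exact ⟨h1.1, Or.inl h1.2.1⟩
    · have h2 := congrArg List.length h1
      simp only [length_append, length_singleton] at h2
      have h3 : (del v Q).length = 0 := by omega
      rw [List.length_eq_zero_iff] at h3
      rw [h3] at h1
      have := mem_lab.1 hj
      exact ⟨h3, Or.inr ⟨j, this.1, by simpa using this.2, by simpa using h1⟩⟩
  obtain ⟨hQ, hΩ⟩ := hQ
  have hQ' := length_of_replicate_count hQ
  rcases hΩ with hΩ | ⟨j, hj, hsj, hΩ⟩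
  · have hΩ' := length_of_replicate_count hΩ
    rw [hQ', hΩ']
    refine Eqv.of_eq ?_
    rw [← append_assoc (List.replicate _ v), ← append_assoc (List.replicate _ v) _ (_ ++ b),
      List.replicate_append_replicate, List.replicate_append_replicate, Nat.add_comm]
  · obtain ⟨p, p', rfl, hp, hp'⟩ := del_eq_cons hΩ
    rw [hQ', length_of_replicate_count hp, length_of_replicate_count hp']
    generalize Q.count v = i
    generalize p.count v = m
    generalize p'.count v = n
    have hL : SatLeft M := by
      refine hP.right.resolve_right fun h => ?_
      rw [h j hj] at hsj
      simp at hsj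
    cases i with
    | zero => exact Eqv.of_eq (by simp)
    | succ i =>
      have h3 := eqv_move_of_satLeft hL (v := v) (i + 1 + m) (l := n + i) (b := b) (hz j hj)
      have h4 := eqv_move_of_satLeft hL (v := v) m (l := n + i + 1 + i) (b := b) (hz j hj)
      rw [show i + 1 + m + (n + i + 1) = m + (n + i + 1 + i + 1) by omega] at h3
      refine (Eqv.of_eq ?_).trans ((h3.trans h4.symm).trans (Eqv.of_eq ?_))
      · rw [← List.replicate_append_replicate (n := i + 1), show n + i + 1 = n + (i + 1) by omega,
          ← List.replicate_append_replicate (n := n)]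
        simp only [append_assoc, cons_append]
      · rw [show n + i + 1 + i + 1 = n + ((i + 1) + (i + 1)) by omega,
          ← List.replicate_append_replicate (n := n),
          ← List.replicate_append_replicate (n := i + 1)]
        simp only [append_assoc, cons_append]

/-- Letters of `Q` and `Ω` occur twice in the word, so `QΩQ` contains no linear letter and lies in
the prefix, the middle or the suffix. The prefix has no nonlinear factor of length 2. In the middle
only `v` is repeated, and exactly twice, which is the critical case. The suffix is treated by
`eqv_of_right`. -/
theorem Pattern.transfer (hM : Basic M) (hT : ¬ Trivializes M) {s : ℕ → Bool}
    {Z₁ Z₂ Z₃ D₁ D₂ D₃ : List ℕ} {o o' : ℕ} (hP : Pattern M s Z₁ Z₂ Z₃ D₁ D₂ D₃ o o')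
    {a Q Ω b : List Letter} (hΩ : ∀ c ∈ Ω, 2 ≤ Ω.count c ∨ c ∈ a ∨ c ∈ b)
    (h : Eqv M (word s v Z₁ Z₂ Z₃) (a ++ (Q ++ (Ω ++ (Q ++ b))))) :
    Eqv M (a ++ (Q ++ (Ω ++ (Q ++ b)))) (a ++ (Ω ++ (Q ++ (Q ++ b)))) ∨
      (Q = [v] ∧ Critical M s v (Z₁ ++ (Z₂ ++ Z₃)) Z₂ a Ω b) := by
  obtain ⟨α, γ, β, w₃, Y, e, hα, hγ, hβ, hw₃, hY, hZY, hbare, hiff⟩ := hP.form hv hM hT h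
  by_cases hQ0 : Q = []
  · subst hQ0; exact Or.inl (Eqv.of_eq (by simp))
  have hlin : ∀ c ∈ Q ++ Ω, isLin c = false := by
    intro c hc
    by_contra hcl
    have h1 := count_linear hv hM hT hP.nodup h (l := c) (by simpa using hcl)
    simp only [List.count_append] at h1
    rcases List.mem_append.1 hc with hc | hc
    · have := List.count_pos_iff.2 hc; omega
    · have h2 := List.count_pos_iff.2 hc
      rcases hΩ c hc with h3 | h3 | h3
      · omega
      · have := List.count_pos_iff.2 h3; omega
      · have := List.count_pos_iff.2 h3; omega
  have hlin' : ∀ c ∈ Q ++ (Ω ++ Q), isLin c = false := by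
    intro c hc
    refine hlin c ?_
    simp only [mem_append] at hc ⊢
    tauto
  have hnl : ∀ l, isLin l = true → l ∉ Q ++ (Ω ++ Q) := by
    intro l hl hm
    have := hlin' l hm
    simp [hl] at this
  have hQlen : 0 < Q.length := List.length_pos_iff.2 hQ0
  have e' : a ++ ((Q ++ (Ω ++ Q)) ++ b) =
      pre s (Z₁ ++ (Z₂ ++ Z₃)) ++ r :: ((α ++ v :: (γ ++ v :: β)) ++ q :: w₃) := by
    rw [← e]; simp
  have hzmem : ∀ j ∈ Z₁ ++ (Z₂ ++ Z₃), z j ∈ α ++ (γ ++ β) := by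
    intro j hj
    rw [hY]
    simpa using hZY.subset hj
  rcases factor_split (hnl r rfl) e' with ⟨C, e1, -⟩ | ⟨C, rfl, e1⟩
  · exfalso
    refine not_factor_pre (B := C) hlin' e1 ?_
    simp only [length_append]; omega
  · rcases factor_split (hnl q rfl) e1.symm with ⟨C', e2, rfl⟩ | ⟨C', rfl, e2⟩
    · -- inside of the middle part
      right
      have hn : (α ++ (γ ++ β)).Nodup := by
        rw [hY]; exact (hZY.nodup_iff.1 hP.nodup).map fun a b h => by simpa using h
      have h3 : α ++ (γ ++ β) = del v C ++ (del v (Q ++ (Ω ++ Q)) ++ del v C') := by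
        have := congrArg (del v) e2
        rw [del_append, del_cons_self, del_append, del_cons_self, del_eq_self hα, del_eq_self hγ,
          del_eq_self hβ, del_append, del_append (v := v) (Q ++ (Ω ++ Q))] at this
        exact this
      have hQd : del v Q = [] := by
        refine List.eq_nil_iff_forall_not_mem.2 fun c hc => ?_
        have h4 := List.nodup_iff_count_le_one.1 hn c
        rw [h3] at h4
        simp only [del_append, List.count_append] at h4
        have := List.count_pos_iff.2 hc
        omega
      have hQr := length_of_replicate_count hQd
      have h5 := congrArg (List.count v) e2
      simp only [List.count_append, List.count_cons_self, count_eq_zero.2 hα, count_eq_zero.2 hγ,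
        count_eq_zero.2 hβ] at h5
      have hQc : Q.count v ≠ 0 := by
        intro h0
        rw [h0] at hQr
        exact hQ0 (by simpa using hQr)
      have hQv : Q = [v] := by
        rw [hQr, show Q.count v = 1 by omega]; rfl
      subst hQv
      simp only [List.count_singleton_self] at h5
      have hC : v ∉ C := count_eq_zero.1 (by omega)
      have hC' : v ∉ C' := count_eq_zero.1 (by omega)
      have hΩv : v ∉ Ω := count_eq_zero.1 (by omega)
      obtain ⟨rfl, e5⟩ := split_unique hα hC (B := γ ++ v :: β) (Q := Ω ++ v :: C')
        (by simpa using e2)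
      obtain ⟨rfl, rfl⟩ := split_unique hγ hΩv e5
      exact ⟨rfl, α, β, w₃, Y, rfl, rfl, hα, hγ, hβ, hw₃, hY, hZY, hbare, hiff⟩
    · -- inside of the suffix
      left
      rw [e2, del_append, del_append] at hw₃
      refine hP.eqv_of_right hv (fun j hj => ?_) hlin hw₃.symm
      have := hzmem j hj
      simp only [mem_append, mem_cons] at this ⊢
      tauto

/-- Starting from `ΩQQ` there is no exception: in the middle it would make the two `v` adjacent,
while they enclose the nonempty pattern `D₁`. -/
theorem Pattern.transfer' (hM : Basic M) (hT : ¬ Trivializes M) {s : ℕ → Bool}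
    {Z₁ Z₂ Z₃ D₁ D₂ D₃ : List ℕ} {o o' : ℕ} (hP : Pattern M s Z₁ Z₂ Z₃ D₁ D₂ D₃ o o')
    {a Q Ω b : List Letter} (hΩ : ∀ c ∈ Ω, 2 ≤ Ω.count c ∨ c ∈ a ∨ c ∈ b)
    (h : Eqv M (word s v Z₁ Z₂ Z₃) (a ++ (Ω ++ (Q ++ (Q ++ b))))) :
    Eqv M (a ++ (Q ++ (Ω ++ (Q ++ b)))) (a ++ (Ω ++ (Q ++ (Q ++ b)))) := by
  obtain ⟨α, γ, β, w₃, Y, e, hα, hγ, hβ, hw₃, hY, hZY, hbare, hiff⟩ := hP.form hv hM hT h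
  by_cases hQ0 : Q = []
  · subst hQ0; exact Eqv.of_eq (by simp)
  have hlin : ∀ c ∈ Q ++ Ω, isLin c = false := by
    intro c hc
    by_contra hcl
    have h1 := count_linear hv hM hT hP.nodup h (l := c) (by simpa using hcl)
    simp only [List.count_append] at h1
    rcases List.mem_append.1 hc with hc | hc
    · have := List.count_pos_iff.2 hc; omega
    · have h2 := List.count_pos_iff.2 hc
      rcases hΩ c hc with h3 | h3 | h3
      · omega
      · have := List.count_pos_iff.2 h3; omega
      · have := List.count_pos_iff.2 h3; omega
  have hlin' : ∀ c ∈ Ω ++ (Q ++ Q), isLin c = false := by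
    intro c hc
    refine hlin c ?_
    simp only [mem_append] at hc ⊢
    tauto
  have hnl : ∀ l, isLin l = true → l ∉ Ω ++ (Q ++ Q) := by
    intro l hl hm
    have := hlin' l hm
    simp [hl] at this
  have hQlen : 0 < Q.length := List.length_pos_iff.2 hQ0
  have e' : a ++ ((Ω ++ (Q ++ Q)) ++ b) =
      pre s (Z₁ ++ (Z₂ ++ Z₃)) ++ r :: ((α ++ v :: (γ ++ v :: β)) ++ q :: w₃) := by
    rw [← e]; simp
  have hzmem : ∀ j ∈ Z₁ ++ (Z₂ ++ Z₃), z j ∈ α ++ (γ ++ β) := by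
    intro j hj
    rw [hY]
    simpa using hZY.subset hj
  rcases factor_split (hnl r rfl) e' with ⟨C, e1, -⟩ | ⟨C, rfl, e1⟩
  · exfalso
    refine not_factor_pre (B := C) hlin' e1 ?_
    simp only [length_append]; omega
  · rcases factor_split (hnl q rfl) e1.symm with ⟨C', e2, rfl⟩ | ⟨C', rfl, e2⟩
    · exfalso
      have hn : (α ++ (γ ++ β)).Nodup := by
        rw [hY]; exact (hZY.nodup_iff.1 hP.nodup).map fun a b h => by simpa using h
      have h3 : α ++ (γ ++ β) = del v C ++ (del v (Ω ++ (Q ++ Q)) ++ del v C') := by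
        have := congrArg (del v) e2
        rw [del_append, del_cons_self, del_append, del_cons_self, del_eq_self hα, del_eq_self hγ,
          del_eq_self hβ, del_append, del_append (v := v) (Ω ++ (Q ++ Q))] at this
        exact this
      have hQd : del v Q = [] := by
        refine List.eq_nil_iff_forall_not_mem.2 fun c hc => ?_
        have h4 := List.nodup_iff_count_le_one.1 hn c
        rw [h3] at h4
        simp only [del_append, List.count_append] at h4
        have := List.count_pos_iff.2 hc
        omega
      have hQr := length_of_replicate_count hQd
      have h5 := congrArg (List.count v) e2
      simp only [List.count_append, List.count_cons_self, count_eq_zero.2 hα, count_eq_zero.2 hγ,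
        count_eq_zero.2 hβ] at h5
      have hQc : Q.count v ≠ 0 := by
        intro h0
        rw [h0] at hQr
        exact hQ0 (by simpa using hQr)
      have hQv : Q = [v] := by
        rw [hQr, show Q.count v = 1 by omega]; rfl
      subst hQv
      simp only [List.count_singleton_self] at h5
      have hC : v ∉ C ++ Ω := by
        rw [← count_eq_zero, List.count_append]; omega
      obtain ⟨-, e5⟩ := split_unique hα hC (B := γ ++ v :: β) (Q := v :: C')
        (by simpa using e2)
      obtain ⟨rfl, -⟩ := split_unique hγ (List.not_mem_nil) (Q := C') (by simpa using e5)
      obtain ⟨i, hi⟩ := List.exists_mem_of_ne_nil _ hP.good₁.ne_nil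
      have := (hiff i).2 (hP.sub₁.subset hi)
      simp at this
    · have h6 : suf s (Z₁ ++ (Z₂ ++ Z₃)) = del v C' ++ (del v (Q ++ (Ω ++ Q)) ++ del v b) ∨
          del v Q = [] := by
        right
        rw [e2, del_append, del_append] at hw₃
        rcases factor_tzWord (fun c hc => hlin' c (mem_del.1 hc).1) hw₃.symm with h7 | ⟨j, -, h7⟩
        · simp only [del_append, append_eq_nil_iff] at h7
          exact h7.2.1
        · have h8 := congrArg List.length h7
          simp only [del_append, length_append, length_singleton] at h8
          exact List.length_eq_zero_iff.1 (by omega)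
      refine hP.eqv_of_right hv (A := del v C') (B := del v b) (fun j hj => ?_) hlin ?_
      · have := hzmem j hj
        simp only [mem_append, mem_cons] at this ⊢
        tauto
      · rcases h6 with h6 | h6
        · exact h6
        · rw [← hw₃, e2]
          simp [h6]

end Special

/-! ### Images of letters in a critical factor -/

/-- The letters `z i`. -/
def isZ : Letter → Bool
  | z _ => true
  | _ => false

theorem filter_isZ_ztWord (L : List ℕ) : (ztWord L).filter isZ = L.map z := by
  induction L with
  | nil => rfl
  | cons i L ih =>
    have h : isZ (z i) = true := rfl
    have h' : isZ (t i) = false := rfl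
    simp [h, h', ih]

theorem filter_isZ_tzWord (L : List ℕ) : (tzWord L).filter isZ = L.map z := by
  induction L with
  | nil => rfl
  | cons i L ih =>
    have h : isZ (z i) = true := rfl
    have h' : isZ (t i) = false := rfl
    simp [h, h', ih]

theorem map_idx_map_z (L : List ℕ) : (L.map z).map idx = L := by
  rw [List.map_map]; exact (List.map_congr_left fun i _ => rfl).trans (List.map_id L)

theorem sublist_of_map_z_sublist {L L' : List ℕ} (h : L.map z <+ L'.map z) : L <+ L' := by
  have := h.map idx
  rwa [map_idx_map_z, map_idx_map_z] at this

theorem z_mem_pre_or_suf (s : ℕ → Bool) {Z : List ℕ} {i : ℕ} (hi : i ∈ Z) :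
    (s i = true ∧ z i ∈ pre s Z) ∨ (s i = false ∧ z i ∈ suf s Z) := by
  cases h : s i
  · right; simp [suf, hi, h]
  · left; simp [pre, hi, h]

section Critical

variable {s : ℕ → Bool} {v : Letter} {Z Z₂ : List ℕ} {a Ω b : List Letter}

theorem Critical.nodup (hZ : Z.Nodup) (h : Critical M s v Z Z₂ a Ω b) : Ω.Nodup := by
  obtain ⟨α, β, w₃, Y, -, -, -, -, -, -, hY, hZY, -⟩ := h
  have hn : (α ++ (Ω ++ β)).Nodup := by
    rw [hY]; exact (hZY.nodup_iff.1 hZ).map fun a b h => by simpa using h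
  exact (List.nodup_append.1 (List.nodup_append.1 hn).2.1).1

theorem Critical.exists_z (h : Critical M s v Z Z₂ a Ω b) {c : Letter} (hc : c ∈ Ω) :
    ∃ i ∈ Z₂, c = z i := by
  obtain ⟨α, β, w₃, Y, -, -, -, -, -, -, hY, -, -, hiff⟩ := h
  have : c ∈ Y.map z := by rw [← hY]; simp [hc]
  obtain ⟨i, -, rfl⟩ := List.mem_map.1 this
  exact ⟨i, (hiff i).1 hc, rfl⟩

theorem Critical.perm (hZ : Z.Nodup) (hZ₂ : Z₂.Nodup) (h : Critical M s v Z Z₂ a Ω b) :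
    Ω.Perm (Z₂.map z) := by
  refine (List.perm_ext_iff_of_nodup (h.nodup hZ) (hZ₂.map fun a b h => by simpa using h)).2 ?_
  intro c
  constructor
  · intro hc
    obtain ⟨i, hi, rfl⟩ := h.exists_z hc
    simpa using hi
  · intro hc
    obtain ⟨i, hi, rfl⟩ := List.mem_map.1 hc
    obtain ⟨α, β, w₃, Y, -, -, -, -, -, -, -, -, -, hiff⟩ := h
    exact (hiff i).2 hi

/-- Letters of `Ω` occur in `a` only inside the prefix, where nonlinear letters are isolated. -/
theorem Critical.factor_left (hZ : Z.Nodup) (h : Critical M s v Z Z₂ a Ω b) {γ : List Letter}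
    (hγ : ∀ c ∈ γ, c ∈ Ω) (ha : γ <:+: a) : γ = [] ∨ ∃ j, s j = true ∧ γ = [z j] := by
  have hlin : ∀ c ∈ γ, isLin c = false := by
    intro c hc
    obtain ⟨i, -, rfl⟩ := h.exists_z (hγ c hc)
    rfl
  obtain ⟨α, β, w₃, Y, rfl, -, -, -, -, -, hY, hZY, -⟩ := h
  have hn : (α ++ (Ω ++ β)).Nodup := by
    rw [hY]; exact (hZY.nodup_iff.1 hZ).map fun a b h => by simpa using h
  obtain ⟨A, B, e⟩ := ha
  rw [append_assoc] at e
  rcases factor_split (fun hr => by simpa [isLin] using hlin r hr) e with ⟨C, e1, -⟩ | ⟨C, -, e1⟩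
  · rcases factor_ztWord hlin e1 with h | ⟨j, hj, h⟩
    · exact Or.inl h
    · exact Or.inr ⟨j, (mem_lab.1 hj).2, h⟩
  · left
    refine List.eq_nil_iff_forall_not_mem.2 fun c hc => ?_
    exact (List.nodup_append.1 hn).2.2 c (by rw [e1]; simp [hc]) c (by simp [hγ c hc]) rfl

theorem Critical.factor_right (hZ : Z.Nodup) (h : Critical M s v Z Z₂ a Ω b) {γ : List Letter}
    (hγ : ∀ c ∈ γ, c ∈ Ω) (hb : γ <:+: b) : γ = [] ∨ ∃ j, s j = false ∧ γ = [z j] := by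
  have hlin : ∀ c ∈ γ, isLin c = false := by
    intro c hc
    obtain ⟨i, -, rfl⟩ := h.exists_z (hγ c hc)
    rfl
  obtain ⟨α, β, w₃, Y, -, rfl, -, hΩ, -, hw₃, hY, hZY, -⟩ := h
  have hn : (α ++ (Ω ++ β)).Nodup := by
    rw [hY]; exact (hZY.nodup_iff.1 hZ).map fun a b h => by simpa using h
  obtain ⟨A, B, e⟩ := hb
  rw [append_assoc] at e
  rcases factor_split (fun hr => by simpa [isLin] using hlin q hr) e with ⟨C, e1, -⟩ | ⟨C, -, e1⟩
  · left
    refine List.eq_nil_iff_forall_not_mem.2 fun c hc => ?_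
    exact (List.nodup_append.1 (List.nodup_append.1 hn).2.1).2.2 c (hγ c hc) c
      (by rw [e1]; simp [hc]) rfl
  · rw [e1, del_append, del_append, del_eq_self (w := γ) fun hc => hΩ (hγ _ hc)] at hw₃
    rcases factor_tzWord hlin hw₃.symm with h | ⟨j, hj, h⟩
    · exact Or.inl h
    · exact Or.inr ⟨j, by simpa using (mem_lab.1 hj).2, h⟩

theorem pair_sublist_append {α : Type*} {c d : α} {u w : List α} (h : [c, d] <+ u ++ w)
    (hc : c ∉ w) (hd : d ∉ w) : [c, d] <+ u := by
  obtain ⟨l₁, l₂, e, h1, h2⟩ := List.sublist_append_iff.1 h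
  cases l₂ with
  | nil => rw [e, append_nil]; exact h1
  | cons f l₂ =>
    exfalso
    have hf : f ∈ w := h2.subset (by simp)
    have : f ∈ [c, d] := by rw [e]; simp
    simp only [mem_cons, not_mem_nil, or_false] at this
    rcases this with rfl | rfl
    · exact hc hf
    · exact hd hf

theorem pair_sublist_append' {α : Type*} {c d : α} {u w : List α} (h : [c, d] <+ u ++ w)
    (hc : c ∉ u) (hd : d ∉ u) : [c, d] <+ w := by
  obtain ⟨l₁, l₂, e, h1, h2⟩ := List.sublist_append_iff.1 h
  cases l₁ with
  | nil => rw [e, nil_append]; exact h2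
  | cons f l₁ =>
    exfalso
    have hf : f ∈ u := h1.subset (by simp)
    have : f ∈ [c, d] := by rw [e]; simp
    simp only [mem_cons, not_mem_nil, or_false] at this
    rcases this with rfl | rfl
    · exact hc hf
    · exact hd hf

theorem Critical.lt_left (hZ : Z.Nodup) (h : Critical M s v Z Z₂ a Ω b) {i j : ℕ}
    (hi : z i ∈ Ω) (hj : z j ∈ Ω) (ha : [z i, z j] <+ a) : i < j := by
  obtain ⟨α, β, w₃, Y, rfl, -, -, -, -, -, hY, hZY, -⟩ := h
  have hn : (α ++ (Ω ++ β)).Nodup := by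
    rw [hY]; exact (hZY.nodup_iff.1 hZ).map fun a b h => by simpa using h
  have hα : ∀ i, z i ∈ Ω → z i ∉ r :: α := fun i hi hc => by
    simp only [mem_cons, reduceCtorEq, false_or] at hc
    exact (List.nodup_append.1 hn).2.2 _ hc _ (by simp [hi]) rfl
  have h1 := (pair_sublist_append ha (hα i hi) (hα j hj)).filter isZ
  rw [pre, filter_isZ_ztWord] at h1
  have h2 : [i, j] <+ lab s Z := sublist_of_map_z_sublist h1
  exact List.pairwise_iff_forall_sublist.1 (lab_pairwise hZ) h2

theorem Critical.lt_right (hZ : Z.Nodup) (h : Critical M s v Z Z₂ a Ω b) {i j : ℕ}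
    (hi : z i ∈ Ω) (hj : z j ∈ Ω) (hb : [z i, z j] <+ b) : i < j := by
  obtain ⟨α, β, w₃, Y, -, rfl, -, hΩ, -, hw₃, hY, hZY, -⟩ := h
  have hn : (α ++ (Ω ++ β)).Nodup := by
    rw [hY]; exact (hZY.nodup_iff.1 hZ).map fun a b h => by simpa using h
  have hβ : ∀ i, z i ∈ Ω → z i ∉ β := fun i hi hc =>
    (List.nodup_append.1 (List.nodup_append.1 hn).2.1).2.2 _ hi _ hc rfl
  have h0 := pair_sublist_append' hb (hβ i hi) (hβ j hj)
  have h1 : [z i, z j] <+ w₃ := by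
    rw [← singleton_append (l := w₃)] at h0
    exact pair_sublist_append' h0 (by simp) (by simp)
  have hne : ∀ i, z i ∈ Ω → z i ≠ v := by rintro i hi rfl; exact hΩ hi
  have h2 : (del v [z i, z j]).filter isZ <+ (del v w₃).filter isZ :=
    (h1.filter fun c => decide (c ≠ v)).filter isZ
  rw [hw₃, suf, filter_isZ_tzWord, del_eq_self (by simp [(hne i hi).symm, (hne j hj).symm])] at h2
  have h3 : [i, j] <+ lab (fun i => !s i) Z :=
    sublist_of_map_z_sublist h2
  exact List.pairwise_iff_forall_sublist.1 (lab_pairwise hZ) h3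

theorem length_eq_one_of_flatMap {α β : Type*} (ψ : α → List β) : ∀ {l : List α},
    (∀ c ∈ l, (ψ c).length ≤ 1) → l.length ≤ (l.flatMap ψ).length →
    ∀ c ∈ l, (ψ c).length = 1 := by
  intro l
  induction l with
  | nil => simp
  | cons d l ih =>
    intro h1 h2 c hc
    have h3 : ∀ l' : List α, (∀ c ∈ l', (ψ c).length ≤ 1) → (l'.flatMap ψ).length ≤ l'.length := by
      intro l'
      induction l' with
      | nil => simp
      | cons d l' ih =>
        intro h
        have h4 := ih fun c hc => h c (by simp [hc])
        have h5 := h d (by simp)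
        rw [flatMap_cons, length_append, length_cons]
        omega
    have h4 := h3 l fun c hc => h1 c (by simp [hc])
    have h5 := h1 d (by simp)
    rw [flatMap_cons, length_append, length_cons] at h2
    rcases List.mem_cons.1 hc with rfl | hc
    · omega
    · exact ih (fun c hc => h1 c (by simp [hc])) (by omega) c hc

theorem infix_flatMap_of_mem {α β : Type*} (ψ : α → List β) {l : List α} {c : α} (hc : c ∈ l) :
    ψ c <:+: l.flatMap ψ := by
  obtain ⟨l₁, l₂, rfl⟩ := List.append_of_mem hc
  exact ⟨l₁.flatMap ψ, l₂.flatMap ψ, by simp⟩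

theorem sublist_flatMap {α β : Type*} (ψ : α → List β) {l l' : List α} (h : l <+ l') :
    l.flatMap ψ <+ l'.flatMap ψ := by
  induction h with
  | slnil => exact List.Sublist.refl _
  | cons a _ ih => rw [flatMap_cons]; exact ih.trans (List.sublist_append_right _ _)
  | cons_cons a _ ih => rw [flatMap_cons, flatMap_cons]; exact (List.Sublist.refl _).append ih

/-- A critical factor which is a product of as many images of letters as possible is given by a
map on the labels. -/
theorem Critical.images (hZ : Z.Nodup) (hZ₂ : Z₂.Nodup) {ψ : Letter → List Letter} {L : List ℕ}
    (h : Critical M s v Z Z₂ a ((L.map z).flatMap ψ) b) (hL : ∀ i ∈ L, i ∈ Z)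
    (hlen : L.length = Z₂.length) (ha : (pre s Z).flatMap ψ <:+: a)
    (hb : (suf s Z).flatMap ψ <:+: b) :
    ∃ f : ℕ → ℕ, (∀ i ∈ L, ψ (z i) = [z (f i)]) ∧ (∀ i ∈ L, s (f i) = s i) ∧
      (∀ i ∈ L, ∀ j ∈ L, s i = s j → i < j → f i < f j) ∧ (L.map f).Perm Z₂ ∧
      (L.map z).flatMap ψ = (L.map f).map z := by
  have hsub : ∀ i ∈ L, ∀ c ∈ ψ (z i), c ∈ (L.map z).flatMap ψ := fun i hi c hc =>
    List.mem_flatMap.2 ⟨z i, by simpa using hi, hc⟩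
  have hcase : ∀ i ∈ L, ψ (z i) = [] ∨ ∃ j, s j = s i ∧ ψ (z i) = [z j] := by
    intro i hi
    rcases z_mem_pre_or_suf s (hL i hi) with ⟨h1, h2⟩ | ⟨h1, h2⟩
    · rw [h1]
      exact h.factor_left hZ (hsub i hi) ((infix_flatMap_of_mem ψ h2).trans ha)
    · rw [h1]
      exact h.factor_right hZ (hsub i hi) ((infix_flatMap_of_mem ψ h2).trans hb)
  have hone : ∀ i ∈ L, ∃ j, s j = s i ∧ ψ (z i) = [z j] := by
    intro i hi
    -- The images have length at most 1 and together fill `Z₂.length` places, which equals their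
    -- number; so none is empty.
    refine (hcase i hi).resolve_left fun h0 => ?_
    have h1 := length_eq_one_of_flatMap ψ (l := L.map z) (fun c hc => by
      obtain ⟨j, hj, rfl⟩ := List.mem_map.1 hc
      rcases hcase j hj with e | ⟨k, -, e⟩ <;> simp [e])
      (by rw [(h.perm hZ hZ₂).length_eq, length_map, length_map, hlen]) (z i) (by simpa using hi)
    rw [h0] at h1
    simp at h1
  choose! f hf using hone
  have hΩ : (L.map z).flatMap ψ = (L.map f).map z := by
    rw [List.flatMap_map, List.map_map]
    have : ∀ l : List ℕ, (∀ i ∈ l, i ∈ L) → (l.flatMap fun i => ψ (z i)) = l.map (z ∘ f) := by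
      intro l hl
      induction l with
      | nil => rfl
      | cons i l ih =>
        rw [flatMap_cons, ih fun j hj => hl j (by simp [hj]), (hf i (hl i (by simp))).2]
        rfl
    exact this L fun _ h => h
  have hmem : ∀ i ∈ L, z (f i) ∈ (L.map z).flatMap ψ := fun i hi =>
    hsub i hi _ (by rw [(hf i hi).2]; simp)
  refine ⟨f, fun i hi => (hf i hi).2, fun i hi => (hf i hi).1, ?_, ?_, hΩ⟩
  · intro i hi j hj hs hij
    have hpair : ∀ {s' : ℕ → Bool}, s' i = true → s' j = true → [i, j] <+ lab s' Z := by
      intro s' h1 h2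
      rcases pair_sublist_or hij.ne (mem_lab.2 ⟨hL i hi, h1⟩) (mem_lab.2 ⟨hL j hj, h2⟩) with h | h
      · exact h
      · exact absurd (List.pairwise_iff_forall_sublist.1 (lab_pairwise hZ) h) (lt_asymm hij)
    have e : [z i, z j].flatMap ψ = [z (f i), z (f j)] := by
      simp [(hf i hi).2, (hf j hj).2]
    cases hsi : s i with
    | true =>
      refine h.lt_left hZ (hmem i hi) (hmem j hj) ?_
      rw [← e]
      refine (sublist_flatMap ψ ?_).trans ha.sublist
      exact ((hpair hsi (hs ▸ hsi)).map z).trans (map_z_sublist_ztWord _)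
    | false =>
      refine h.lt_right hZ (hmem i hi) (hmem j hj) ?_
      rw [← e]
      refine (sublist_flatMap ψ ?_).trans hb.sublist
      exact ((hpair (s' := fun i => !s i) (by simp [hsi]) (by simp [← hs, hsi])).map z).trans
        (map_z_sublist_tzWord _)
  · have h1 := (h.perm hZ hZ₂)
    rw [hΩ] at h1
    have := h1.map idx
    rwa [map_idx_map_z, map_idx_map_z] at this

/-- In a critical situation the order of rigid labels is fixed. -/
theorem Critical.eq_of_rigid (hM : Basic M) (hT : ¬ Trivializes M) (hZ : Z.Nodup) {L D : List ℕ}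
    (h : Critical M s v Z Z₂ a (L.map z) b) {p : ℕ → Bool} (hD : D <+ Z)
    (hp : D.Perm (L.filter p)) (hr : ∀ i ∈ D, ∀ j ∈ D, RigidPair M s i j) : L.filter p = D := by
  obtain ⟨α, β, w₃, Y, -, -, -, -, -, -, hY, hZY, hE, -⟩ := h
  have hYn := hZY.nodup_iff.1 hZ
  have hLY : L.filter p <+ Y := by
    refine List.filter_sublist.trans (sublist_of_map_z_sublist ?_)
    rw [← hY]
    exact (List.sublist_append_left _ β).trans (List.sublist_append_right α _)
  have hDn := hZ.sublist hD
  refine eq_of_isChain_sublist hDn hp ?_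
  rw [List.isChain_iff_forall_rel_of_append_cons_cons]
  intro i j l₁ l₂ e
  have hij : [i, j] <+ D := by
    rw [e]
    exact (((List.nil_sublist l₂).cons_cons j).cons_cons i).trans (List.sublist_append_right l₁ _)
  have hi := hij.subset (show i ∈ [i, j] by simp)
  have hj := hij.subset (show j ∈ [i, j] by simp)
  have hijY := pair_sublist_of_eqv hM hT hZ (Perm.refl Z) hZY hE (hij.trans hD) (hr i hi j hj)
  have hne : i ≠ j := by simpa using hij.nodup hDn
  refine (pair_sublist_or hne (hp.subset hi) (hp.subset hj)).resolve_right fun hji => ?_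
  exact lt_asymm ((pair_sublist_iff hYn).1 hijY).2.2 ((pair_sublist_iff hYn).1 (hji.trans hLY)).2.2

end Critical

/-- A chain of inequalities transported by a monotone map. -/
theorem getLast_lt_of_map_eq {f : ℕ → ℕ} : ∀ {A : List ℕ} {g h : ℕ},
    (g :: A).map f = A ++ [h] → (∀ i ∈ g :: A, ∀ j ∈ g :: A, i < j → f i < f j) →
    g < (A ++ [h]).head (by simp) → (g :: A).getLast (by simp) < h := by
  intro A
  induction A with
  | nil => intro g h _ _ h3; simpa using h3
  | cons n A ih =>
    intro g h h1 h2 h3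
    simp only [map_cons, cons_append, List.cons.injEq] at h1
    simp only [cons_append, head_cons] at h3
    rw [List.getLast_cons (by simp)]
    refine ih (by simpa using h1.2) (fun i hi j hj => h2 i (by simp [hi]) j (by simp [hj])) ?_
    have h4 := h2 g (by simp) n (by simp) h3
    have h5 : (A ++ [h]).head (by simp) = f n := by
      simp only [← h1.2, head_cons]
    rw [h5, ← h1.1]
    exact h1.1 ▸ h4

/-- The data of the proof of non-distributivity. -/
structure Config (M : Type u) [Monoid M] (s : ℕ → Bool) (N : List ℕ) (g h n₁ n₂ : ℕ) : Prop where
  basic : Basic M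
  nontriv : ¬ Trivializes M
  patX : ∃ D₁ D₂ D₃ o', Pattern M s [] (g :: N) [h] D₁ D₂ D₃ h o'
  patY : ∃ D₁ D₂ D₃ o', Pattern M s [g] (N ++ [h]) [] D₁ D₂ D₃ g o'
  eq_head : ∃ N', N = n₁ :: N'
  eq_last : ∃ N', N = N' ++ [n₂]
  lt_head : g < n₁
  lt_last : h < n₂
  type_head : s g = s n₁
  type_last : s h = s n₂
  first : s n₁ = false → ¬ SatFirst M
  second : s n₂ = true → ¬ SatSecond M

/-! ### Impossibility of a critical factor for one special letter -/

section Config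

variable {s : ℕ → Bool} {N : List ℕ} {g h n₁ n₂ : ℕ} (C : Config M s N g h n₁ n₂)
include C

theorem Config.nodup : (g :: (N ++ [h])).Nodup := by
  obtain ⟨D₁, D₂, D₃, o', hP⟩ := C.patX
  simpa using hP.nodup

/-- When `g` and `h` share a type, `first` or `second` supplies the missing law for exactly that
type. -/
theorem Config.rigid (hs : s g = s h) {i j : ℕ} (hi : s i = s g) :
    RigidPair M s i j := by
  right
  cases hg : s g with
  | true =>
    left
    exact ⟨hi.trans hg, C.second (C.type_last ▸ hs ▸ hg)⟩
  | false =>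
    right
    exact ⟨hi.trans hg, C.first (C.type_head ▸ hg)⟩

/-- The images define a type-preserving map `f` from `g :: N` onto `N ++ [h]`, increasing on each
type. Counting labels of the type of `g` shows that `h` has this type. Rigidity then makes `f` the
shift to the next label of this type; from `g < n₁` it follows step by step that each label is
smaller than the next, ending with `n₂ < h`, against `h < n₂`. -/
theorem Config.not_critical_y {ψ : Letter → List Letter} {a b : List Letter}
    (hc : Critical M s y (g :: (N ++ [h])) (N ++ [h]) a (((g :: N).map z).flatMap ψ) b)
    (ha : (pre s (g :: (N ++ [h]))).flatMap ψ <:+: a)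
    (hb : (suf s (g :: (N ++ [h]))).flatMap ψ <:+: b) : False := by
  have hn := C.nodup
  obtain ⟨f, h1, h2, h3, h4, h5⟩ := hc.images hn hn.of_cons (fun i hi => by
    simp only [mem_cons, mem_append] at hi ⊢; tauto) (by simp) ha hb
  rw [h5] at hc
  set p : ℕ → Bool := fun i => decide (s i = s g) with hp
  have e1 : ((g :: N).map f).filter p = ((g :: N).filter p).map f := by
    rw [List.filter_map]
    congr 1
    exact List.filter_congr fun i hi => by simp [hp, h2 i hi]
  have hpg : p g = true := by simp [hp]
  have e2 := (h4.filter p)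
  rw [e1, List.filter_cons, hpg, if_pos rfl, List.filter_append] at e2
  have hsh : s h = s g := by
    by_contra hne
    have := e2.length_eq
    simp [hp, hne] at this
  have hph : p h = true := by simp [hp, hsh]
  rw [List.filter_cons, hph, if_pos rfl, List.filter_nil] at e2
  have hDZ : N.filter p ++ [h] <+ g :: (N ++ [h]) :=
    ((List.filter_sublist).append (List.Sublist.refl _)).cons g
  have key := hc.eq_of_rigid C.basic C.nontriv hn (p := p) hDZ
    (by rw [e1, List.filter_cons, hpg, if_pos rfl]; exact e2.symm) (fun i hi j _ => by
      have hpD : ∀ i ∈ N.filter p ++ [h], s i = s g := by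
        intro i hi
        simp only [mem_append, mem_filter, mem_singleton, hp, decide_eq_true_eq] at hi
        rcases hi with hi | rfl
        · exact hi.2
        · exact hsh
      exact C.rigid hsh.symm (hpD i hi))
  rw [e1, List.filter_cons, hpg, if_pos rfl] at key
  obtain ⟨N', hN'⟩ := C.eq_head
  obtain ⟨N'', hN''⟩ := C.eq_last
  have hhead : (N.filter p ++ [h]).head (by simp) = n₁ := by
    have : p n₁ = true := by simp [hp, C.type_head]
    simp [hN', this]
  have hlast : (g :: N.filter p).getLast (by simp) = n₂ := by
    have : p n₂ = true := by simp [hp, ← C.type_last, hsh]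
    simp [hN'', List.filter_append, this]
  have := getLast_lt_of_map_eq key (fun i hi j hj hij => by
    have hsub : ∀ i ∈ g :: N.filter p, i ∈ g :: N ∧ s i = s g := by
      intro i hi
      simp only [mem_cons, mem_filter, hp, decide_eq_true_eq] at hi
      rcases hi with rfl | hi
      · simp
      · simp [hi]
    exact h3 i (hsub i hi).1 j (hsub j hj).1 ((hsub i hi).2.trans (hsub j hj).2.symm) hij)
    (by rw [hhead]; exact C.lt_head)
  rw [hlast] at this
  exact lt_asymm this C.lt_last

/-- The mirror image: the shift runs backwards from `h` to `g`, so the lists are reversed, and `h <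
n₂` forces `n₁ < g`. -/
theorem Config.not_critical_x {ψ : Letter → List Letter} {a b : List Letter}
    (hc : Critical M s x (g :: (N ++ [h])) (g :: N) a (((N ++ [h]).map z).flatMap ψ) b)
    (ha : (pre s (g :: (N ++ [h]))).flatMap ψ <:+: a)
    (hb : (suf s (g :: (N ++ [h]))).flatMap ψ <:+: b) : False := by
  have hn := C.nodup
  have hn' : (g :: N).Nodup := hn.sublist ((List.sublist_append_left N [h]).cons_cons g)
  obtain ⟨f, h1, h2, h3, h4, h5⟩ := hc.images hn hn' (fun i hi => by
    simp only [mem_cons, mem_append] at hi ⊢; tauto) (by simp) ha hb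
  rw [h5] at hc
  set p : ℕ → Bool := fun i => decide (s i = s h) with hp
  have e1 : ((N ++ [h]).map f).filter p = ((N ++ [h]).filter p).map f := by
    rw [List.filter_map]
    congr 1
    exact List.filter_congr fun i hi => by simp [hp, h2 i hi]
  have hph : p h = true := by simp [hp]
  have e2 := (h4.filter p)
  rw [e1] at e2
  have hsg : s g = s h := by
    by_contra hne
    have := e2.length_eq
    simp [hp, hne, List.filter_append] at this
  have hpg : p g = true := by simp [hp, hsg]
  have e3 : (N ++ [h]).filter p = N.filter p ++ [h] := by simp [List.filter_append, hph]
  have e4 : (g :: N).filter p = g :: N.filter p := by simp [hpg]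
  rw [e3, e4] at e2
  have hDZ : g :: N.filter p <+ g :: (N ++ [h]) :=
    (List.filter_sublist.trans (List.sublist_append_left N [h])).cons_cons g
  have key := hc.eq_of_rigid C.basic C.nontriv hn (p := p) hDZ
    (by rw [e1, e3]; exact e2.symm) (fun i hi j _ => by
      have hpD : ∀ i ∈ g :: N.filter p, s i = s g := by
        intro i hi
        simp only [mem_cons, mem_filter, hp, decide_eq_true_eq] at hi
        rcases hi with rfl | hi
        · rfl
        · exact hi.2.trans hsg.symm
      exact C.rigid hsg (hpD i hi))
  rw [e1, e3] at key
  obtain ⟨N', hN'⟩ := C.eq_head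
  obtain ⟨N'', hN''⟩ := C.eq_last
  have key' : (h :: (N.filter p).reverse).map f = (N.filter p).reverse ++ [g] := by
    have := congrArg List.reverse key
    simpa [List.map_reverse] using this
  have hhead : ((N.filter p).reverse ++ [g]).head (by simp) = n₂ := by
    have : p n₂ = true := by simp [hp, ← C.type_last]
    simp [hN'', List.filter_append, this]
  have hlast : (h :: (N.filter p).reverse).getLast (by simp) = n₁ := by
    have : p n₁ = true := by simp [hp, ← C.type_head, hsg]
    simp [hN', this]
  have := getLast_lt_of_map_eq key' (fun i hi j hj hij => by
    have hsub : ∀ i ∈ h :: (N.filter p).reverse, i ∈ N ++ [h] ∧ s i = s h := by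
      intro i hi
      simp only [mem_cons, mem_reverse, mem_filter, hp, decide_eq_true_eq] at hi
      rcases hi with rfl | hi
      · simp
      · simp [hi]
    exact h3 i (hsub i hi).1 j (hsub j hj).1 ((hsub i hi).2.trans (hsub j hj).2.symm) hij)
    (by rw [hhead]; exact C.lt_last)
  rw [hlast] at this
  exact lt_asymm this C.lt_head

end Config

/-! ### Critical factors of words with two special letters -/

theorem count_del {u v : Letter} (h : u ≠ v) (w : List Letter) : (del v w).count u = w.count u := by
  rw [del, List.count_filter (by simpa using h)]

theorem eq_of_del_eq_singleton {u c : Letter} (hc : c ≠ u) {w : List Letter} (h : del u w = [c])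
    (h1 : w.count u = 1) : w = [u, c] ∨ w = [c, u] := by
  obtain ⟨p, p', rfl, hp, hp'⟩ := del_eq_cons h
  rw [length_of_replicate_count hp, length_of_replicate_count hp']
  simp only [count_append, count_cons_of_ne hc] at h1
  rcases Nat.eq_zero_or_pos (p.count u) with h0 | h0
  · right
    rw [h0, show p'.count u = 1 by omega]; rfl
  · left
    rw [show p.count u = 1 by omega, show p'.count u = 0 by omega]; rfl

theorem eqv_swap_left (hM : Basic M) (c d : Letter) (a b e : List Letter) :
    Eqv M (a ++ [c, d] ++ b ++ [c, d] ++ e) (a ++ [d, c] ++ b ++ [c, d] ++ e) := by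
  intro φ
  have := congrArg (fun m => (a.map φ).prod * (m * (e.map φ).prod))
    (hM.a4 (φ c) (φ d) (b.map φ).prod)
  simpa [mul_assoc] using this

theorem eqv_swap_right (hM : Basic M) (c d : Letter) (a b e : List Letter) :
    Eqv M (a ++ [c, d] ++ b ++ [c, d] ++ e) (a ++ [c, d] ++ b ++ [d, c] ++ e) := by
  intro φ
  have := congrArg (fun m => (a.map φ).prod * (m * (e.map φ).prod))
    (hM.a5 (φ c) (φ d) (b.map φ).prod)
  simpa [mul_assoc] using this

/-- The normal forms for `v` and for `u` together put exactly one `u` into `Ω`, inside the image of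
some `z j`, beside one letter `z (f j)`. The image occurs once more in `a` or `b`, so the fourth or
fifth identity swaps its two letters within `Ω`, which moves `z (f j)` across a `u`. -/
theorem not_critical_of_both {v u : Letter} (hvu : (v = x ∧ u = y) ∨ (v = y ∧ u = x))
    (hM : Basic M) (hT : ¬ Trivializes M) {s : ℕ → Bool} {Z Z₂ : List ℕ} (hZ : Z.Nodup)
    (hZ₂ : Z₂.Nodup) {Z₁' Z₂' Z₃' D₁ D₂ D₃ : List ℕ} {o o' : ℕ}
    (hP : Pattern M s Z₁' Z₂' Z₃' D₁ D₂ D₃ o o') (hZ' : Z₁' ++ (Z₂' ++ Z₃') = Z) {L : List ℕ}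
    {i₀ i₁ i₂ : ℕ} (hi₀ : i₀ ∈ Z₂ ∧ i₀ ∈ Z₂') (hi₁ : i₁ ∈ Z₂ ∧ i₁ ∉ Z₂')
    (hi₂ : i₂ ∉ Z₂ ∧ i₂ ∈ Z₂') (hL : ∀ i ∈ L, i ∈ Z) (hlen : L.length = Z₂.length)
    {φ : Letter → List Letter} {a b Q Ω Ω₁ Ω₂ X : List Letter} (hΩ : Ω = Ω₁ ++ (X ++ (X ++ Ω₂)))
    (hLΩ : Ω₁ ++ Ω₂ = (L.map z).flatMap φ) (ha : (pre s Z).flatMap φ <:+: a)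
    (hb : (suf s Z).flatMap φ <:+: b) (hc : Critical M s v Z Z₂ (del u a) (del u Ω) (del u b))
    (h : Eqv M (word s u Z₁' Z₂' Z₃') (del v (a ++ (Q ++ (Ω ++ (Q ++ b)))))) : False := by
  have hne : u ≠ v := by rcases hvu with ⟨rfl, rfl⟩ | ⟨rfl, rfl⟩ <;> simp
  have hv : v = x ∨ v = y := by rcases hvu with ⟨rfl, rfl⟩ | ⟨rfl, rfl⟩ <;> simp
  have hu : u = x ∨ u = y := by rcases hvu with ⟨rfl, rfl⟩ | ⟨rfl, rfl⟩ <;> simp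
  have hc' := hc
  obtain ⟨α, β, w₃, Y, ea, eb, -, hvΩ, -, -, hY, hZY, -, hiff⟩ := hc'
  obtain ⟨a₁, a₂, rfl, -, ha₂⟩ := del_eq_append_cons ea
  obtain ⟨b₁, b₂, rfl, hb₁, -⟩ := del_eq_append_cons eb
  have hvΩ : v ∉ Ω := fun hm => hvΩ (by simp [hm, hne.symm])
  -- positions of the labels with respect to `u`
  have pos : ∀ {Ω' b₁' : List Letter} {P P' : List Letter} {c : ℕ} {a₁' a₂' b₂' : List Letter},
      Eqv M (word s u Z₁' Z₂' Z₃')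
        (del v ((a₁' ++ r :: a₂') ++ (Q ++ (Ω' ++ (Q ++ (b₁' ++ q :: b₂')))))) →
      a₂' ++ (Q ++ (Ω' ++ (Q ++ b₁'))) = P ++ z c :: P' →
      (c ∈ Z₂' ↔ P.count u = 1) ∧ P.count u + P'.count u = 2 := by
    intro Ω' b₁' P P' c a₁' a₂' b₂' h e
    have e' : (a₁' ++ r :: a₂') ++ (Q ++ (Ω' ++ (Q ++ (b₁' ++ q :: b₂')))) =
        a₁' ++ r :: ((P ++ z c :: P') ++ q :: b₂') := by
      rw [← e]; simp
    rw [e', del_append, del_cons_ne (r_ne hv), del_append, del_append, del_cons_ne (q_ne hv),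
      del_cons_ne (z_ne hv c)] at h
    have := hP.position hu hM hT h
    rwa [count_del hne, count_del hne] at this
  have hmem : ∀ {i}, i ∈ Z₂ → z i ∈ Ω := fun hi => (mem_del.1 ((hiff _).2 hi)).1
  -- Without a `u` in `Ω` all its labels would be on the same side of both `u`, but `i₀` is enclosed
  -- by them and `i₁` is not.
  have h1 : 1 ≤ Ω.count u := by
    by_contra h0
    have h0 : Ω.count u = 0 := by omega
    have key : ∀ {i}, i ∈ Z₂ → (i ∈ Z₂' ↔ (a₂ ++ Q).count u = 1) := by
      intro i hi
      obtain ⟨P, P', rfl⟩ := List.append_of_mem (hmem hi)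
      have := (pos (P := a₂ ++ (Q ++ P)) (P' := P' ++ (Q ++ b₁)) (c := i) h (by simp)).1
      simp only [count_append] at h0 this ⊢
      rw [show P.count u = 0 by omega, Nat.add_zero] at this
      exact this
    exact hi₁.2 ((key hi₁.1).2 ((key hi₀.1).1 hi₀.2))
  -- The label `i₂` is outside of `Ω` but between the two `u`, so one of them is separated from `Ω`
  -- by it.
  have h2 : Ω.count u ≤ 1 := by
    have hm : z i₂ ∈ α ++ (del u Ω ++ β) := by
      rw [hY]
      have := hZY.subset (show i₂ ∈ Z by rw [← hZ']; simp [hi₂.2])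
      simpa using this
    have hm' : z i₂ ∉ del u Ω := fun hm => hi₂.1 ((hiff i₂).1 hm)
    simp only [mem_append, hm', false_or] at hm
    rcases hm with hm | hm
    · rw [← ha₂] at hm
      obtain ⟨P, P', rfl⟩ := List.append_of_mem (mem_del.1 hm).1
      have := pos (P := P) (P' := P' ++ (Q ++ (Ω ++ (Q ++ b₁)))) (c := i₂) h (by simp)
      simp only [count_append] at this
      have := this.1.1 hi₂.2
      omega
    · rw [← hb₁] at hm
      obtain ⟨P, P', rfl⟩ := List.append_of_mem (mem_del.1 hm).1
      have := pos (P := a₂ ++ (Q ++ (Ω ++ (Q ++ P)))) (P' := P') (c := i₂) h (by simp)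
      simp only [count_append] at this
      have := this.1.1 hi₂.2
      omega
  -- The square `XX` is free of `u`, and the other letters of `Ω` are not repeated.
  have hXn : X = [] := by
    rw [hΩ] at h2 hvΩ
    simp only [count_append] at h2
    have hX0 : u ∉ X := count_eq_zero.1 (by omega)
    have hn := hc.nodup hZ
    rw [hΩ] at hn
    simp only [del_append] at hn
    have := (List.nodup_append.1 hn).2.1
    rw [del_eq_self hX0] at this
    refine List.eq_nil_iff_forall_not_mem.2 fun c hc => ?_
    exact (List.nodup_append.1 this).2.2 c hc c (by simp [hc]) rfl
  subst hXn
  rw [nil_append, nil_append, hLΩ] at hΩ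
  have hdel : ∀ l : List Letter, del u (l.flatMap φ) = l.flatMap fun c => del u (φ c) := by
    intro l
    induction l with
    | nil => rfl
    | cons c l ih => simp [ih]
  have hinf : ∀ {l w : List Letter}, l <:+: w → del u l <:+: del u w := by
    rintro l w ⟨A, B, rfl⟩
    exact ⟨del u A, del u B, by simp⟩
  have hc2 := hc
  rw [hΩ, hdel] at hc2
  obtain ⟨f, hf, -⟩ := hc2.images hZ hZ₂ hL hlen (by rw [← hdel]; exact hinf ha)
    (by rw [← hdel]; exact hinf hb)
  have hu' : u ∈ Ω := List.count_pos_iff.1 h1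
  rw [hΩ] at hu'
  obtain ⟨c, hcL, hcu⟩ := List.mem_flatMap.1 hu'
  obtain ⟨j, hj, rfl⟩ := List.mem_map.1 hcL
  obtain ⟨l₁, l₂, rfl⟩ := List.append_of_mem hj
  set P := (l₁.map z).flatMap φ with hPdef
  set P' := (l₂.map z).flatMap φ with hP'def
  have hΩe : Ω = P ++ (φ (z j) ++ P') := by rw [hΩ]; simp [hPdef, hP'def]
  have hcount := h2
  rw [hΩe] at hcount
  simp only [count_append] at hcount
  have hcu' := List.count_pos_iff.2 hcu
  have hpair := eq_of_del_eq_singleton (z_ne hu (f j)) (hf j hj) (by omega)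
  have hvφ : v ∉ φ (z j) := fun hm => hvΩ (by rw [hΩe]; simp [hm])
  have hzφ : z (f j) ∈ φ (z j) := by rcases hpair with e | e <;> simp [e]
  -- the swap
  have swap : ∀ {c d : Letter}, φ (z j) = [c, d] →
      Eqv M (word s u Z₁' Z₂' Z₃') (del v ((a₁ ++ r :: a₂) ++ (Q ++ ((P ++ ([d, c] ++ P')) ++
        (Q ++ (b₁ ++ q :: b₂)))))) := by
    intro c d e
    rw [hΩe] at h
    have hcd : del v [c, d] = [c, d] := del_eq_self (e ▸ hvφ)
    have hdc : del v [d, c] = [d, c] := del_eq_self fun hm => hvφ (by rw [e]; simp at hm ⊢; tauto)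
    rcases z_mem_pre_or_suf s (hL j hj) with ⟨-, hm⟩ | ⟨-, hm⟩
    · obtain ⟨A, B, eA⟩ := (infix_flatMap_of_mem φ hm).trans ha
      rw [← eA, e] at h
      rw [← eA, e]
      refine h.trans ?_
      simp only [del_append, hcd, hdc]
      simpa using eqv_swap_right hM c d (del v A) (del v B ++ (del v Q ++ del v P))
        (del v P' ++ (del v Q ++ del v (b₁ ++ q :: b₂)))
    · obtain ⟨A, B, eB⟩ := (infix_flatMap_of_mem φ hm).trans hb
      rw [← eB, e] at h
      rw [← eB, e]
      refine h.trans ?_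
      simp only [del_append, hcd, hdc]
      simpa using eqv_swap_left hM c d (del v (a₁ ++ r :: a₂) ++ (del v Q ++ del v P))
        (del v P' ++ (del v Q ++ del v A)) (del v B)
  rw [hΩe] at h
  have hzu := z_ne hu (f j)
  rcases hpair with e | e
  · have k1 := pos (P := a₂ ++ (Q ++ (P ++ [u]))) (P' := P' ++ (Q ++ b₁)) (c := f j) h
      (by simp [e])
    have k2 := pos (P := a₂ ++ (Q ++ P)) (P' := u :: (P' ++ (Q ++ b₁))) (c := f j) (swap e)
      (by simp)
    have k3 := k1.1.symm.trans k2.1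
    have k4 := k1.2
    have k5 := k2.2
    simp only [count_append, count_cons_self, count_nil] at k3 k4 k5
    omega
  · have k1 := pos (P := a₂ ++ (Q ++ P)) (P' := u :: (P' ++ (Q ++ b₁))) (c := f j) h
      (by simp [e])
    have k2 := pos (P := a₂ ++ (Q ++ (P ++ [u]))) (P' := P' ++ (Q ++ b₁)) (c := f j) (swap e)
      (by simp)
    have k3 := k1.1.symm.trans k2.1
    have k4 := k1.2
    have k5 := k2.2
    simp only [count_append, count_cons_self, count_nil] at k3 k4 k5
    omega

/-! ### The words witnessing non-distributivity -/

/-- The word `… x z_g y (N) x z_h y …`. -/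
def wordA (s : ℕ → Bool) (N : List ℕ) (g h : ℕ) : List Letter :=
  pre s (g :: (N ++ [h])) ++ r :: x :: z g :: y :: (N.map z ++ x :: z h :: y :: q ::
    suf s (g :: (N ++ [h])))

/-- The word `… z_g y (N) x x z_h y …`. -/
def wordAx (s : ℕ → Bool) (N : List ℕ) (g h : ℕ) : List Letter :=
  pre s (g :: (N ++ [h])) ++ r :: z g :: y :: (N.map z ++ x :: x :: z h :: y :: q ::
    suf s (g :: (N ++ [h])))

/-- The word `… x z_g (N) x z_h y y …`. -/
def wordAy (s : ℕ → Bool) (N : List ℕ) (g h : ℕ) : List Letter :=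
  pre s (g :: (N ++ [h])) ++ r :: x :: z g :: (N.map z ++ x :: z h :: y :: y :: q ::
    suf s (g :: (N ++ [h])))

/-- The word `… z_g (N) x x z_h y y …`. -/
def wordAxy (s : ℕ → Bool) (N : List ℕ) (g h : ℕ) : List Letter :=
  pre s (g :: (N ++ [h])) ++ r :: z g :: (N.map z ++ x :: x :: z h :: y :: y :: q ::
    suf s (g :: (N ++ [h])))

/-- The words equivalent to `wordA` without `y`. -/
def ClassX (M : Type u) [Monoid M] (s : ℕ → Bool) (N : List ℕ) (g h : ℕ) (w : List Letter) : Prop :=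
  Eqv M (word s x [] (g :: N) [h]) w

/-- The words equivalent to `wordA` without `x`. -/
def ClassY (M : Type u) [Monoid M] (s : ℕ → Bool) (N : List ℕ) (g h : ℕ) (w : List Letter) : Prop :=
  Eqv M (word s y [g] (N ++ [h]) []) w

/-- The words that are equivalent to `wordA` after deleting `x` as well as after deleting `y`. -/
def ClassXY (M : Type u) [Monoid M] (s : ℕ → Bool) (N : List ℕ) (g h : ℕ) (w : List Letter) :
    Prop :=
  ClassX M s N g h (del y w) ∧ ClassY M s N g h (del x w)

theorem mem_of_mem_image {s : ℕ → Bool} {Z L : List ℕ} (hL : ∀ i ∈ L, i ∈ Z) {φ : Letter → List Letter}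
    {a b : List Letter} (ha : (pre s Z).flatMap φ <:+: a) (hb : (suf s Z).flatMap φ <:+: b)
    {c : Letter} (hc : c ∈ (L.map z).flatMap φ) : c ∈ a ∨ c ∈ b := by
  obtain ⟨d, hd, hc⟩ := List.mem_flatMap.1 hc
  obtain ⟨i, hi, rfl⟩ := List.mem_map.1 hd
  rcases z_mem_pre_or_suf s (hL i hi) with ⟨-, h⟩ | ⟨-, h⟩
  · exact Or.inl (ha.subset (List.mem_flatMap.2 ⟨_, h, hc⟩))
  · exact Or.inr (hb.subset (List.mem_flatMap.2 ⟨_, h, hc⟩))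

theorem classXY_wordA (s : ℕ → Bool) (N : List ℕ) (g h : ℕ) :
    ClassXY M s N g h (wordA s N g h) := by
  refine ⟨Eqv.of_eq ?_, Eqv.of_eq ?_⟩
  · simp [wordA, word, del_eq_self (notMem_pre (Or.inr rfl) s _),
      del_eq_self (notMem_suf (Or.inr rfl) s _), del_eq_self (notMem_map_z (Or.inr rfl) N),
      del_cons_ne]
  · simp [wordA, word, del_eq_self (notMem_pre (Or.inl rfl) s _),
      del_eq_self (notMem_suf (Or.inl rfl) s _), del_eq_self (notMem_map_z (Or.inl rfl) N),
      del_cons_ne]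

/-! ### Stability of the three languages under replacement in arbitrary contexts -/

section Config

variable {s : ℕ → Bool} {N : List ℕ} {g h n₁ n₂ : ℕ} (C : Config M s N g h n₁ n₂)
include C

/-- Here `Q = φ x` and `Ω` is the image of `z_g y N`. In the critical case `φ y` must be empty,
which leaves an image of `g :: N` as in `not_critical_y`. -/
theorem Config.classY_iff (a b : List Letter) (φ : Letter → List Letter) :
    ClassY M s N g h (a ++ (wordA s N g h).flatMap φ ++ b) ↔
      ClassY M s N g h (a ++ (wordAx s N g h).flatMap φ ++ b) := by
  obtain ⟨D₁, D₂, D₃, o', hP⟩ := C.patY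
  have hn := C.nodup
  set Z := g :: (N ++ [h]) with hZ
  have hZ' : [g] ++ ((N ++ [h]) ++ []) = Z := by simp [hZ]
  have e1 : a ++ (wordA s N g h).flatMap φ ++ b = (a ++ ((pre s Z).flatMap φ ++ φ r)) ++ (φ x ++
      ((φ (z g) ++ (φ y ++ (N.map z).flatMap φ)) ++ (φ x ++
      ((φ (z h) ++ φ y) ++ (φ q ++ ((suf s Z).flatMap φ ++ b)))))) := by
    simp [wordA, hZ]
  have e2 : a ++ (wordAx s N g h).flatMap φ ++ b = (a ++ ((pre s Z).flatMap φ ++ φ r)) ++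
      ((φ (z g) ++ (φ y ++ (N.map z).flatMap φ)) ++ (φ x ++ (φ x ++
      ((φ (z h) ++ φ y) ++ (φ q ++ ((suf s Z).flatMap φ ++ b)))))) := by
    simp [wordAx, hZ]
  rw [e1, e2]
  have ha : (pre s Z).flatMap φ <:+: a ++ ((pre s Z).flatMap φ ++ φ r) := ⟨a, φ r, by simp⟩
  have hb : (suf s Z).flatMap φ <:+: (φ (z h) ++ φ y) ++ (φ q ++ ((suf s Z).flatMap φ ++ b)) :=
    ⟨(φ (z h) ++ φ y) ++ φ q, b, by simp⟩
  have hΩ : ∀ c ∈ φ (z g) ++ (φ y ++ (N.map z).flatMap φ),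
      2 ≤ (φ (z g) ++ (φ y ++ (N.map z).flatMap φ)).count c ∨
      c ∈ a ++ ((pre s Z).flatMap φ ++ φ r) ∨
      c ∈ (φ (z h) ++ φ y) ++ (φ q ++ ((suf s Z).flatMap φ ++ b)) := by
    intro c hc
    right
    by_cases hy : c ∈ φ y
    · right; simp [hy]
    · refine mem_of_mem_image (L := g :: N) (fun i hi => ?_) ha hb ?_
      · simp only [hZ, mem_cons, mem_append] at hi ⊢; tauto
      · simp only [mem_append, hy, false_or, map_cons, flatMap_cons] at hc ⊢; exact hc
  constructor
  · intro hw
    have hw' := hw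
    rcases hP.transfer (Or.inr rfl) C.basic C.nontriv hΩ hw with h1 | ⟨-, hc⟩
    · exact hw'.trans h1
    exfalso
    rw [hZ'] at hc
    have hq : q ∉ φ (z h) ++ φ y := by
      intro hq
      rcases List.mem_append.1 hq with hq | hq
      · have h2 := count_linear (Or.inr rfl) C.basic C.nontriv hP.nodup hw (l := q) rfl
        simp only [count_append] at h2
        have h3 := List.count_pos_iff.2 hq
        rcases mem_of_mem_image (s := s) (Z := Z) (L := [h]) (by simp [hZ]) (List.infix_refl _)
          (List.infix_refl _) (φ := φ) (c := q) (by simpa using hq) with h4 | h4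
        · have := List.count_pos_iff.2 h4; omega
        · have := List.count_pos_iff.2 h4; omega
      · obtain ⟨i, -, h2⟩ := hc.exists_z (c := q) (by simp [hq])
        simp at h2
    -- Both copies of `φ y` lie before `q`, in the part of the middle where only the special letter
    -- of the class is repeated.
    have hy : φ y = [] := by
      have hn' := hc.nodup hn
      obtain ⟨α, β, w₃, Y, -, e, -, -, -, -, hY, hZY, -⟩ := hc
      have hnY : (α ++ ((φ (z g) ++ (φ y ++ (N.map z).flatMap φ)) ++ β)).Nodup := by
        rw [hY]; exact (hZY.nodup_iff.1 hn).map fun a b h => by simpa using h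
      rcases factor_split (A := []) hq e with ⟨E, e3, -⟩ | ⟨E, e3, -⟩
      · refine List.eq_nil_iff_forall_not_mem.2 fun c hc => ?_
        exact (List.nodup_append.1 (List.nodup_append.1 hnY).2.1).2.2 c (by simp [hc]) c
          (by rw [e3]; simp [hc]) rfl
      · simp at e3
    refine C.not_critical_y (ψ := φ) ?_ ha hb
    rw [hy] at hc ⊢
    simpa using hc
  · intro hw
    exact hw.trans (hP.transfer' (Or.inr rfl) C.basic C.nontriv hΩ hw).symm

/-- Symmetrically, `Q = φ y`; the first copy of `φ x` lies behind `r` and the second in `Ω`, so `φ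
x` is empty in the critical case. -/
theorem Config.classX_iff (a b : List Letter) (φ : Letter → List Letter) :
    ClassX M s N g h (a ++ (wordA s N g h).flatMap φ ++ b) ↔
      ClassX M s N g h (a ++ (wordAy s N g h).flatMap φ ++ b) := by
  obtain ⟨D₁, D₂, D₃, o', hP⟩ := C.patX
  have hn := C.nodup
  set Z := g :: (N ++ [h]) with hZ
  have hZ' : [] ++ ((g :: N) ++ [h]) = Z := by simp [hZ]
  have e1 : a ++ (wordA s N g h).flatMap φ ++ b = ((a ++ ((pre s Z).flatMap φ ++ φ r)) ++
      (φ x ++ φ (z g))) ++ (φ y ++ (((N.map z).flatMap φ ++ (φ x ++ φ (z h))) ++ (φ y ++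
      (φ q ++ ((suf s Z).flatMap φ ++ b))))) := by
    simp [wordA, hZ]
  have e2 : a ++ (wordAy s N g h).flatMap φ ++ b = ((a ++ ((pre s Z).flatMap φ ++ φ r)) ++
      (φ x ++ φ (z g))) ++ (((N.map z).flatMap φ ++ (φ x ++ φ (z h))) ++ (φ y ++ (φ y ++
      (φ q ++ ((suf s Z).flatMap φ ++ b))))) := by
    simp [wordAy, hZ]
  rw [e1, e2]
  have ha : (pre s Z).flatMap φ <:+: (a ++ ((pre s Z).flatMap φ ++ φ r)) ++ (φ x ++ φ (z g)) :=
    ⟨a, φ r ++ (φ x ++ φ (z g)), by simp⟩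
  have hb : (suf s Z).flatMap φ <:+: φ q ++ ((suf s Z).flatMap φ ++ b) := ⟨φ q, b, by simp⟩
  have hΩ : ∀ c ∈ (N.map z).flatMap φ ++ (φ x ++ φ (z h)),
      2 ≤ ((N.map z).flatMap φ ++ (φ x ++ φ (z h))).count c ∨
      c ∈ (a ++ ((pre s Z).flatMap φ ++ φ r)) ++ (φ x ++ φ (z g)) ∨
      c ∈ φ q ++ ((suf s Z).flatMap φ ++ b) := by
    intro c hc
    right
    by_cases hx : c ∈ φ x
    · left; simp [hx]
    · refine mem_of_mem_image (L := N ++ [h]) (fun i hi => ?_) ha hb ?_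
      · simp only [hZ, mem_cons, mem_append] at hi ⊢; tauto
      · simpa only [mem_append, hx, false_or, map_append, flatMap_append, map_cons, map_nil,
          flatMap_cons, flatMap_nil, append_nil] using hc
  constructor
  · intro hw
    have hw' := hw
    rcases hP.transfer (Or.inl rfl) C.basic C.nontriv hΩ hw with h1 | ⟨-, hc⟩
    · exact hw'.trans h1
    exfalso
    rw [hZ'] at hc
    have hr : r ∉ φ x ++ φ (z g) := by
      intro hr
      rcases List.mem_append.1 hr with hr | hr
      · obtain ⟨i, -, h2⟩ := hc.exists_z (c := r) (by simp [hr])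
        simp at h2
      · have h2 := count_linear (Or.inl rfl) C.basic C.nontriv hP.nodup hw (l := r) rfl
        simp only [count_append] at h2
        have h3 := List.count_pos_iff.2 hr
        rcases mem_of_mem_image (s := s) (Z := Z) (L := [g]) (by simp [hZ]) (List.infix_refl _)
          (List.infix_refl _) (φ := φ) (c := r) (by simpa using hr) with h4 | h4
        · have := List.count_pos_iff.2 h4; omega
        · have := List.count_pos_iff.2 h4; omega
    have hx : φ x = [] := by
      obtain ⟨α, β, w₃, Y, e, -, -, -, -, -, hY, hZY, -⟩ := hc
      have hnY : (α ++ (((N.map z).flatMap φ ++ (φ x ++ φ (z h))) ++ β)).Nodup := by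
        rw [hY]; exact (hZY.nodup_iff.1 hn).map fun a b h => by simpa using h
      rcases factor_split (A := a ++ ((pre s Z).flatMap φ ++ φ r)) (B := []) hr
        (by rw [append_nil]; exact e) with ⟨E, -, e3⟩ | ⟨E, -, e3⟩
      · simp at e3
      · refine List.eq_nil_iff_forall_not_mem.2 fun c hc => ?_
        exact (List.nodup_append.1 hnY).2.2 c (by rw [e3]; simp [hc]) c (by simp [hc]) rfl
    refine C.not_critical_x (ψ := φ) ?_ ha hb
    rw [hx] at hc ⊢
    simpa using hc
  · intro hw
    exact hw.trans (hP.transfer' (Or.inl rfl) C.basic C.nontriv hΩ hw).symm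

/-- The replacement is compared after each of the two deletions. A critical factor for one special
letter is excluded by membership of the same word in the language of the other. -/
theorem Config.classXY_iff {L : List ℕ} (hL : ∀ i ∈ L, i ∈ g :: (N ++ [h]))
    (hlen : L.length = N.length + 1) {φ : Letter → List Letter}
    {a b Q Ω Ω₁ Ω₂ X : List Letter} (hΩ : Ω = Ω₁ ++ (X ++ (X ++ Ω₂)))
    (hLΩ : Ω₁ ++ Ω₂ = (L.map z).flatMap φ) (ha : (pre s (g :: (N ++ [h]))).flatMap φ <:+: a)
    (hb : (suf s (g :: (N ++ [h]))).flatMap φ <:+: b) :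
    ClassXY M s N g h (a ++ (Q ++ (Ω ++ (Q ++ b)))) ↔
      ClassXY M s N g h (a ++ (Ω ++ (Q ++ (Q ++ b)))) := by
  obtain ⟨D₁, D₂, D₃, o, hX⟩ := C.patX
  obtain ⟨E₁, E₂, E₃, o', hY⟩ := C.patY
  have hn := C.nodup
  have hZX : [] ++ ((g :: N) ++ [h]) = g :: (N ++ [h]) := by simp
  have hZY : [g] ++ ((N ++ [h]) ++ []) = g :: (N ++ [h]) := by simp
  obtain ⟨N', hN'⟩ := C.eq_head
  have hn₁ : n₁ ∈ N := by simp [hN']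
  have hg : g ∉ N ++ [h] := (List.nodup_cons.1 hn).1
  have hh : h ∉ g :: N := by
    have := hn
    rw [← cons_append] at this
    exact fun hm => (List.nodup_append.1 this).2.2 h hm h (by simp) rfl
  have hdel : ∀ u : Letter, ∀ c ∈ del u Ω, 2 ≤ (del u Ω).count c ∨ c ∈ del u a ∨ c ∈ del u b := by
    intro u c hc
    have hcu : c ≠ u := (mem_del.1 hc).2
    have hc := (mem_del.1 hc).1
    simp only [mem_del, hcu, ne_eq, not_false_eq_true, and_true]
    rw [count_del hcu]
    by_cases hcX : c ∈ X
    · left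
      have := List.count_pos_iff.2 hcX
      rw [hΩ]
      simp only [count_append]
      omega
    · right
      refine mem_of_mem_image hL ha hb ?_
      rw [← hLΩ]
      rw [hΩ] at hc
      simpa [hcX] using hc
  simp only [ClassXY, ClassX, ClassY]
  constructor
  · rintro ⟨h1, h2⟩
    have h1' := h1
    have h2' := h2
    simp only [del_append] at h1' h2'
    constructor
    · rcases hX.transfer (Or.inl rfl) C.basic C.nontriv (hdel y) h1' with h3 | ⟨-, h3⟩
      · simpa only [del_append] using h1'.trans h3
      · rw [hZX] at h3
        exact (not_critical_of_both (Or.inl ⟨rfl, rfl⟩) C.basic C.nontriv hn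
          (hn.sublist (by simp)) hY hZY (i₀ := n₁) (i₁ := g) (i₂ := h)
          (by simp [hn₁]) ⟨by simp, hg⟩ ⟨hh, by simp⟩ hL (by simpa using hlen) hΩ hLΩ ha hb h3
          h2).elim
    · rcases hY.transfer (Or.inr rfl) C.basic C.nontriv (hdel x) h2' with h3 | ⟨-, h3⟩
      · simpa only [del_append] using h2'.trans h3
      · rw [hZY] at h3
        exact (not_critical_of_both (Or.inr ⟨rfl, rfl⟩) C.basic C.nontriv hn
          hn.of_cons hX hZX (i₀ := n₁) (i₁ := h) (i₂ := g)
          (by simp [hn₁]) ⟨by simp, hh⟩ ⟨hg, by simp⟩ hL (by simpa using hlen) hΩ hLΩ ha hb h3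
          h1).elim
  · rintro ⟨h1, h2⟩
    simp only [del_append] at h1 h2 ⊢
    exact ⟨h1.trans (hX.transfer' (Or.inl rfl) C.basic C.nontriv (hdel y) h1).symm,
      h2.trans (hY.transfer' (Or.inr rfl) C.basic C.nontriv (hdel x) h2).symm⟩

theorem Config.classXY_iff_x (a b : List Letter) (φ : Letter → List Letter) :
    ClassXY M s N g h (a ++ (wordAx s N g h).flatMap φ ++ b) ↔
      ClassXY M s N g h (a ++ (wordAxy s N g h).flatMap φ ++ b) := by
  set Z := g :: (N ++ [h]) with hZ
  have e1 : a ++ (wordAx s N g h).flatMap φ ++ b = (a ++ ((pre s Z).flatMap φ ++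
      (φ r ++ φ (z g)))) ++ (φ y ++ (((N.map z).flatMap φ ++ (φ x ++ (φ x ++ φ (z h)))) ++ (φ y ++
      (φ q ++ ((suf s Z).flatMap φ ++ b))))) := by
    simp [wordAx, hZ]
  have e2 : a ++ (wordAxy s N g h).flatMap φ ++ b = (a ++ ((pre s Z).flatMap φ ++
      (φ r ++ φ (z g)))) ++ (((N.map z).flatMap φ ++ (φ x ++ (φ x ++ φ (z h)))) ++ (φ y ++ (φ y ++
      (φ q ++ ((suf s Z).flatMap φ ++ b))))) := by
    simp [wordAxy, hZ]
  rw [e1, e2]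
  exact C.classXY_iff (φ := φ) (L := N ++ [h]) (fun i hi => List.mem_cons_of_mem _ hi) (by simp) rfl
    (by simp) ⟨a, φ r ++ φ (z g), by simp [hZ]⟩ ⟨φ q, b, by simp [hZ]⟩

theorem Config.classXY_iff_y (a b : List Letter) (φ : Letter → List Letter) :
    ClassXY M s N g h (a ++ (wordAy s N g h).flatMap φ ++ b) ↔
      ClassXY M s N g h (a ++ (wordAxy s N g h).flatMap φ ++ b) := by
  set Z := g :: (N ++ [h]) with hZ
  have e1 : a ++ (wordAy s N g h).flatMap φ ++ b = (a ++ ((pre s Z).flatMap φ ++ φ r)) ++ (φ x ++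
      (((g :: N).map z).flatMap φ ++ (φ x ++ (φ (z h) ++ (φ y ++ (φ y ++
      (φ q ++ ((suf s Z).flatMap φ ++ b)))))))) := by
    simp [wordAy, hZ]
  have e2 : a ++ (wordAxy s N g h).flatMap φ ++ b = (a ++ ((pre s Z).flatMap φ ++ φ r)) ++
      (((g :: N).map z).flatMap φ ++ (φ x ++ (φ x ++ (φ (z h) ++ (φ y ++ (φ y ++
      (φ q ++ ((suf s Z).flatMap φ ++ b)))))))) := by
    simp [wordAxy, hZ]
  rw [e1, e2]
  refine C.classXY_iff (φ := φ) (L := g :: N) (fun i hi => ?_) (by simp)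
    (Ω₁ := ((g :: N).map z).flatMap φ) (X := []) (Ω₂ := []) (by simp)
    (by simp) ⟨a, φ r, by simp [hZ]⟩
    ⟨φ (z h) ++ (φ y ++ (φ y ++ φ q)), b, by simp [hZ]⟩
  simp only [mem_cons, mem_append] at hi ⊢
  tauto

/-- Deleting `y` leaves a word with `x²` in the middle; it is killed, whereas the words of `ClassX`
are not. -/
theorem Config.not_classXY_wordAxy : ¬ ClassXY M s N g h (wordAxy s N g h) := by
  rintro ⟨h1, -⟩
  obtain ⟨D₁, D₂, D₃, o', hP⟩ := C.patX
  have hn := C.nodup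
  have h2 : Eqv M (word s x [] (g :: N) [h]) (pre s (g :: (N ++ [h])) ++
      r :: (((g :: N).map z ++ x :: x :: [z h]) ++ q :: suf s (g :: (N ++ [h])))) := by
    refine Eqv.trans h1 (Eqv.of_eq ?_)
    simp [wordAxy, del_eq_self (notMem_pre (Or.inr rfl) s _),
      del_eq_self (notMem_suf (Or.inr rfl) s _), del_eq_self (notMem_map_z (Or.inr rfl) N),
      del_cons_ne]
  have hv : x = x ∨ x = y := Or.inl rfl
  have h3 := killed_of_middle_square hv C.basic (s := s) (Z := g :: (N ++ [h]))
    (Y := g :: (N ++ [h])) (w₁ := pre s (g :: (N ++ [h]))) (α := (g :: N).map z) (β := [z h])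
    (w₃ := suf s (g :: (N ++ [h])))
    (del_eq_self (notMem_pre hv s _)) (by
      simp [del_eq_self (notMem_map_z hv N), del_cons_ne])
    (del_eq_self (notMem_suf hv s _)) (fun _ hi => hi) (Or.inl (notMem_pre hv s _))
  exact not_killed hv C.basic hP.nodup hP.good₁ hP.sub₁ h2 h3

end Config

/-! ### From the class `K` to a configuration -/

/-! ### Passage from the class `K` to minimal violated patterns -/

theorem basic_of_classK (h : MonVar.ClassK M) : Basic M := by
  have key : ∀ (X Y Z T : M) (e : MonVar.Identity), MonVar.Satisfies M e → ∃ φ : ℕ → M,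
      FreeMonoid.lift φ MonVar.x = X ∧ FreeMonoid.lift φ MonVar.y = Y ∧
      FreeMonoid.lift φ MonVar.z = Z ∧ FreeMonoid.lift φ MonVar.t = T ∧
      FreeMonoid.lift φ e.1 = FreeMonoid.lift φ e.2 := by
    intro X Y Z T e he
    refine ⟨fun n => if n = 0 then X else if n = 1 then Y else if n = 2 then Z else T,
      ?_, ?_, ?_, ?_, he _⟩ <;>
    simp [MonVar.x, MonVar.y, MonVar.z, MonVar.t]
  constructor
  · intro X Y T
    obtain ⟨φ, h1, h2, -, h4, e⟩ := key X Y 1 T _ h.id₁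
    simpa [h1, h2, h4, pow_two, mul_assoc] using e
  · intro X Y
    obtain ⟨φ, h1, h2, -, -, e⟩ := key X Y 1 1 _ h.id₂
    simpa [h1, h2, pow_two, mul_assoc] using e
  · intro X Y T
    obtain ⟨φ, h1, h2, -, h4, e⟩ := key X Y 1 T _ h.id₃
    simpa [h1, h2, h4, pow_two, mul_assoc] using e
  · intro X Y Z
    obtain ⟨φ, h1, h2, h3, -, e⟩ := key X Y Z 1 _ h.id₄
    simpa [h1, h2, h3, mul_assoc] using e
  · intro X Y Z
    obtain ⟨φ, h1, h2, h3, -, e⟩ := key X Y Z 1 _ h.id₅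
    simpa [h1, h2, h3, mul_assoc] using e

theorem exists_alternating_of_classK (h : MonVar.ClassK M) : ∃ (s : ℕ → Bool) (Z : List ℕ),
    Z.Nodup ∧ (Z.IsChain fun i j => s i ≠ s j) ∧ ¬ Collapses M s Z := by
  obtain ⟨n, m, ρ, -, hρ, hv⟩ := h.violates
  have hn : (List.ofFn fun i => (ρ i : ℕ)).Nodup :=
    List.nodup_ofFn.2 fun i j e => ρ.injective (Fin.ext e)
  have hmem : ∀ i, i ∈ List.ofFn (fun i => (ρ i : ℕ)) ↔ i < n + m := by
    intro i
    rw [List.mem_ofFn]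
    constructor
    · rintro ⟨j, rfl⟩; exact (ρ j).2
    · intro hi; exact ⟨ρ.symm ⟨i, hi⟩, by simp⟩
  refine ⟨fun i => decide (i < n), List.ofFn fun i => (ρ i : ℕ), hn, ?_, ?_⟩
  · rw [List.isChain_iff_getElem]
    intro i hi
    simp only [List.length_ofFn] at hi
    simp only [List.getElem_ofFn]
    have := hρ ⟨i, by omega⟩ ⟨i + 1, hi⟩ rfl
    rcases this with ⟨h1, h2⟩ | ⟨h1, h2⟩
    · simp [h1, not_lt.2 h2]
    · simp [h1, not_lt.2 h2]
  · intro hc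
    refine hv fun φ => ?_
    have e1 : lab (fun i => decide (i < n)) (List.ofFn fun i => (ρ i : ℕ)) = List.range n := by
      refine eq_of_pairwise_lt (lab_pairwise hn) List.pairwise_lt_range fun i => ?_
      rw [mem_lab, hmem]
      simp only [decide_eq_true_eq, mem_range]
      omega
    have e2 : lab (fun i => !decide (i < n)) (List.ofFn fun i => (ρ i : ℕ)) =
        List.range' n m := by
      refine eq_of_pairwise_lt (lab_pairwise hn) (List.pairwise_lt_range' (s := n) (n := m)) fun i => ?_
      rw [mem_lab, hmem]
      simp only [Bool.not_eq_true', decide_eq_false_iff_not, List.mem_range'_1]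
      omega
    have key := hc (ztWord (List.range n)) (tzWord (List.range' n m)) x
      (by rw [e1]; exact map_z_sublist_ztWord _) (by rw [e2]; exact map_z_sublist_tzWord _)
    let ψ : Letter → M := fun c => match c with
      | x => φ 0 | z i => φ (2 * i + 4) | t i => φ (2 * i + 5) | _ => 1
    have f1 : ∀ l : List ℕ, ((ztWord l).map ψ).prod =
        (l.map fun i => φ (2 * i + 4) * φ (2 * i + 5)).prod := by
      intro l; induction l with
      | nil => rfl
      | cons i l ih => simp [ih, ψ, mul_assoc]
    have f2 : ∀ l : List ℕ, ((tzWord l).map ψ).prod =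
        (l.map fun i => φ (2 * i + 5) * φ (2 * i + 4)).prod := by
      intro l; induction l with
      | nil => rfl
      | cons i l ih => simp [ih, ψ, mul_assoc]
    have g1 : FreeMonoid.lift φ (MonVar.prefixWord n) = ((ztWord (List.range n)).map ψ).prod := by
      rw [f1, MonVar.prefixWord, map_list_prod, List.map_ofFn]
      congr 1
      refine List.ext_getElem (by simp) fun i h1 h2 => ?_
      simp [MonVar.zi, MonVar.ti]
    have g2 : FreeMonoid.lift φ (MonVar.suffixWord n m) =
        ((tzWord (List.range' n m)).map ψ).prod := by
      rw [f2, MonVar.suffixWord, map_list_prod, List.map_ofFn]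
      congr 1
      refine List.ext_getElem (by simp) fun i h1 h2 => ?_
      simp [MonVar.zi, MonVar.ti]
    have g3 : FreeMonoid.lift φ (MonVar.middleWord n m ρ) =
        (((List.ofFn fun i => (ρ i : ℕ)).map z).map ψ).prod := by
      rw [MonVar.middleWord, map_list_prod, List.map_ofFn, List.map_ofFn, List.map_ofFn]
      congr 1
    have := key ψ
    have hx : ψ x = φ 0 := rfl
    have hx' : FreeMonoid.lift φ MonVar.x = φ 0 := by simp [MonVar.x]
    simpa [MonVar.aHat, MonVar.aHat', g1, g2, g3, hx, hx', pow_two, mul_assoc] using this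

theorem exists_good {s : ℕ → Bool} : ∀ (k : ℕ) {Z : List ℕ}, Z.length = k → Z.Nodup →
    (Z.IsChain fun i j => s i ≠ s j) → ¬ Collapses M s Z → ∃ D, Good M s D := by
  intro k
  induction k with
  | zero =>
    intro Z hZ _ _ h
    rw [List.length_eq_zero_iff.1 hZ] at h
    exact absurd (collapses_nil s) h
  | succ k ih =>
    intro Z hZ hn hc h
    by_cases h1 : Collapses M s Z.tail
    · by_cases h2 : Collapses M s Z.dropLast
      · exact ⟨Z, hn, hc, h, h1, h2⟩
      · exact ih (by simp [hZ]) (hn.sublist (List.dropLast_sublist Z)) hc.dropLast h2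
    · exact ih (by simp [hZ]) (hn.sublist (List.tail_sublist Z)) hc.tail h1

theorem good_singleton {s : ℕ → Bool} {i : ℕ} (h : ¬ Collapses M s [i]) : Good M s [i] :=
  ⟨by simp, by simp, h, collapses_nil s, collapses_nil s⟩

/-- If `SatLeft` or `SatRight` fails, a single label is already violated, of prefix type in the
first case and of suffix type in the second. The extra alternatives are what the fields `left` and
`right` of `Pattern` need. -/
theorem exists_good_of_classK (h : MonVar.ClassK M) : ∃ (s : ℕ → Bool) (D : List ℕ),
    Good M s D ∧ (SatRight M ∨ D.length = 1) ∧ (SatLeft M ∨ ∀ i, s i = true) := by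
  by_cases hL : SatLeft M
  · by_cases hR : SatRight M
    · obtain ⟨s, Z, h1, h2, h3⟩ := exists_alternating_of_classK h
      obtain ⟨D, hD⟩ := exists_good _ rfl h1 h2 h3
      exact ⟨s, D, hD, Or.inl hR, Or.inl hL⟩
    · refine ⟨fun _ => false, [0], good_singleton fun hc => hR fun Z V B => ?_,
        Or.inr rfl, Or.inl hL⟩
      have := hc [] [t 0, z 0] x (by simp [lab]) (by simp [lab])
        (fun c => match c with | x => V | z _ => Z | t _ => B | _ => 1)
      simpa using this
  · refine ⟨fun _ => true, [0], good_singleton fun hc => hL fun Z V A => ?_, Or.inr rfl,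
      Or.inr fun _ => rfl⟩
    have := hc [z 0, t 0] [] x (by simp [lab]) (by simp [lab])
      (fun c => match c with | x => V | z _ => Z | t _ => A | _ => 1)
    simpa using this

/-- Division by 3 undoes the spreading, so both the collapses and the violation are carried over by
relabelling. -/
theorem Good.lift {s : ℕ → Bool} {D : List ℕ} (h : Good M s D) {σ : ℕ → ℕ}
    (hσ : ∀ k, σ k / 3 = k) : Good M (fun i => s (i / 3)) (D.map σ) := by
  have hmono : StrictMono σ := by
    intro i j hij
    have h1 := hσ i
    have h2 := hσ j
    omega
  have hback : (D.map σ).map (· / 3) = D := by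
    rw [List.map_map]
    exact (List.map_congr_left fun i _ => hσ i).trans (List.map_id D)
  have hn := h.nodup.map hmono.injective
  refine ⟨hn, ?_, ?_, ?_, ?_⟩
  · rw [List.isChain_map]
    simpa [hσ] using h.chain
  · intro hc
    refine h.not_collapses ?_
    rw [← hback]
    refine hc.relabel hn ?_ fun i _ => rfl
    intro i hi j hj hij
    obtain ⟨i, -, rfl⟩ := List.mem_map.1 hi
    obtain ⟨j, -, rfl⟩ := List.mem_map.1 hj
    simpa [hσ] using hmono.lt_iff_lt.1 hij
  · rw [← List.map_tail]
    exact h.tail.relabel (h.nodup.sublist (List.tail_sublist D)) (hmono.strictMonoOn _)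
      fun i _ => by simp [hσ]
  · rw [← List.map_dropLast]
    exact h.dropLast.relabel (h.nodup.sublist (List.dropLast_sublist D)) (hmono.strictMonoOn _)
      fun i _ => by simp [hσ]

/-- Otherwise the last `z k` could be exchanged with the second `v`, and the two `v` would enclose
only the collapsing part `D`. -/
theorem Good.not_satSecond (hM : Basic M) {s : ℕ → Bool} {D : List ℕ} {k : ℕ}
    (h : Good M s (D ++ [k])) (hk : s k = true) : ¬ SatSecond M := by
  intro hS
  have hD : Collapses M s D := by simpa using h.dropLast
  refine h.not_killed (v := x) (Or.inl rfl) hM ?_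
  refine Killed.congr ?_ (hD.killed_word (Or.inl rfl) hM
    (A := []) (B := [k]) (by simpa using h.nodup))
  have hm : z k ∈ pre s (D ++ [k]) := by simp [pre, hk]
  obtain ⟨a, b, e⟩ := List.append_of_mem hm
  intro φ
  have := congrArg (fun m => (a.map φ).prod * (m * ((q :: suf s (D ++ [k])).map φ).prod))
    (hS (φ (z k)) (φ x) (((b ++ [r]).map φ).prod) ((D.map z).map φ).prod)
  simp [word, e, mul_assoc] at this ⊢
  exact this

/-- The mirror image: the first `z k` would be exchanged with the first `v`. -/
theorem Good.not_satFirst (hM : Basic M) {s : ℕ → Bool} {D : List ℕ} {k : ℕ}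
    (h : Good M s (k :: D)) (hk : s k = false) : ¬ SatFirst M := by
  intro hS
  have hD : Collapses M s D := by simpa using h.tail
  refine h.not_killed (v := x) (Or.inl rfl) hM ?_
  refine Killed.congr ?_ (hD.killed_word (Or.inl rfl) hM
    (A := [k]) (B := []) (by simpa using h.nodup))
  have hm : z k ∈ suf s (k :: D) := by simp [suf, hk]
  obtain ⟨a, b, e⟩ := List.append_of_mem hm
  intro φ
  have := congrArg (fun m => (((pre s (k :: D)) ++ [r]).map φ).prod * (m * (b.map φ).prod))
    (hS (φ x) (φ (z k)) ((D.map z).map φ).prod (((q :: a).map φ).prod))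
  simp [word, e, mul_assoc] at this ⊢
  exact this

/-! ### The configuration of a good pattern -/

/-- The relabelling `k ↦ 3k + 2`, except that `i ↦ 3i` and `j ↦ 3j + 1` for the given labels. -/
def spread (i j : Option ℕ) (k : ℕ) : ℕ :=
  if some k = i then 3 * k else if some k = j then 3 * k + 1 else 3 * k + 2

theorem spread_div (i j : Option ℕ) (k : ℕ) : spread i j k / 3 = k := by
  unfold spread; split_ifs <;> omega

theorem map_spread_left {k : ℕ} {D : List ℕ} (h : k ∉ D) (j : Option ℕ) :
    (k :: D).map (spread (some k) j) = 3 * k :: D.map (spread none j) := by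
  rw [List.map_cons]
  congr 1
  · simp [spread]
  · refine List.map_congr_left fun i hi => ?_
    have : i ≠ k := fun e => h (e ▸ hi)
    simp [spread, this]

theorem map_spread_right {k : ℕ} {D : List ℕ} (h : k ∉ D) :
    (D ++ [k]).map (spread none (some k)) = D.map (spread none none) ++ [3 * k + 1] := by
  rw [List.map_append]
  congr 1
  · refine List.map_congr_left fun i hi => ?_
    have : i ≠ k := fun e => h (e ▸ hi)
    simp [spread, this]
  · simp [spread]

/-- `N` is `D` spread over the residue 2 modulo 3. This leaves room for `g = 3k` just below the
first label and `h = 3l + 1` just below the last one. Replacing an end of `N` by its twin, or both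
ends, gives further copies of `D`, and these are the violated patterns required. -/
theorem exists_config (h : MonVar.ClassK M) :
    ∃ s N g h n₁ n₂, Config M s N g h n₁ n₂ := by
  obtain ⟨s, D, hD, hR, hL⟩ := exists_good_of_classK h
  have hM := basic_of_classK h
  have hT : ¬ Trivializes M := fun hT => hD.not_collapses (hT.collapses s D)
  obtain ⟨k, D', hk⟩ := List.exists_cons_of_ne_nil hD.ne_nil
  obtain ⟨D'', l, hl⟩ : ∃ D'' l, D = D'' ++ [l] :=
    ⟨D.dropLast, D.getLast hD.ne_nil, (List.dropLast_append_getLast hD.ne_nil).symm⟩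
  have hkD : k ∉ D' := by have := hD.nodup; rw [hk] at this; exact (List.nodup_cons.1 this).1
  have hlD : l ∉ D'' := by
    have := hD.nodup; rw [hl] at this
    exact fun hm => (List.nodup_append.1 this).2.2 l hm l (by simp) rfl
  have hsingle : D.length = 1 → D' = [] ∧ D'' = [] ∧ l = k := by
    intro h1
    have h2 : D' = [] := by rw [hk] at h1; simpa using h1
    have h3 : D'' = [] := by rw [hl] at h1; simpa using h1
    subst h2 h3
    rw [hk] at hl
    simpa using hl.symm
  set N := D.map (spread none none) with hN
  have eN : N = (3 * k + 2) :: D'.map (spread none none) := by rw [hN, hk]; simp [spread]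
  have eN' : N = D''.map (spread none none) ++ [3 * l + 2] := by rw [hN, hl]; simp [spread]
  have eG : D.map (spread (some k) none) = 3 * k :: D'.map (spread none none) := by
    rw [hk, map_spread_left hkD]
  have eH : D.map (spread none (some l)) = D''.map (spread none none) ++ [3 * l + 1] := by
    rw [hl, map_spread_right hlD]
  have eGH : D.map (spread (some k) (some l)) = 3 * k :: D'.map (spread none (some l)) := by
    rw [hk, map_spread_left hkD]
  have gN := hD.lift (spread_div none none)
  have gG := hD.lift (spread_div (some k) none)
  have gH := hD.lift (spread_div none (some l))
  have gGH := hD.lift (spread_div (some k) (some l))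
  have hres : ∀ i ∈ N, ∃ j, i = 3 * j + 2 := by
    intro i hi
    obtain ⟨j, -, rfl⟩ := List.mem_map.1 hi
    exact ⟨j, by simp [spread]⟩
  have hnodup : (3 * k :: (N ++ [3 * l + 1])).Nodup := by
    rw [List.nodup_cons, List.nodup_append]
    refine ⟨?_, gN.nodup, by simp, ?_⟩
    · simp only [mem_append, mem_singleton, not_or]
      refine ⟨fun hm => ?_, by omega⟩
      obtain ⟨j, hj⟩ := hres _ hm
      omega
    · intro i hi i' hi'
      obtain ⟨j, rfl⟩ := hres _ hi
      simp only [mem_singleton] at hi'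
      omega
  -- For a one-element `D` the first label is also the last, and the twin of `g` in the second
  -- pattern is `h = 3k + 1` instead of `3k + 2`.
  have hsp : (k ≠ l ∧ spread none (some l) k = 3 * k + 2) ∨
      (k = l ∧ spread none (some l) k = 3 * k + 1) := by
    by_cases h : k = l
    · right; simp [spread, h]
    · left; simp [spread, h]
  have subH : D.map (spread none (some l)) <+ N ++ [3 * l + 1] := by
    rw [eH, eN']
    exact (List.sublist_append_left _ _).append (List.Sublist.refl _)
  have htail : D'.map (spread none (some l)) <+ N ++ [3 * l + 1] := by
    refine List.Sublist.trans ?_ subH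
    rw [hk]
    exact List.sublist_cons_self _ _
  refine ⟨fun i => s (i / 3), N, 3 * k, 3 * l + 1, 3 * k + 2, 3 * l + 2, hM, hT,
    ⟨N, D.map (spread (some k) none), D.map (spread none (some l)), 3 * l + 2, ?_⟩,
    ⟨D.map (spread none (some l)), N, D.map (spread (some k) (some l)), spread none (some l) k, ?_⟩,
    ⟨_, eN⟩, ⟨_, eN'⟩, by omega, by omega, ?_, ?_, ?_, ?_⟩
  · refine
      { nodup := by simpa using hnodup
        good₁ := gN
        good₂ := gG
        good₃ := gH
        sub₁ := List.sublist_cons_self _ _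
        sub₂ := ?_
        cover := ?_
        outer := Or.inr ⟨rfl, rfl⟩
        sub₃ := ?_
        mem₃ := by rw [eH]; simp
        map₃ := ?_
        type_eq := ?_
        lt := by omega
        adj := by intro i _; omega
        left := ?_
        right := hL.imp id fun h i _ => h _ }
    · rw [eG, eN]
      exact (List.sublist_cons_self _ _).cons_cons _
    · intro i hi
      rcases List.mem_cons.1 hi with rfl | hi
      · right; rw [eG]; simp
      · exact Or.inl hi
    · exact subH.cons _
    · rw [hN, List.map_map]
      refine List.map_congr_left fun i _ => ?_
      by_cases hi : i = l
      · simp [spread, hi]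
      · have : 3 * i + 2 ≠ 3 * l + 1 := by omega
        simp [spread, hi, Function.update_of_ne this]
    · rw [show (3 * l + 1) / 3 = l by omega, show (3 * l + 2) / 3 = l by omega]
    · refine hR.imp id fun h1 j => ?_
      obtain ⟨rfl, -, -⟩ := hsingle h1
      rw [eN, eG]
      simp only [map_nil, mem_singleton]
      omega
  · refine
      { nodup := by simpa using hnodup
        good₁ := gH
        good₂ := gN
        good₃ := gGH
        sub₁ := subH
        sub₂ := List.sublist_append_left _ _
        cover := ?_
        outer := Or.inl ⟨rfl, rfl⟩
        sub₃ := ?_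
        mem₃ := by rw [eGH]; simp
        map₃ := ?_
        type_eq := ?_
        lt := by omega
        adj := ?_
        left := ?_
        right := hL.imp id fun h i _ => h _ }
    · intro i hi
      rcases List.mem_append.1 hi with hi | hi
      · exact Or.inr hi
      · left; rw [eH]; exact List.mem_append_right _ hi
    · rw [eGH, append_nil]
      exact htail.cons_cons _
    · rw [List.map_map]
      refine List.map_congr_left fun i _ => ?_
      by_cases hi : i = k
      · simp [spread, hi]
      · have h1 : spread (some k) (some l) i = spread none (some l) i := by simp [spread, hi]
        have h2 : spread none (some l) i ≠ 3 * k := by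
          unfold spread; split_ifs <;> simp_all <;> omega
        rw [Function.comp_apply, h1, Function.update_of_ne h2]
        rfl
    · rw [spread_div, show (3 * k) / 3 = k by omega]
    · intro i hi
      simp only [append_nil, cons_append, nil_append, mem_cons, mem_append, not_mem_nil,
        or_false] at hi
      rcases hi with rfl | hi | rfl
      · left; omega
      · obtain ⟨j, rfl⟩ := hres _ hi
        omega
      · omega
    · refine hR.imp id fun h1 j => ?_
      obtain ⟨-, rfl, -⟩ := hsingle h1
      rw [eN', eH]
      simp only [map_nil, nil_append, mem_singleton]
      omega
  · rw [show (3 * k) / 3 = k by omega, show (3 * k + 2) / 3 = k by omega]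
  · rw [show (3 * l + 1) / 3 = l by omega, show (3 * l + 2) / 3 = l by omega]
  · rw [show (3 * k + 2) / 3 = k by omega]
    exact Good.not_satFirst hM (hk ▸ hD)
  · rw [show (3 * l + 2) / 3 = l by omega]
    exact Good.not_satSecond hM (hl ▸ hD)

/-! ### Syntactic monoids -/

/-- The syntactic congruence of a language. -/
def synCon (C : List Letter → Prop) : Con (FreeMonoid Letter) where
  r p q := ∀ a b : List Letter, C (a ++ FreeMonoid.toList p ++ b) ↔ C (a ++ FreeMonoid.toList q ++ b)
  iseqv := ⟨fun _ _ _ => Iff.rfl, fun h a b => (h a b).symm, fun h h' a b => (h a b).trans (h' a b)⟩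
  mul' := by
    intro p p' q q' h h' a b
    have h1 := h a (FreeMonoid.toList q ++ b)
    have h2 := h' (a ++ FreeMonoid.toList p') b
    simp only [FreeMonoid.toList_mul, append_assoc] at h1 h2 ⊢
    exact h1.trans h2

theorem synCon_iff {C : List Letter → Prop} {p q : FreeMonoid Letter} : synCon C p q ↔
    ∀ a b : List Letter, C (a ++ FreeMonoid.toList p ++ b) ↔ C (a ++ FreeMonoid.toList q ++ b) :=
  Iff.rfl

/-- The syntactic monoid of a language. -/
abbrev Syn (C : List Letter → Prop) : Type u := ULift.{u} (synCon C).Quotient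

theorem satisfies_syn_iff {C : List Letter → Prop} {e : MonVar.Identity} :
    MonVar.Satisfies (Syn.{u} C) e ↔
      ∀ ψ : ℕ → FreeMonoid Letter, synCon C (FreeMonoid.lift ψ e.1) (FreeMonoid.lift ψ e.2) := by
  have key : ∀ (ψ : ℕ → FreeMonoid Letter) (w : MonVar.Word),
      FreeMonoid.lift (fun n => (ULift.up ((ψ n : FreeMonoid Letter) : (synCon C).Quotient) :
        Syn.{u} C)) w = ULift.up ((FreeMonoid.lift ψ w : FreeMonoid Letter) : (synCon C).Quotient) := by
    intro ψ w
    induction w using FreeMonoid.inductionOn' with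
    | one => rfl
    | of_mul n w ih => rw [map_mul, map_mul, ih, FreeMonoid.lift_eval_of, FreeMonoid.lift_eval_of]; rfl
  constructor
  · intro h ψ
    have := h fun n => ULift.up ((ψ n : FreeMonoid Letter) : (synCon C).Quotient)
    rw [key, key] at this
    exact (Con.eq _).1 (congrArg ULift.down this)
  · intro h φ
    have hs : ∀ n, ∃ p : FreeMonoid Letter, φ n = ULift.up ((p : FreeMonoid Letter) : (synCon C).Quotient) := by
      intro n
      obtain ⟨p, hp⟩ := Con.mk'_surjective (φ n).down
      exact ⟨p, by rw [show ((p : FreeMonoid Letter) : (synCon C).Quotient) = (φ n).down from hp]⟩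
    choose ψ hψ using hs
    rw [funext hψ, key, key]
    exact congrArg ULift.up ((Con.eq _).2 (h ψ))

theorem prod_toList_lift (φ : Letter → M) (ψ : ℕ → FreeMonoid Letter) (w : MonVar.Word) :
    ((FreeMonoid.toList (FreeMonoid.lift ψ w)).map φ).prod =
      FreeMonoid.lift (fun n => ((FreeMonoid.toList (ψ n)).map φ).prod) w := by
  induction w using FreeMonoid.inductionOn' with
  | one => rfl
  | of_mul n w ih => simp [ih]

/-- A language closed under the equivalence of `M` has a syntactic congruence containing that
equivalence, so its syntactic monoid lies in the variety of `M`. -/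
theorem satisfies_syn_of_saturated {C : List Letter → Prop}
    (hC : ∀ u w, Eqv M u w → C u → C w) {e : MonVar.Identity} (he : MonVar.Satisfies M e) :
    MonVar.Satisfies (Syn.{u} C) e := by
  refine satisfies_syn_iff.2 fun ψ => synCon_iff.2 fun a b => ?_
  have h : Eqv M (FreeMonoid.toList (FreeMonoid.lift ψ e.1))
      (FreeMonoid.toList (FreeMonoid.lift ψ e.2)) := fun φ => by
    rw [prod_toList_lift, prod_toList_lift, he]
  exact ⟨hC _ _ ((h.left a).right b), hC _ _ ((h.symm.left a).right b)⟩

theorem del_toList_lift (v : Letter) (ψ : ℕ → FreeMonoid Letter) (w : MonVar.Word) :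
    del v (FreeMonoid.toList (FreeMonoid.lift ψ w)) = FreeMonoid.toList
      (FreeMonoid.lift (fun n => FreeMonoid.ofList (del v (FreeMonoid.toList (ψ n)))) w) := by
  induction w using FreeMonoid.inductionOn' with
  | one => rfl
  | of_mul n w ih => simp [ih]

/-- Deleting a letter from an instance of an identity gives another instance, so both halves of the
language can be tested separately. -/
theorem satisfies_syn_del {C C' : List Letter → Prop} {v u : Letter} {e : MonVar.Identity}
    (h : MonVar.Satisfies (Syn.{u} C) e) (h' : MonVar.Satisfies (Syn.{u} C') e) :
    MonVar.Satisfies (Syn.{u} fun w => C (del v w) ∧ C' (del u w)) e := by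
  refine satisfies_syn_iff.2 fun ψ => synCon_iff.2 fun a b => ?_
  simp only [del_append, del_toList_lift]
  exact and_congr (synCon_iff.1 (satisfies_syn_iff.1 h _) _ _)
    (synCon_iff.1 (satisfies_syn_iff.1 h' _) _ _)

/-- The letters as elements of the alphabet `ℕ`. -/
def enc : Letter → ℕ
  | x => 0
  | y => 1
  | r => 2
  | q => 3
  | z i => 2 * i + 4
  | t i => 2 * i + 5

/-- A left inverse of `enc`. -/
def dec (n : ℕ) : Letter :=
  if n = 0 then x else if n = 1 then y else if n = 2 then r else if n = 3 then q else
    if n % 2 = 0 then z (n / 2 - 2) else t (n / 2 - 2)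

theorem dec_enc (c : Letter) : dec (enc c) = c := by
  cases c with
  | x | y | r | q => rfl
  | z i =>
    have h : (2 * i + 4) / 2 - 2 = i := by omega
    simp [dec, enc, h]
  | t i =>
    have h1 : (2 * i + 5) % 2 = 1 := by omega
    have h2 : (2 * i + 5) / 2 - 2 = i := by omega
    simp [dec, enc, h1, h2]

/-- A word over `Letter` as a word over the alphabet `ℕ`. -/
def encWord (w : List Letter) : MonVar.Word := FreeMonoid.ofList (w.map enc)

theorem toList_lift_encWord (ψ : ℕ → FreeMonoid Letter) (w : List Letter) :
    FreeMonoid.toList (FreeMonoid.lift ψ (encWord w)) =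
      w.flatMap fun c => FreeMonoid.toList (ψ (enc c)) := by
  induction w with
  | nil => rfl
  | cons c w ih =>
    rw [flatMap_cons, ← ih]
    simp [encWord, FreeMonoid.ofList_cons]

theorem satisfies_syn_encWord {C : List Letter → Prop} {u w : List Letter}
    (h : ∀ (a b : List Letter) (φ : Letter → List Letter),
      C (a ++ u.flatMap φ ++ b) ↔ C (a ++ w.flatMap φ ++ b)) :
    MonVar.Satisfies (Syn.{u} C) (encWord u, encWord w) := by
  refine satisfies_syn_iff.2 fun ψ => synCon_iff.2 fun a b => ?_
  rw [toList_lift_encWord, toList_lift_encWord]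
  exact h a b _

theorem mem_iff_of_satisfies_syn {C : List Letter → Prop} {u w : List Letter}
    (h : MonVar.Satisfies (Syn.{u} C) (encWord u, encWord w)) : C u ↔ C w := by
  have := synCon_iff.1 (satisfies_syn_iff.1 h fun n => FreeMonoid.of (dec n)) [] []
  simpa [toList_lift_encWord, dec_enc] using this

theorem generatedBy_le_iff {N : Type u} [Monoid N] {S : Set MonVar.Identity} :
    MonVar.Variety.generatedBy N ≤ MonVar.Variety.ofIdentities S ↔ S ⊆ MonVar.identitiesOf N :=
  MonVar.Variety.le_ofIdentities_iff.trans
    ⟨fun h _ he => h he _ (MonVar.Variety.isLeast_generatedBy N).1,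
      fun h _ he _ hN => hN _ (h he)⟩

/-! ### Failure of the distributive law -/

theorem Config.not_isDistributive {s : ℕ → Bool} {N : List ℕ} {g h n₁ n₂ : ℕ}
    (C : Config M s N g h n₁ n₂) : ¬ MonVar.IsDistributive
      (MonVar.Variety.SubvarietyLattice (MonVar.Variety.generatedBy M)) := by
  intro hd
  have hX : ∀ u w, Eqv M u w → ClassX M s N g h u → ClassX M s N g h w := fun _ _ h h' => h'.trans h
  have hY : ∀ u w, Eqv M u w → ClassY M s N g h u → ClassY M s N g h w := fun _ _ h h' => h'.trans h
  have hXY : ∀ u w, Eqv M u w → ClassXY M s N g h u → ClassXY M s N g h w := fun _ _ h h' =>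
    ⟨h'.1.trans (h.filter _), h'.2.trans (h.filter _)⟩
  set V := MonVar.Variety.generatedBy M
  set A := MonVar.Variety.generatedBy (Syn.{u} (ClassXY M s N g h)) with hA
  set B := MonVar.Variety.generatedBy (Syn.{u} (ClassX M s N g h)) with hB
  set D := MonVar.Variety.generatedBy (Syn.{u} (ClassY M s N g h)) with hD
  have hAV : A ≤ V := generatedBy_le_iff.2 fun _ he => satisfies_syn_of_saturated hXY he
  have hBV : B ≤ V := generatedBy_le_iff.2 fun _ he => satisfies_syn_of_saturated hX he
  have hDV : D ≤ V := generatedBy_le_iff.2 fun _ he => satisfies_syn_of_saturated hY he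
  have hle : A ≤ B ⊔ D := by
    refine generatedBy_le_iff.2 fun e he => ?_
    exact satisfies_syn_del (he.1 _ (MonVar.Variety.isLeast_generatedBy _).1)
      (he.2 _ (MonVar.Variety.isLeast_generatedBy _).1)
  have hdist : A ⊓ (B ⊔ D) = (A ⊓ B) ⊔ (A ⊓ D) :=
    congrArg Subtype.val (hd ⟨A, hAV⟩ ⟨B, hBV⟩ ⟨D, hDV⟩)
  rw [inf_eq_left.2 hle] at hdist
  have hsat : A ≤ MonVar.Variety.ofIdentities {(encWord (wordA s N g h), encWord (wordAxy s N g h))} := by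
    rw [hdist]
    refine sup_le ?_ ?_
    -- In `A ⊓ B` the path is `wordA ≈ wordAy ≈ wordAxy`.
    · rintro K ⟨hK, hK'⟩ e rfl φ
      exact (hK' _ (satisfies_syn_encWord C.classX_iff) φ).trans
        (hK _ (satisfies_syn_encWord C.classXY_iff_y) φ)
    -- In `A ⊓ D` the path is `wordA ≈ wordAx ≈ wordAxy`.
    · rintro K ⟨hK, hK'⟩ e rfl φ
      exact (hK' _ (satisfies_syn_encWord C.classY_iff) φ).trans
        (hK _ (satisfies_syn_encWord C.classXY_iff_x) φ)
  have := generatedBy_le_iff.1 hsat rfl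
  exact C.not_classXY_wordAxy ((mem_iff_of_satisfies_syn this).1 (classXY_wordA s N g h))

end KVariety

theorem mainTheorem9 (M : Type u) [Monoid M] (hM : MonVar.ClassK M) :
    ¬ MonVar.IsDistributive
        (MonVar.Variety.SubvarietyLattice (MonVar.Variety.generatedBy M)) := by
  obtain ⟨s, N, g, h, n₁, n₂, C⟩ := KVariety.exists_config hM
  exact C.not_isDistributive
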